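/- **Setting.** For a finite family (multiset) $S_0$ of $n\ge 1$ points of $\mathbb R^d$, a vector $\mu\in\mathbb R^d$ and $\epsilon',\delta>0$, call $S_0$ *$(\epsilon',\delta)$-stable with respect to $\mu$* if for every $w:\mathbb R^d\to[0,1]$ with $\mathbf E_{X\sim\mathcal U(S_0)}[w(X)]\ge 1-\epsilon'$ the distribution $Q_w$, obtained from the uniform distribution $\mathcal U(S_0)$ by re-weighting with $w$ and normalizing, satisfies $$\Big\|\mathbf E_{X\sim Q_w}[X]-\mu\Big\|_2\le\delta\quad\text{and}\quad\Big\|\mathbf E_{X\sim Q_w}[(X-\mu)(X-\mu)^T]-\mathbf I_d\Big\|_2\le\delta^2/\epsilon' .$$ A family $S$ is an *$\epsilon$-corrupted version* of $S_0$ if it is obtained from $S_0$ by replacing at most $\epsilon n$ of its $n$ points by arbitrary points. In the *$k$-pass streaming model* the elements of a fixed $S$ are revealed one at a time, and this is repeated $k$ times; the order of the elements within each pass is arbitrary (and fixed independently of the algorithm's random bits). Algorithms are randomized programs that store and manipulate real numbers exactly (real RAM: unit-cost $+,-,\times,/$ and comparisons, fair coin flips); memory is the number of cells used, each holding one real or natural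 number. For $d\in\mathbb Z_+$, $\epsilon,\tau\in(0,1)$ put $$\Lambda_{A,m}(d,\epsilon,\tau)=A\,\big(1+\log d+\log(1/\epsilon)+\log(1/\tau)\big)^m,$$ so that a quantity is $\mathrm{polylog}(d,1/\epsilon,1/\tau)$ if it is at most $\Lambda_{A,m}(d,\epsilon,\tau)$ for some absolute constants $A,m$. **Theorem (robust mean estimation in the multi-pass streaming model).** There are a single algorithm and absolute constants $C\ge 1$, $\epsilon_0>0$ with $C\epsilon_0\le 1/2$, $A>0$ and $m\in\mathbb N$ such that the following holds. Let $d,n\in\mathbb Z_+$, $0<\tau<1$, $0<\epsilon<\epsilon_0$ and $\delta\ge\epsilon$. Let $S$ be an $\epsilon$-corrupted version of a family of $n$ points of $\mathbb R^d$ that is $(C\epsilon,\delta)$-stable with respect to the (unknown) vector $\mu\in\mathbb R^d$. Given $d,\epsilon,\delta,\tau$ and streaming access to $S$ (but neither $\mu$ nor $n$), the algorithm always halts; it makes at most $\Lambda_{A,m}(d,\epsilon,\tau)$ passes over the stream, runs in time at most $nd\,\Lambda_{A,m}(d,\epsilon,\tau)$, and uses at most $d\,\Lambda_{A,m}(d,\epsilon,\tau)$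 memory cells, for every outcome of its random bits; and with probability at least $1-\tau$ over its random bits, its output $\widehat\mu$ satisfies $\|\mu-\widehat\mu\|_2\le A\delta$. -/

import Mathlib

/-! ### Stable sets and strong contamination

Point sets are finite families `S : Fin n → ℝ^d`, so that repeated points are allowed. -/

noncomputable section

namespace RobustMean

/-- `ℝ^d` with the Euclidean norm. -/
abbrev Pt (d : ℕ) : Type := EuclideanSpace ℝ (Fin d)

/-- `E_{X ∼ U(S)}[f(X)]`, the expectation under the uniform distribution on the family `S`. -/
def expect {d n : ℕ} {F : Type} [AddCommGroup F] [Module ℝ F] (S : Fin n → Pt d) (f : Pt d → F) :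
    F :=
  (n : ℝ)⁻¹ • ∑ i, f (S i)

/-- The mean of the uniform distribution on `S` re-weighted by `w`. -/
def weightedMean {d n : ℕ} (S : Fin n → Pt d) (w : Pt d → ℝ) : Pt d :=
  (expect S w)⁻¹ • expect S (fun x => w x • x)

/-- The second moment matrix, centred at `μ`, of the uniform distribution on `S` re-weighted
by `w`. -/
def weightedSecondMoment {d n : ℕ} (S : Fin n → Pt d) (w : Pt d → ℝ) (μ : Pt d) :
    Matrix (Fin d) (Fin d) ℝ :=
  (expect S w)⁻¹ • expect S (fun x => w x • Matrix.vecMulVec (x - μ) (x - μ))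

/-- The spectral norm of a square matrix. -/
def specNorm {d : ℕ} (M : Matrix (Fin d) (Fin d) ℝ) : ℝ :=
  ‖Matrix.toEuclideanCLM (𝕜 := ℝ) M‖

/-- `S` is `(ε, δ)`-stable with respect to `μ`. -/
def IsStable {d n : ℕ} (ε δ : ℝ) (μ : Pt d) (S : Fin n → Pt d) : Prop :=
  ∀ w : Pt d → ℝ, (∀ x, 0 ≤ w x ∧ w x ≤ 1) → 1 - ε ≤ expect S w →
    ‖weightedMean S w - μ‖ ≤ δ ∧ specNorm (weightedSecondMoment S w μ - 1) ≤ δ ^ 2 / ε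

open Classical in
/-- `S` is obtained from `S₀` by replacing at most `ε n` of its `n` points by arbitrary points. -/
def IsCorrupted {d n : ℕ} (ε : ℝ) (S₀ S : Fin n → Pt d) : Prop :=
  ((Finset.univ.filter fun i => S i ≠ S₀ i).card : ℝ) ≤ ε * n

end RobustMean

/-! ### A randomized real RAM reading its input in several passes

The machine has finitely many registers holding natural numbers (loop counters, addresses),
finitely many registers holding real numbers, finitely many arrays of real numbers that are
addressed by natural numbers, and a buffer with the `d` coordinates of the most recently revealed
point of the stream. Arithmetic and comparisons on exact numbers take unit time; there is no
rounding and no conversion from reals to natural numbers. Randomness comes from fair coin flips.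
The dimension `d` and the parameters `ε, δ, τ` are read-only inputs; the number of points of the
stream is not given to the machine. -/

namespace StreamRAM

/-- Natural-number expressions over `a` natural-number registers. -/
inductive NatExp (a : ℕ) : Type
  | lit (k : ℕ)
  | dim
  | reg (r : Fin a)
  | add (e f : NatExp a)
  | sub (e f : NatExp a)
  | mul (e f : NatExp a)

/-- Real expressions over `a` natural-number registers, `b` real registers and `c` arrays.
`item e` is coordinate number `e` (counted from `0`) of the buffered point. -/
inductive RealExp (a b c : ℕ) : Type
  | lit (q : ℚ)
  | eps
  | delta
  | tau
  | ofNat (e : NatExp a)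
  | reg (r : Fin b)
  | arr (k : Fin c) (e : NatExp a)
  | item (e : NatExp a)
  | add (x y : RealExp a b c)
  | sub (x y : RealExp a b c)
  | mul (x y : RealExp a b c)
  | div (x y : RealExp a b c)

/-- Tests. `atEnd` asks whether all points of the current pass have been revealed. -/
inductive BoolExp (a b c : ℕ) : Type
  | natLt (e f : NatExp a)
  | realLt (x y : RealExp a b c)
  | atEnd
  | neg (p : BoolExp a b c)
  | conj (p q : BoolExp a b c)

/-- Commands. `flip r` stores a fair random bit in the natural-number register `r`; `next` loads
the next point of the current pass into the buffer; `rewind` starts a new pass. -/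
inductive Cmd (a b c : ℕ) : Type
  | skip
  | setNat (r : Fin a) (e : NatExp a)
  | setReal (r : Fin b) (x : RealExp a b c)
  | setArr (k : Fin c) (e : NatExp a) (x : RealExp a b c)
  | flip (r : Fin a)
  | next
  | rewind
  | seq (p q : Cmd a b c)
  | ite (t : BoolExp a b c) (p q : Cmd a b c)
  | loop (t : BoolExp a b c) (p : Cmd a b c)

/-- A program: its numbers of registers and arrays, its code, and the array whose first `d` cells
hold the output. -/
structure Program : Type where
  numNat : ℕ
  numReal : ℕ
  numArr : ℕ
  code : Cmd numNat numReal numArr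
  output : Fin numArr

/-- What the machine is run on: the parameters, the point `stream p i` revealed at position `i` of
pass number `p` (a stream of `n` points per pass), and the outcomes of the coin flips. -/
structure Input (d n : ℕ) : Type where
  ε : ℝ
  δ : ℝ
  τ : ℝ
  stream : ℕ → Fin n → RobustMean.Pt d
  coins : ℕ → Bool

/-- Machine states. Besides registers, arrays and buffer, a state records the number of the current
pass (from `0`), the number of points revealed in it, the number of coins flipped, the time spent,
and the least `span` such that all array cells accessed so far have addresses `< span`. -/
structure State (d a b c : ℕ) : Type where
  nat : Fin a → ℕ
  real : Fin b → ℝ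
  arr : Fin c → ℕ → ℝ
  item : RobustMean.Pt d
  pass : ℕ
  pos : ℕ
  coin : ℕ
  time : ℕ
  span : ℕ

/-- All registers, arrays and the buffer are zero at the start. -/
def State.start (d a b c : ℕ) : State d a b c :=
  ⟨fun _ => 0, fun _ => 0, fun _ _ => 0, 0, 0, 0, 0, 0, 0⟩

/-- Charge `t` units of time and record accesses to array cells with addresses `< m`. -/
def State.charge {d a b c : ℕ} (s : State d a b c) (t m : ℕ) : State d a b c :=
  { s with time := s.time + t, span := max s.span m }

section Expressions

variable {d n a b c : ℕ}

def NatExp.eval (s : State d a b c) : NatExp a → ℕ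
  | .lit k => k
  | .dim => d
  | .reg r => s.nat r
  | .add e f => e.eval s + f.eval s
  | .sub e f => e.eval s - f.eval s
  | .mul e f => e.eval s * f.eval s

def NatExp.cost : NatExp a → ℕ
  | .lit _ => 1
  | .dim => 1
  | .reg _ => 1
  | .add e f => e.cost + f.cost + 1
  | .sub e f => e.cost + f.cost + 1
  | .mul e f => e.cost + f.cost + 1

def RealExp.eval (I : Input d n) (s : State d a b c) : RealExp a b c → ℝ
  | .lit q => q
  | .eps => I.ε
  | .delta => I.δ
  | .tau => I.τ
  | .ofNat e => e.eval s
  | .reg r => s.real r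
  | .arr k e => s.arr k (e.eval s)
  | .item e => if h : e.eval s < d then s.item ⟨e.eval s, h⟩ else 0
  | .add x y => x.eval I s + y.eval I s
  | .sub x y => x.eval I s - y.eval I s
  | .mul x y => x.eval I s * y.eval I s
  | .div x y => x.eval I s / y.eval I s

def RealExp.cost : RealExp a b c → ℕ
  | .lit _ => 1
  | .eps => 1
  | .delta => 1
  | .tau => 1
  | .ofNat e => e.cost + 1
  | .reg _ => 1
  | .arr _ e => e.cost + 1
  | .item e => e.cost + 1
  | .add x y => x.cost + y.cost + 1
  | .sub x y => x.cost + y.cost + 1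
  | .mul x y => x.cost + y.cost + 1
  | .div x y => x.cost + y.cost + 1

/-- All array cells read in the evaluation have addresses below this number. -/
def RealExp.span (s : State d a b c) : RealExp a b c → ℕ
  | .arr _ e => e.eval s + 1
  | .add x y => max (x.span s) (y.span s)
  | .sub x y => max (x.span s) (y.span s)
  | .mul x y => max (x.span s) (y.span s)
  | .div x y => max (x.span s) (y.span s)
  | _ => 0

def BoolExp.Holds (I : Input d n) (s : State d a b c) : BoolExp a b c → Prop
  | .natLt e f => e.eval s < f.eval s
  | .realLt x y => x.eval I s < y.eval I s
  | .atEnd => n ≤ s.pos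
  | .neg p => ¬ p.Holds I s
  | .conj p q => p.Holds I s ∧ q.Holds I s

def BoolExp.cost : BoolExp a b c → ℕ
  | .natLt e f => e.cost + f.cost + 1
  | .realLt x y => x.cost + y.cost + 1
  | .atEnd => 1
  | .neg p => p.cost + 1
  | .conj p q => p.cost + q.cost + 1

def BoolExp.span (s : State d a b c) : BoolExp a b c → ℕ
  | .natLt _ _ => 0
  | .realLt x y => max (x.span s) (y.span s)
  | .atEnd => 0
  | .neg p => p.span s
  | .conj p q => max (p.span s) (q.span s)

end Expressions

/-- `Exec I p s s'`: on input `I`, command `p` started in state `s` terminates in state `s'`.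
Every elementary operation costs one unit of time, and loading a point into the buffer costs
`d + 1` units. -/
inductive Exec {d n a b c : ℕ} (I : Input d n) :
    Cmd a b c → State d a b c → State d a b c → Prop
  | skip (s : State d a b c) : Exec I .skip s (s.charge 1 0)
  | setNat (s : State d a b c) (r : Fin a) (e : NatExp a) :
      Exec I (.setNat r e) s
        ({ s with nat := Function.update s.nat r (e.eval s) }.charge (e.cost + 1) 0)
  | setReal (s : State d a b c) (r : Fin b) (x : RealExp a b c) :
      Exec I (.setReal r x) s
        ({ s with real := Function.update s.real r (x.eval I s) }.charge (x.cost + 1) (x.span s))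
  | setArr (s : State d a b c) (k : Fin c) (e : NatExp a) (x : RealExp a b c) :
      Exec I (.setArr k e x) s
        ({ s with
            arr := Function.update s.arr k
              (Function.update (s.arr k) (e.eval s) (x.eval I s)) }.charge
          (e.cost + x.cost + 1) (max (e.eval s + 1) (x.span s)))
  | flip (s : State d a b c) (r : Fin a) :
      Exec I (.flip r) s
        ({ s with
            nat := Function.update s.nat r (I.coins s.coin).toNat
            coin := s.coin + 1 }.charge 1 0)
  | next (s : State d a b c) (h : s.pos < n) :
      Exec I .next s
        ({ s with item := I.stream s.pass ⟨s.pos, h⟩, pos := s.pos + 1 }.charge (d + 1) 0)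
  | nextAtEnd (s : State d a b c) (h : n ≤ s.pos) : Exec I .next s (s.charge (d + 1) 0)
  | rewind (s : State d a b c) :
      Exec I .rewind s ({ s with pass := s.pass + 1, pos := 0 }.charge 1 0)
  | seq {p q : Cmd a b c} {s s' s'' : State d a b c} (hp : Exec I p s s') (hq : Exec I q s' s'') :
      Exec I (.seq p q) s s''
  | iteTrue {t : BoolExp a b c} {p q : Cmd a b c} {s s' : State d a b c} (ht : t.Holds I s)
      (hp : Exec I p (s.charge (t.cost + 1) (t.span s)) s') : Exec I (.ite t p q) s s'
  | iteFalse {t : BoolExp a b c} {p q : Cmd a b c} {s s' : State d a b c} (ht : ¬ t.Holds I s)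
      (hq : Exec I q (s.charge (t.cost + 1) (t.span s)) s') : Exec I (.ite t p q) s s'
  | loopTrue {t : BoolExp a b c} {p : Cmd a b c} {s s' s'' : State d a b c} (ht : t.Holds I s)
      (hp : Exec I p (s.charge (t.cost + 1) (t.span s)) s') (hl : Exec I (.loop t p) s' s'') :
      Exec I (.loop t p) s s''
  | loopFalse {t : BoolExp a b c} {p : Cmd a b c} {s : State d a b c} (ht : ¬ t.Holds I s) :
      Exec I (.loop t p) s (s.charge (t.cost + 1) (t.span s))

/-- Program `P`, started on input `I`, halts in state `s`. -/
def Program.HaltsIn {d n : ℕ} (P : Program) (I : Input d n)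
    (s : State d P.numNat P.numReal P.numArr) : Prop :=
  Exec I P.code (State.start d P.numNat P.numReal P.numArr) s

/-- The output vector. -/
def Program.result {d : ℕ} (P : Program) (s : State d P.numNat P.numReal P.numArr) :
    RobustMean.Pt d :=
  WithLp.toLp 2 fun i : Fin d => s.arr P.output (i : ℕ)

/-- The number of passes over the stream. -/
def Program.passes {d : ℕ} (P : Program) (s : State d P.numNat P.numReal P.numArr) : ℕ :=
  s.pass + 1

/-- The number of memory cells: all registers, the accessed range of every array, and the
buffer. -/
def Program.memory {d : ℕ} (P : Program) (s : State d P.numNat P.numReal P.numArr) : ℕ :=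
  P.numNat + P.numReal + P.numArr * s.span + d

/-- The law of an infinite sequence of independent fair coin flips. -/
def fairCoins : MeasureTheory.Measure (ℕ → Bool) :=
  MeasureTheory.Measure.infinitePi fun _ : ℕ => (PMF.uniformOfFintype Bool).toMeasure

end StreamRAM

/-- The bound `A (1 + log d + log (1/ε) + log (1/τ))^m`. A quantity is `polylog(d, 1/ε, 1/τ)` if it
is at most this for some absolute constants `A` and `m`. -/
def polylogBound (A : ℝ) (m : ℕ) (d : ℕ) (ε τ : ℝ) : ℝ :=
  A * (1 + Real.log d + Real.log (1 / ε) + Real.log (1 / τ)) ^ m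

end

/-! The estimator is a filter that lowers the weights of suspicious points. Put `Δ = δ ^ 2 / ε`, and
let `dev` be the second moment of the weighted points about their weighted mean, divided by `n` and
not by the total weight, minus `max 0 (1 - 5 * Δ)` times the identity. With this normalization `dev`
can only decrease when weights decrease, because the weighted mean minimizes the second moment
(`sum_mul_sq_wMean_le`). As long as the good points have lost at most about as much weight as the
bad ones (`GoodWeights`), stability makes `dev` positive (`Setting.dev_nonneg`), and the mean can be
wrong along `v` only if `⟪v, dev v⟫` is large (`Setting.mean_error_sq_le`, by Cauchy–Schwarz over
the few bad points). So it suffices to bring the potential `tr (dev ^ (2 ℓ + 1))` down to about `(Δ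
times a constant) ^ (2 ℓ + 1)`; with `ℓ` logarithmic, the factor `d` lost between trace and norm
disappears in the root.

One round draws a sign vector `z`, sets `v = dev ^ ℓ z`, and divides the weights by `1 + s * score`,
where the score is the excess of the squared projection on `v` over a threshold. The good points
have small total score (`Setting.good_score_le`). The step size `s`, found by halving, leaves a
total score of at least twice and at most four times that bound, unless the total was already small
and `s = 0` (`stepSize_spec`). Hence the bad points lose at least as much as the good ones, for
every outcome of the coins (`Setting.goodWeights_filter`).

The potential drops by a constant factor on average (`Setting.expect_potential_le`). By
`trace_pow_succ_le` the drop is at least the contribution of the weight taken from bad points,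
measured by `‖dev ^ ℓ y‖ ^ 2`; the bad points carry almost the whole potential
(`Setting.bad_power_ge`); after the filter they contribute little along `v`
(`Setting.bad_second_filter_le`); and the fourth moment of a sign vector turns smallness along `v =
dev ^ ℓ z` into an average loss of a third of `‖dev ^ ℓ y‖ ^ 2` (`expect_weight_mul_sq_le`). The
initial potential is controlled by pruning around a rough centre, a random point of the stream that
has more than half of all points near it; `16 * ℓ ^ 2` rounds then suffice, and Markov's inequality
gives `Setting.card_inaccurate_le`.

In the stream no weights are stored. They are recomputed in every pass from the list of filters so
far, each a centre, a direction, a threshold and a step size. All that a round needs is a sum over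
the points, hence independent of their order; only the draws of candidate centres depend on the
order, and the order is fixed before the coins. A small program logic (`Runs`) shows that the
machine computes `finalMean` within the bounds (`estimator_halts`), and counting coin sequences
shows that `finalMean` is accurate (`Setting.probability_accurate`). -/

open scoped InnerProductSpace BigOperators

noncomputable section

namespace RobustMean

/-! ### Powers and traces of positive operators. -/

section Operators

variable {E : Type*} [NormedAddCommGroup E] [InnerProductSpace ℝ E] [FiniteDimensional ℝ E]

/-- A symmetric operator acts on its eigenvector basis by powers of the eigenvalues. -/
lemma pow_apply_eigenvectorBasis {A : E →ₗ[ℝ] E} (hA : A.IsSymmetric) {N : ℕ}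
    (hN : Module.finrank ℝ E = N) (k : ℕ) (i : Fin N) :
    (A ^ k) (hA.eigenvectorBasis hN i) = (hA.eigenvalues hN i) ^ k • hA.eigenvectorBasis hN i := by
  induction k with
  | zero => simp
  | succ k ih =>
    rw [pow_succ', Module.End.mul_apply, ih, map_smul, hA.apply_eigenvectorBasis, smul_smul,
      pow_succ]
    rfl

lemma eigenvalues_eq_inner {A : E →ₗ[ℝ] E} (hA : A.IsSymmetric) {N : ℕ}
    (hN : Module.finrank ℝ E = N) (i : Fin N) :
    hA.eigenvalues hN i = ⟪hA.eigenvectorBasis hN i, A (hA.eigenvectorBasis hN i)⟫_ℝ := by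
  rw [hA.apply_eigenvectorBasis, inner_smul_right, real_inner_self_eq_norm_sq]
  simp

lemma eigenvalues_nonneg_of_inner {A : E →ₗ[ℝ] E} (hA : A.IsSymmetric) {N : ℕ}
    (hN : Module.finrank ℝ E = N) (h : ∀ u, 0 ≤ ⟪u, A u⟫_ℝ) (i : Fin N) :
    0 ≤ hA.eigenvalues hN i := by
  rw [eigenvalues_eq_inner]; exact h _

lemma trace_pow_eq_sum {A : E →ₗ[ℝ] E} (hA : A.IsSymmetric) {N : ℕ}
    (hN : Module.finrank ℝ E = N) (k : ℕ) :
    LinearMap.trace ℝ E (A ^ k) = ∑ i, hA.eigenvalues hN i ^ k := by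
  rw [LinearMap.trace_eq_sum_inner _ (hA.eigenvectorBasis hN)]
  refine Finset.sum_congr rfl fun i _ => ?_
  rw [pow_apply_eigenvectorBasis, inner_smul_right, real_inner_self_eq_norm_sq]
  simp

/-- The moments of a positive operator at a unit vector: `⟪u, A u⟫ ^ k ≤ ⟪u, A ^ k u⟫`. -/
lemma inner_pow_le_inner_pow {A : E →ₗ[ℝ] E} (hA : A.IsSymmetric)
    (hpos : ∀ u, 0 ≤ ⟪u, A u⟫_ℝ) {u : E} (hu : ‖u‖ = 1) (k : ℕ) :
    ⟪u, A u⟫_ℝ ^ k ≤ ⟪u, (A ^ k) u⟫_ℝ := by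
  set b := hA.eigenvectorBasis rfl with hb
  have key : ∀ k, ⟪u, (A ^ k) u⟫_ℝ
      = ∑ i, ⟪b i, u⟫_ℝ ^ 2 * hA.eigenvalues rfl i ^ k := by
    intro k
    rw [← b.sum_inner_mul_inner u ((A ^ k) u)]
    refine Finset.sum_congr rfl fun i _ => ?_
    rw [← hA.pow k, hb, pow_apply_eigenvectorBasis, inner_smul_left,
      real_inner_comm u]
    simp only [conj_trivial]
    ring
  have h1 : ∑ i, ⟪b i, u⟫_ℝ ^ 2 = 1 := by
    have := b.sum_sq_norm_inner_right u
    simpa [hu] using this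
  have h2 := key 1
  rw [pow_one] at h2
  rw [h2, key k]
  simp only [pow_one]
  -- Jensen's inequality: by Parseval the numbers `⟪b i, u⟫ ^ 2` are probability weights on the
  -- eigenvalues.
  exact Real.pow_arith_mean_le_arith_mean_pow _ _ _ (fun i _ => sq_nonneg _) h1
    (fun i _ => eigenvalues_nonneg_of_inner hA rfl hpos i) k

/-- If `0 ≤ B ≤ A` then `tr (B ^ (k + 1)) ≤ tr (A ^ k * B)`. -/
lemma trace_pow_succ_le {A B : E →ₗ[ℝ] E} (hA : A.IsSymmetric) (hB : B.IsSymmetric)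
    (hB0 : ∀ u, 0 ≤ ⟪u, B u⟫_ℝ) (hBA : ∀ u, ⟪u, B u⟫_ℝ ≤ ⟪u, A u⟫_ℝ) (k : ℕ) :
    LinearMap.trace ℝ E (B ^ (k + 1)) ≤ LinearMap.trace ℝ E (A ^ k * B) := by
  -- Both traces are taken in an eigenbasis of `B`, so that only scalars are compared. Operator
  -- powers are not monotone, and no order between `A ^ k` and `B ^ k` is claimed.
  rw [trace_pow_eq_sum hB rfl, LinearMap.trace_eq_sum_inner _ (hB.eigenvectorBasis rfl)]
  refine Finset.sum_le_sum fun i _ => ?_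
  have h0 := eigenvalues_nonneg_of_inner hB rfl hB0 i
  rw [Module.End.mul_apply, hB.apply_eigenvectorBasis, map_smul, inner_smul_right, pow_succ,
    mul_comm]
  refine mul_le_mul_of_nonneg_left ?_ h0
  calc hB.eigenvalues rfl i ^ k
      ≤ ⟪hB.eigenvectorBasis rfl i, A (hB.eigenvectorBasis rfl i)⟫_ℝ ^ k := by
        refine pow_le_pow_left₀ h0 ?_ k
        rw [eigenvalues_eq_inner]; exact hBA _
    _ ≤ _ := inner_pow_le_inner_pow hA (fun u => (hB0 u).trans (hBA u)) (by simp) k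

/-- The quadratic form of a positive operator is bounded by the trace of its powers. -/
lemma inner_pow_le_trace_pow {A : E →ₗ[ℝ] E} (hA : A.IsSymmetric)
    (hpos : ∀ u, 0 ≤ ⟪u, A u⟫_ℝ) {u : E} (hu : ‖u‖ = 1) (k : ℕ) :
    ⟪u, A u⟫_ℝ ^ k ≤ LinearMap.trace ℝ E (A ^ k) := by
  refine (inner_pow_le_inner_pow hA hpos hu k).trans ?_
  set b := hA.eigenvectorBasis rfl with hb
  rw [trace_pow_eq_sum hA rfl, ← b.sum_inner_mul_inner u ((A ^ k) u)]
  refine Finset.sum_le_sum fun i _ => ?_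
  have h1 : ⟪b i, u⟫_ℝ ^ 2 ≤ 1 := by
    have := abs_real_inner_le_norm (b i) u
    rw [hu, b.norm_eq_one, mul_one] at this
    rw [sq_le_one_iff_abs_le_one]; exact this
  rw [← hA.pow k, hb, pow_apply_eigenvectorBasis, inner_smul_left, real_inner_comm u,
    ← hb]
  simp only [conj_trivial]
  have h0 := pow_nonneg (eigenvalues_nonneg_of_inner hA rfl hpos i) k
  rw [real_inner_comm] at h1
  nlinarith

lemma trace_pow_le_of_inner_le {A : E →ₗ[ℝ] E} (hA : A.IsSymmetric)
    (hpos : ∀ u, 0 ≤ ⟪u, A u⟫_ℝ) {β : ℝ} (hβ : ∀ u, ⟪u, A u⟫_ℝ ≤ β * ‖u‖ ^ 2) (k : ℕ) :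
    LinearMap.trace ℝ E (A ^ k) ≤ Module.finrank ℝ E * β ^ k := by
  rw [trace_pow_eq_sum hA rfl]
  calc ∑ i, hA.eigenvalues rfl i ^ k ≤ ∑ _i : Fin (Module.finrank ℝ E), β ^ k := by
        refine Finset.sum_le_sum fun i _ => pow_le_pow_left₀
          (eigenvalues_nonneg_of_inner hA rfl hpos i) ?_ k
        rw [eigenvalues_eq_inner]
        simpa using hβ (hA.eigenvectorBasis rfl i)
    _ = _ := by simp

lemma trace_pow_nonneg {A : E →ₗ[ℝ] E} (hA : A.IsSymmetric)
    (hpos : ∀ u, 0 ≤ ⟪u, A u⟫_ℝ) (k : ℕ) : 0 ≤ LinearMap.trace ℝ E (A ^ k) := by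
  rw [trace_pow_eq_sum hA rfl]
  exact Finset.sum_nonneg fun i _ => pow_nonneg (eigenvalues_nonneg_of_inner hA rfl hpos i) k

/-- `θ tr (A ^ k) ≤ tr (A ^ (k + 1)) + dim E * θ ^ (k + 1)`. -/
lemma mul_trace_pow_le {A : E →ₗ[ℝ] E} (hA : A.IsSymmetric)
    (hpos : ∀ u, 0 ≤ ⟪u, A u⟫_ℝ) {θ : ℝ} (hθ : 0 ≤ θ) (k : ℕ) :
    θ * LinearMap.trace ℝ E (A ^ k)
      ≤ LinearMap.trace ℝ E (A ^ (k + 1)) + Module.finrank ℝ E * θ ^ (k + 1) := by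
  rw [trace_pow_eq_sum hA rfl, trace_pow_eq_sum hA rfl, Finset.mul_sum]
  have : (Module.finrank ℝ E * θ ^ (k + 1) : ℝ)
      = ∑ _i : Fin (Module.finrank ℝ E), θ ^ (k + 1) := by simp
  rw [this, ← Finset.sum_add_distrib]
  refine Finset.sum_le_sum fun i _ => ?_
  have h0 := eigenvalues_nonneg_of_inner hA rfl hpos i
  set b := hA.eigenvalues rfl i
  rcases le_total θ b with h | h
  · have : θ * b ^ k ≤ b ^ (k + 1) := by
      rw [pow_succ']; exact mul_le_mul_of_nonneg_right h (by positivity)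
    have : 0 ≤ θ ^ (k + 1) := by positivity
    linarith
  · have : θ * b ^ k ≤ θ ^ (k + 1) := by
      rw [pow_succ']; exact mul_le_mul_of_nonneg_left (pow_le_pow_left₀ h0 h k) hθ
    have : 0 ≤ b ^ (k + 1) := by positivity
    linarith

end Operators

section OrthonormalSums

variable {E : Type*} [NormedAddCommGroup E] [InnerProductSpace ℝ E]

/-- `tr (A ^ (2 p) * B) = ∑ ⟪A ^ p e, B (A ^ p e)⟫` over an orthonormal basis. -/
lemma trace_pow_mul_eq_sum {ι : Type*} [Fintype ι] (e : OrthonormalBasis ι ℝ E)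
    {A : E →ₗ[ℝ] E} (hA : A.IsSymmetric) (B : E →ₗ[ℝ] E) (p : ℕ) :
    LinearMap.trace ℝ E (A ^ (2 * p) * B)
      = ∑ j, ⟪(A ^ p) (e j), B ((A ^ p) (e j))⟫_ℝ := by
  rw [two_mul, pow_add, mul_assoc, LinearMap.trace_mul_comm, LinearMap.trace_eq_sum_inner _ e]
  refine Finset.sum_congr rfl fun j _ => ?_
  rw [hA.pow p, Module.End.mul_apply, Module.End.mul_apply]

/-- Parseval after moving `A ^ p` to the other side. It collapses the contributions of a point `y`
along all images `(A ^ p) (e j)` into a single norm, the quantity that random sign vectors estimate.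
-/
lemma sum_inner_pow_sq {ι : Type*} [Fintype ι] (e : OrthonormalBasis ι ℝ E)
    {A : E →ₗ[ℝ] E} (hA : A.IsSymmetric) (p : ℕ) (y : E) :
    ∑ j, ⟪(A ^ p) (e j), y⟫_ℝ ^ 2 = ‖(A ^ p) y‖ ^ 2 := by
  rw [← e.sum_sq_norm_inner_right]
  refine Finset.sum_congr rfl fun j _ => ?_
  rw [hA.pow p, Real.norm_eq_abs, sq_abs]

end OrthonormalSums

end RobustMean

namespace RobustMean

/-! ### Moments of random sign vectors. -/

section Signs

/-- The sign `±1` encoded by a bit. -/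
def bitSign (b : Bool) : ℝ := 2 * (b.toNat : ℝ) - 1

/-- The vector of signs encoded by a tuple of bits. -/
def signVec {d : ℕ} (b : Fin d → Bool) : Pt d := WithLp.toLp 2 fun i => bitSign (b i)

@[simp] lemma bitSign_true : bitSign true = 1 := by norm_num [bitSign]

@[simp] lemma bitSign_false : bitSign false = -1 := by norm_num [bitSign]

lemma sum_bits_succ {d : ℕ} (f : (Fin (d + 1) → Bool) → ℝ) :
    ∑ b, f b = ∑ b : Fin d → Bool, (f (Fin.cons true b) + f (Fin.cons false b)) := by
  rw [← (Fin.consEquiv fun _ : Fin (d + 1) => Bool).sum_comp, Fintype.sum_prod_type_right]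
  refine Finset.sum_congr rfl fun b _ => ?_
  rw [Fintype.sum_bool]
  rfl

lemma sum_signs_sq {d : ℕ} (u : Fin d → ℝ) :
    ∑ b : Fin d → Bool, (∑ i, bitSign (b i) * u i) ^ 2 = 2 ^ d * ∑ i, u i ^ 2 := by
  induction d with
  | zero => simp
  | succ d ih =>
    rw [sum_bits_succ]
    simp only [Fin.sum_univ_succ, Fin.cons_zero, Fin.cons_succ, bitSign_true, bitSign_false]
    have h : ∀ b : Fin d → Bool,
        (1 * u 0 + ∑ i : Fin d, bitSign (b i) * u i.succ) ^ 2
          + (-1 * u 0 + ∑ i : Fin d, bitSign (b i) * u i.succ) ^ 2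
        = 2 * u 0 ^ 2 + 2 * (∑ i : Fin d, bitSign (b i) * u i.succ) ^ 2 := fun b => by ring
    rw [Finset.sum_congr rfl fun b _ => h b, Finset.sum_add_distrib, ← Finset.mul_sum,
      ← Finset.mul_sum, ih fun i => u i.succ]
    simp
    ring

/-- Induction on the dimension: averaging over the first sign kills the odd powers, and the mixed
term is given by the second moment. With `R` the sum of the other squares, `u⁴ + 6 u² R + 3 R² ≤ 3
(u² + R)²` closes the step. -/
lemma sum_signs_pow_four_le {d : ℕ} (u : Fin d → ℝ) :
    ∑ b : Fin d → Bool, (∑ i, bitSign (b i) * u i) ^ 4 ≤ 2 ^ d * (3 * (∑ i, u i ^ 2) ^ 2) := by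
  induction d with
  | zero => simp
  | succ d ih =>
    rw [sum_bits_succ]
    simp only [Fin.sum_univ_succ, Fin.cons_zero, Fin.cons_succ, bitSign_true, bitSign_false]
    have h : ∀ b : Fin d → Bool,
        (1 * u 0 + ∑ i : Fin d, bitSign (b i) * u i.succ) ^ 4
          + (-1 * u 0 + ∑ i : Fin d, bitSign (b i) * u i.succ) ^ 4
        = 2 * u 0 ^ 4 + 12 * u 0 ^ 2 * (∑ i : Fin d, bitSign (b i) * u i.succ) ^ 2
          + 2 * (∑ i : Fin d, bitSign (b i) * u i.succ) ^ 4 := fun b => by ring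
    rw [Finset.sum_congr rfl fun b _ => h b, Finset.sum_add_distrib, Finset.sum_add_distrib,
      ← Finset.mul_sum, ← Finset.mul_sum, ← Finset.mul_sum, sum_signs_sq fun i => u i.succ]
    have := ih fun i => u i.succ
    have h2 : (0 : ℝ) ≤ 2 ^ d * u 0 ^ 4 := by positivity
    simp only [Finset.sum_const, Finset.card_univ, Fintype.card_fun, Fintype.card_bool,
      Fintype.card_fin, nsmul_eq_mul, Nat.cast_pow, Nat.cast_ofNat]
    rw [pow_succ (2 : ℝ) d]
    nlinarith

lemma inner_signVec {d : ℕ} (b : Fin d → Bool) (u : Pt d) :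
    ⟪signVec b, u⟫_ℝ = ∑ i, bitSign (b i) * u i := by
  simp [signVec, PiLp.inner_apply, mul_comm]

lemma expect_bits {d : ℕ} (f : (Fin d → Bool) → ℝ) : 𝔼 b, f b = (∑ b, f b) / 2 ^ d := by
  rw [Fintype.expect_eq_sum_div_card]
  simp

lemma expect_inner_signVec_sq {d : ℕ} (u : Pt d) :
    𝔼 b : Fin d → Bool, ⟪signVec b, u⟫_ℝ ^ 2 = ‖u‖ ^ 2 := by
  simp only [inner_signVec, expect_bits, sum_signs_sq, EuclideanSpace.real_norm_sq_eq]
  field_simp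

lemma expect_inner_signVec_pow_four_le {d : ℕ} (u : Pt d) :
    𝔼 b : Fin d → Bool, ⟪signVec b, u⟫_ℝ ^ 4 ≤ 3 * ‖u‖ ^ 4 := by
  have h : ‖u‖ ^ 4 = (∑ i, u i ^ 2) ^ 2 := by
    rw [← EuclideanSpace.real_norm_sq_eq]; ring
  simp only [inner_signVec, expect_bits, h]
  rw [div_le_iff₀ (by positivity), mul_comm]
  exact sum_signs_pow_four_le _

/-- Polarization of the second moment. -/
lemma expect_inner_signVec_mul {d : ℕ} (u v : Pt d) :
    𝔼 b : Fin d → Bool, ⟪signVec b, u⟫_ℝ * ⟪signVec b, v⟫_ℝ = ⟪u, v⟫_ℝ := by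
  have h : ∀ b : Fin d → Bool, ⟪signVec b, u⟫_ℝ * ⟪signVec b, v⟫_ℝ
      = (1 / 2) * (⟪signVec b, u + v⟫_ℝ ^ 2 - ⟪signVec b, u⟫_ℝ ^ 2 - ⟪signVec b, v⟫_ℝ ^ 2) :=
    fun b => by rw [inner_add_right]; ring
  rw [Finset.expect_congr rfl fun b _ => h b, ← Finset.mul_expect, Finset.expect_sub_distrib,
    Finset.expect_sub_distrib, expect_inner_signVec_sq, expect_inner_signVec_sq,
    expect_inner_signVec_sq, norm_add_sq_real]
  ring

/-- A random sign vector computes the trace. -/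
lemma expect_inner_signVec_apply {d : ℕ} {A : Pt d →ₗ[ℝ] Pt d} (hA : A.IsSymmetric) :
    𝔼 b : Fin d → Bool, ⟪signVec b, A (signVec b)⟫_ℝ = LinearMap.trace ℝ (Pt d) A := by
  let e := EuclideanSpace.basisFun (Fin d) ℝ
  have h : ∀ b : Fin d → Bool, ⟪signVec b, A (signVec b)⟫_ℝ
      = ∑ j, ⟪signVec b, e j⟫_ℝ * ⟪signVec b, A (e j)⟫_ℝ := fun b => by
    rw [← e.sum_inner_mul_inner (signVec b) (A (signVec b))]
    refine Finset.sum_congr rfl fun j _ => ?_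
    rw [← hA (e j), real_inner_comm (A (e j))]
  rw [Finset.expect_congr rfl fun b _ => h b, Finset.expect_sum_comm,
    LinearMap.trace_eq_sum_inner _ e]
  exact Finset.sum_congr rfl fun j _ => expect_inner_signVec_mul _ _

/-- A point whose weight is lowered according to its squared projection on a random sign vector:
on average, its contribution to the second moment drops by a constant factor, up to the contribution
that is left along the random direction. -/
lemma expect_weight_mul_sq_le {d : ℕ} (u : Pt d) (w : ℝ) (w' : (Fin d → Bool) → ℝ)
    (h0 : ∀ b, 0 ≤ w' b) (h1 : ∀ b, w' b ≤ w) :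
    𝔼 b, w' b * ‖u‖ ^ 2
      ≤ 2 / 3 * (w * ‖u‖ ^ 2) + 2 / 3 * 𝔼 b, w' b * ⟪signVec b, u⟫_ℝ ^ 2 := by
  rcases eq_or_ne u 0 with rfl | hu
  · simp
  have ht : 0 < ‖u‖ ^ 2 := by positivity
  have hw : 0 ≤ w := (h0 fun _ => true).trans (h1 _)
  set t := ‖u‖ ^ 2 with htdef
  -- Replacing `w'` by `w` is allowed only in front of a nonnegative factor, here `t (1 - X / (3
  -- t))²`. With `E X = t` and `E X² ≤ 3 t²` the mean of `(1 - c X / t)²` is at most `1 - 2 c + 3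
  -- c²`, which is least, namely `2 / 3`, at `c = 1 / 3`.
  have hb : ∀ b, w' b * t ≤ w * (t - 2 / 3 * ⟪signVec b, u⟫_ℝ ^ 2
      + 1 / (9 * t) * ⟪signVec b, u⟫_ℝ ^ 4) + 2 / 3 * (w' b * ⟪signVec b, u⟫_ℝ ^ 2) := by
    intro b
    set X := ⟪signVec b, u⟫_ℝ ^ 2 with hX
    have e4 : ⟪signVec b, u⟫_ℝ ^ 4 = X ^ 2 := by rw [hX]; ring
    rw [e4]
    have hsq : t - 2 / 3 * X + 1 / (9 * t) * X ^ 2 = t * (1 - X / (3 * t)) ^ 2 := by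
      field_simp
      ring
    have hnn : 0 ≤ t - 2 / 3 * X + 1 / (9 * t) * X ^ 2 := by rw [hsq]; positivity
    have h2 : w' b * (t - 2 / 3 * X + 1 / (9 * t) * X ^ 2)
        ≤ w * (t - 2 / 3 * X + 1 / (9 * t) * X ^ 2) := mul_le_mul_of_nonneg_right (h1 b) hnn
    have h3 : 0 ≤ w' b * (1 / (9 * t) * X ^ 2) := mul_nonneg (h0 b) (by positivity)
    linarith
  refine (Finset.expect_le_expect fun b _ => hb b).trans ?_
  rw [Finset.expect_add_distrib, ← Finset.mul_expect, ← Finset.mul_expect,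
    Finset.expect_add_distrib, Finset.expect_sub_distrib, ← Finset.mul_expect,
    ← Finset.mul_expect, expect_inner_signVec_sq, Fintype.expect_const, ← htdef]
  have h4 := expect_inner_signVec_pow_four_le u
  have e4 : ‖u‖ ^ 4 = t ^ 2 := by rw [htdef]; ring
  rw [e4] at h4
  have h5 : 1 / (9 * t) * 𝔼 b : Fin d → Bool, ⟪signVec b, u⟫_ℝ ^ 4 ≤ 1 / 3 * t := by
    calc _ ≤ 1 / (9 * t) * (3 * t ^ 2) := mul_le_mul_of_nonneg_left h4 (by positivity)
      _ = _ := by field_simp; ring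
  have h6 : w * (t - 2 / 3 * t + 1 / (9 * t) * 𝔼 b : Fin d → Bool, ⟪signVec b, u⟫_ℝ ^ 4)
      ≤ w * (2 / 3 * t) := mul_le_mul_of_nonneg_left (by linarith) hw
  linarith

end Signs

end RobustMean

namespace RobustMean

/-! ### Weighted means and second moments. -/

section Moments

variable {d n : ℕ}

/-- The mean of the points `S i` with weights `ω i`. -/
def wMean (S : Fin n → Pt d) (ω : Fin n → ℝ) : Pt d := (∑ i, ω i)⁻¹ • ∑ i, ω i • S i

/-- The rank-one operator `u ↦ ⟪y, u⟫ y`. -/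
def rankOne (y : Pt d) : Pt d →ₗ[ℝ] Pt d := (innerₛₗ ℝ y).smulRight y

/-- The second moment of the points `S i` with weights `ω i` about their weighted mean, divided by
the number of points, minus `L` times the identity. -/
def devOp (L : ℝ) (S : Fin n → Pt d) (ω : Fin n → ℝ) : Pt d →ₗ[ℝ] Pt d :=
  (n : ℝ)⁻¹ • ∑ i, ω i • rankOne (S i - wMean S ω) - L • 1

@[simp] lemma rankOne_apply (y u : Pt d) : rankOne y u = ⟪y, u⟫_ℝ • y := rfl

lemma devOp_apply (L : ℝ) (S : Fin n → Pt d) (ω : Fin n → ℝ) (u : Pt d) :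
    devOp L S ω u = (n : ℝ)⁻¹ • (∑ i, (ω i * ⟪S i - wMean S ω, u⟫_ℝ) • (S i - wMean S ω))
      - L • u := by
  simp [devOp, LinearMap.sum_apply, smul_smul]

lemma inner_devOp (hn : 0 < n) (L : ℝ) (S : Fin n → Pt d) (ω : Fin n → ℝ) (u : Pt d) :
    n * ⟪u, devOp L S ω u⟫_ℝ = ∑ i, ω i * ⟪u, S i - wMean S ω⟫_ℝ ^ 2 - n * (L * ‖u‖ ^ 2) := by
  have hn' : (n : ℝ) ≠ 0 := by positivity
  rw [devOp_apply, inner_sub_right, inner_smul_right, inner_smul_right, inner_sum,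
    real_inner_self_eq_norm_sq, mul_sub, mul_inv_cancel_left₀ hn']
  congr 1
  refine Finset.sum_congr rfl fun i _ => ?_
  rw [inner_smul_right, real_inner_comm u]
  ring

lemma devOp_symmetric (L : ℝ) (S : Fin n → Pt d) (ω : Fin n → ℝ) :
    (devOp L S ω).IsSymmetric := by
  intro u v
  rw [devOp_apply, devOp_apply, inner_sub_left, inner_sub_right, inner_smul_left,
    inner_smul_right, inner_smul_left, inner_smul_right, sum_inner, inner_sum]
  congr 2
  refine Finset.sum_congr rfl fun i _ => ?_
  rw [inner_smul_right, inner_smul_left, real_inner_comm u]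
  simp only [conj_trivial]
  ring

lemma sum_mul_inner_sub_wMean (S : Fin n → Pt d) {ω : Fin n → ℝ} (h : ∑ i, ω i ≠ 0) (u : Pt d) :
    ∑ i, ω i * ⟪u, S i - wMean S ω⟫_ℝ = 0 := by
  have h1 : ∑ i, ω i * ⟪u, S i - wMean S ω⟫_ℝ = ⟪u, ∑ i, ω i • (S i - wMean S ω)⟫_ℝ := by
    rw [inner_sum]
    exact Finset.sum_congr rfl fun i _ => by rw [inner_smul_right]
  rw [h1]
  simp only [smul_sub, Finset.sum_sub_distrib, ← Finset.sum_smul]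
  rw [wMean, smul_smul, mul_inv_cancel₀ h, one_smul, sub_self, inner_zero_right]

/-- The weighted mean minimizes the second moment in every direction. -/
lemma sum_mul_sq_wMean_le (S : Fin n → Pt d) {ω : Fin n → ℝ} (h0 : ∀ i, 0 ≤ ω i) (u c : Pt d) :
    ∑ i, ω i * ⟪u, S i - wMean S ω⟫_ℝ ^ 2 ≤ ∑ i, ω i * ⟪u, S i - c⟫_ℝ ^ 2 := by
  by_cases h : ∑ i, ω i = 0
  · have hz : ∀ i, ω i = 0 := fun i =>
      (Finset.sum_eq_zero_iff_of_nonneg fun i _ => h0 i).1 h i (Finset.mem_univ i)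
    simp [hz]
  set m := ⟪u, wMean S ω - c⟫_ℝ with hm
  have h1 : ∀ i, ω i * ⟪u, S i - c⟫_ℝ ^ 2 = ω i * ⟪u, S i - wMean S ω⟫_ℝ ^ 2
      + 2 * m * (ω i * ⟪u, S i - wMean S ω⟫_ℝ) + ω i * m ^ 2 := fun i => by
    have : ⟪u, S i - c⟫_ℝ = ⟪u, S i - wMean S ω⟫_ℝ + m := by
      rw [hm, ← inner_add_right]; congr 1; abel
    rw [this]; ring
  rw [Finset.sum_congr rfl fun i _ => h1 i, Finset.sum_add_distrib, Finset.sum_add_distrib,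
    ← Finset.mul_sum, sum_mul_inner_sub_wMean S h]
  have : 0 ≤ ∑ i, ω i * m ^ 2 := Finset.sum_nonneg fun i _ => mul_nonneg (h0 i) (sq_nonneg _)
  linarith

end Moments

/-! ### What stability says about the good and the bad points. -/

/-- The points `S i`, `i ∈ G`, make up all but a fraction `ε` of the family `S`, and they have
stable first and second moments about `μ` when at most a fraction `4 ε` of the points is left out.
Here `Δ = δ ^ 2 / ε`. -/
structure Setting {d n : ℕ} (S : Fin n → Pt d) (μ : Pt d) (G : Finset (Fin n)) (ε δ Δ : ℝ) :
    Prop where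
  n_pos : 0 < n
  eps_pos : 0 < ε
  eps_le : ε ≤ 1 / 10000
  delta_pos : 0 < δ
  eps_mul : ε * Δ = δ ^ 2
  eps_le_Delta : ε ≤ Δ
  card_compl : ((Gᶜ).card : ℝ) ≤ ε * n
  mean : ∀ (ω : Fin n → ℝ) (v : Pt d), (∀ i, 0 ≤ ω i) → (∀ i, ω i ≤ 1) →
    (1 - 4 * ε) * n ≤ ∑ i ∈ G, ω i →
    |∑ i ∈ G, ω i * ⟪v, S i - μ⟫_ℝ| ≤ δ * ‖v‖ * ∑ i ∈ G, ω i
  second : ∀ (ω : Fin n → ℝ) (v : Pt d), (∀ i, 0 ≤ ω i) → (∀ i, ω i ≤ 1) →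
    (1 - 4 * ε) * n ≤ ∑ i ∈ G, ω i →
    |∑ i ∈ G, ω i * ⟪v, S i - μ⟫_ℝ ^ 2 - ‖v‖ ^ 2 * ∑ i ∈ G, ω i| ≤ Δ * ‖v‖ ^ 2 * ∑ i ∈ G, ω i

/-- Weights that have taken away at most about as much from the good points as from the others. -/
structure GoodWeights {n : ℕ} (G : Finset (Fin n)) (ε : ℝ) (ω : Fin n → ℝ) : Prop where
  nonneg : ∀ i, 0 ≤ ω i
  le_one : ∀ i, ω i ≤ 1
  loss : ∑ i ∈ G, (1 - ω i) ≤ ∑ i ∈ Gᶜ, (1 - ω i) + ε * n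

section Scores

variable {d n : ℕ}

/-- The operator whose potential is decreased. -/
abbrev dev (S : Fin n → Pt d) (Δ : ℝ) (ω : Fin n → ℝ) : Pt d →ₗ[ℝ] Pt d :=
  devOp (max 0 (1 - 5 * Δ)) S ω

/-- The excess of the squared projection on `v`, centred at `c`, over a threshold. -/
def excess (v c : Pt d) (ϑ : ℝ) (x : Pt d) : ℝ := max 0 (⟪v, x - c⟫_ℝ ^ 2 - ϑ)

lemma excess_nonneg (v c : Pt d) (ϑ : ℝ) (x : Pt d) : 0 ≤ excess v c ϑ x := le_max_left _ _

/-- The threshold for scores in direction `v`. -/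
def threshold (ε Δ : ℝ) (v : Pt d) : ℝ := 8 * (Δ / ε) * ‖v‖ ^ 2

/-- The bound for the total score of the good points in direction `v`, divided by `n`; here
`q = ⟪v, dev v⟫`. -/
def scoreBound (ε Δ : ℝ) (v : Pt d) (q : ℝ) : ℝ := 7 * Δ * ‖v‖ ^ 2 + 16 * ε * q

end Scores

namespace Setting

variable {d n : ℕ} {S : Fin n → Pt d} {μ : Pt d} {G : Finset (Fin n)} {ε δ Δ : ℝ}

lemma Delta_pos (h : Setting S μ G ε δ Δ) : 0 < Δ := h.eps_pos.trans_le h.eps_le_Delta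

lemma delta_sq_le (h : Setting S μ G ε δ Δ) : δ ^ 2 ≤ Δ / 10000 := by
  rw [← h.eps_mul]
  have := mul_le_mul_of_nonneg_right h.eps_le h.Delta_pos.le
  linarith

lemma cast_n_pos (h : Setting S μ G ε δ Δ) : (0 : ℝ) < n := by exact_mod_cast h.n_pos

lemma card_good (h : Setting S μ G ε δ Δ) : (1 - ε) * n ≤ (G.card : ℝ) := by
  have h1 : (G.card : ℝ) + (Gᶜ).card = n := by
    have := G.card_add_card_compl
    rw [Fintype.card_fin] at this
    exact_mod_cast this
  have := h.card_compl
  linarith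

lemma card_good_le (G : Finset (Fin n)) : (G.card : ℝ) ≤ n := by
  have := G.card_le_univ
  rw [Fintype.card_fin] at this
  exact_mod_cast this

lemma sum_good_le (_h : Setting S μ G ε δ Δ) {ω : Fin n → ℝ} (h1 : ∀ i, ω i ≤ 1) :
    ∑ i ∈ G, ω i ≤ n := by
  calc ∑ i ∈ G, ω i ≤ ∑ _i ∈ G, (1 : ℝ) := Finset.sum_le_sum fun i _ => h1 i
    _ = G.card := by simp
    _ ≤ n := card_good_le G

lemma sum_bad_le (h : Setting S μ G ε δ Δ) {ω : Fin n → ℝ} (h1 : ∀ i, ω i ≤ 1) :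
    ∑ i ∈ Gᶜ, ω i ≤ ε * n := by
  calc ∑ i ∈ Gᶜ, ω i ≤ ∑ _i ∈ Gᶜ, (1 : ℝ) := Finset.sum_le_sum fun i _ => h1 i
    _ = (Gᶜ).card := by simp
    _ ≤ ε * n := h.card_compl

/-- The bad points have at most `ε n` weight to lose, so the good ones have lost at most `2 ε n`; at
most another `ε n` of the indices are not good. The remaining `ε n` up to the `4 ε` of `Setting` is
slack. -/
lemma sum_good_ge (h : Setting S μ G ε δ Δ) {ω : Fin n → ℝ} (hω : GoodWeights G ε ω) :
    (1 - 3 * ε) * n ≤ ∑ i ∈ G, ω i := by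
  have h1 := hω.loss
  have h2 : ∑ i ∈ Gᶜ, (1 - ω i) ≤ ε * n :=
    h.sum_bad_le fun i => by linarith [hω.nonneg i]
  rw [Finset.sum_sub_distrib] at h1
  have h3 := h.card_good
  simp only [Finset.sum_const, nsmul_eq_mul, mul_one] at h1
  linarith

lemma sum_good_ge_four (h : Setting S μ G ε δ Δ) {ω : Fin n → ℝ} (hω : GoodWeights G ε ω) :
    (1 - 4 * ε) * n ≤ ∑ i ∈ G, ω i := by
  have := h.sum_good_ge hω
  have := mul_pos h.eps_pos h.cast_n_pos
  linarith

lemma half_le_sum_good (h : Setting S μ G ε δ Δ) {ω : Fin n → ℝ} (hω : GoodWeights G ε ω) :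
    (n : ℝ) / 2 ≤ ∑ i ∈ G, ω i := by
  have := h.sum_good_ge hω
  have := mul_le_mul_of_nonneg_right h.eps_le h.cast_n_pos.le
  linarith [h.cast_n_pos]

lemma sum_weights_pos (h : Setting S μ G ε δ Δ) {ω : Fin n → ℝ} (hω : GoodWeights G ε ω) :
    0 < ∑ i, ω i := by
  rw [← Finset.sum_add_sum_compl G]
  have h1 := h.half_le_sum_good hω
  have h2 : 0 ≤ ∑ i ∈ Gᶜ, ω i := Finset.sum_nonneg fun i _ => hω.nonneg i
  linarith [h.cast_n_pos]

lemma sum_good_recenter (c v : Pt d) (ω : Fin n → ℝ) :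
    ∑ i ∈ G, ω i * ⟪v, S i - c⟫_ℝ ^ 2 = ∑ i ∈ G, ω i * ⟪v, S i - μ⟫_ℝ ^ 2
      - 2 * ⟪v, c - μ⟫_ℝ * ∑ i ∈ G, ω i * ⟪v, S i - μ⟫_ℝ + ⟪v, c - μ⟫_ℝ ^ 2 * ∑ i ∈ G, ω i := by
  rw [Finset.mul_sum, Finset.mul_sum, ← Finset.sum_sub_distrib, ← Finset.sum_add_distrib]
  refine Finset.sum_congr rfl fun i _ => ?_
  have : ⟪v, S i - c⟫_ℝ = ⟪v, S i - μ⟫_ℝ - ⟪v, c - μ⟫_ℝ := by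
    rw [← inner_sub_right]; congr 1; abel
  rw [this]; ring

/-- The good points have second moment at least `1 - 5 Δ` about every centre. -/
lemma good_second_ge (h : Setting S μ G ε δ Δ) {ω : Fin n → ℝ} (hω : GoodWeights G ε ω)
    (c v : Pt d) :
    n * (max 0 (1 - 5 * Δ) * ‖v‖ ^ 2) ≤ ∑ i ∈ G, ω i * ⟪v, S i - c⟫_ℝ ^ 2 := by
  have hn := h.cast_n_pos
  set V := ‖v‖ ^ 2 with hV
  have hV0 : 0 ≤ V := by positivity
  rcases le_total (1 - 5 * Δ) 0 with h5 | h5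
  · rw [max_eq_left h5]
    simp only [zero_mul, mul_zero]
    exact Finset.sum_nonneg fun i _ => mul_nonneg (hω.nonneg i) (sq_nonneg _)
  rw [max_eq_right h5]
  have hW := h.sum_good_ge_four hω
  have hW3 := h.sum_good_ge hω
  have e1 := (abs_le.1 (h.mean ω v hω.nonneg hω.le_one hW))
  have e2 := (abs_le.1 (h.second ω v hω.nonneg hω.le_one hW)).1
  have hWle := h.sum_good_le hω.le_one
  rw [sum_good_recenter (μ := μ)]
  set W := ∑ i ∈ G, ω i
  set m := ⟪v, c - μ⟫_ℝ
  set a := ∑ i ∈ G, ω i * ⟪v, S i - μ⟫_ℝ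
  have hWp : 0 ≤ W := (by linarith [h.half_le_sum_good hω] : 0 ≤ W)
  have h1 : 2 * m * a ≤ 2 * |m| * (δ * ‖v‖ * W) := by
    have : m * a ≤ |m| * |a| := by rw [← abs_mul]; exact le_abs_self _
    have : |m| * |a| ≤ |m| * (δ * ‖v‖ * W) :=
      mul_le_mul_of_nonneg_left (abs_le.2 e1) (abs_nonneg _)
    linarith
  have h2 : 2 * |m| * (δ * ‖v‖ * W) ≤ (m ^ 2 + δ ^ 2 * V) * W := by
    have := mul_nonneg (sq_nonneg (|m| - δ * ‖v‖)) hWp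
    rw [← sq_abs m]
    nlinarith
  have hδ := h.delta_sq_le
  have hΔ := h.Delta_pos
  have h3 : (1 - Δ - δ ^ 2) * V * ((1 - 3 * ε) * n) ≤ (1 - Δ - δ ^ 2) * V * W :=
    mul_le_mul_of_nonneg_left hW3 (mul_nonneg (by linarith) hV0)
  have h4 : n * ((1 - 5 * Δ) * V) ≤ (1 - Δ - δ ^ 2) * V * ((1 - 3 * ε) * n) := by
    -- Origin of the constant 5: one `Δ` from stability, three from the missing weight through `ε ≤
    -- Δ`, and `δ ^ 2` is a tiny multiple of `Δ`.
    have : (1 - 5 * Δ) ≤ (1 - Δ - δ ^ 2) * (1 - 3 * ε) := by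
      nlinarith [h.eps_pos, h.eps_le_Delta, mul_pos h.eps_pos hΔ, sq_nonneg δ,
        mul_nonneg h.eps_pos.le (sq_nonneg δ)]
    have := mul_le_mul_of_nonneg_right this (mul_nonneg hV0 hn.le)
    linarith
  linarith

/-- The bad points contribute at most `⟪v, dev v⟫` to the second moment. -/
lemma bad_second_le (h : Setting S μ G ε δ Δ) {ω : Fin n → ℝ} (hω : GoodWeights G ε ω)
    (v : Pt d) :
    ∑ i ∈ Gᶜ, ω i * ⟪v, S i - wMean S ω⟫_ℝ ^ 2 ≤ n * ⟪v, dev S Δ ω v⟫_ℝ := by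
  rw [inner_devOp h.n_pos, ← Finset.sum_add_sum_compl G]
  have := h.good_second_ge hω (wMean S ω) v
  linarith

/-- This is what the shift by `1 - 5 * Δ` is for: the good points alone already have that much
second moment about any centre, so all trace inequalities for positive operators apply to `dev`. -/
lemma dev_nonneg (h : Setting S μ G ε δ Δ) {ω : Fin n → ℝ} (hω : GoodWeights G ε ω)
    (v : Pt d) : 0 ≤ ⟪v, dev S Δ ω v⟫_ℝ := by
  have h1 := h.bad_second_le hω v
  have h2 : 0 ≤ ∑ i ∈ Gᶜ, ω i * ⟪v, S i - wMean S ω⟫_ℝ ^ 2 :=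
    Finset.sum_nonneg fun i _ => mul_nonneg (hω.nonneg i) (sq_nonneg _)
  exact nonneg_of_mul_nonneg_right (h2.trans h1) h.cast_n_pos

/-- The weighted mean is close to `μ` in directions of small deviation. -/
lemma mean_error_sq_le (h : Setting S μ G ε δ Δ) {ω : Fin n → ℝ} (hω : GoodWeights G ε ω)
    (v : Pt d) :
    ⟪v, wMean S ω - μ⟫_ℝ ^ 2 ≤ 2 * δ ^ 2 * ‖v‖ ^ 2 + 8 * ε * ⟪v, dev S Δ ω v⟫_ℝ := by
  have hn := h.cast_n_pos
  have hsum := sum_mul_inner_sub_wMean S (h.sum_weights_pos hω).ne' v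
  rw [← Finset.sum_add_sum_compl G] at hsum
  have hbad := h.bad_second_le hω v
  have hq := h.dev_nonneg hω v
  -- Cauchy–Schwarz: the bad points can move the mean only at the price of a large second moment,
  -- since their total weight is at most `ε n`.
  have hcs : (∑ i ∈ Gᶜ, ω i * ⟪v, S i - wMean S ω⟫_ℝ) ^ 2
      ≤ (∑ i ∈ Gᶜ, ω i) * ∑ i ∈ Gᶜ, ω i * ⟪v, S i - wMean S ω⟫_ℝ ^ 2 :=
    Finset.sum_sq_le_sum_mul_sum_of_sq_le_mul _ (fun i _ => hω.nonneg i)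
      (fun i _ => mul_nonneg (hω.nonneg i) (sq_nonneg _)) (fun i _ => le_of_eq (by ring))
  have hWB := h.sum_bad_le hω.le_one
  have hWh := h.half_le_sum_good hω
  have ha := h.mean ω v hω.nonneg hω.le_one (h.sum_good_ge_four hω)
  have hgood : ∑ i ∈ G, ω i * ⟪v, S i - wMean S ω⟫_ℝ
      = ∑ i ∈ G, ω i * ⟪v, S i - μ⟫_ℝ - ⟪v, wMean S ω - μ⟫_ℝ * ∑ i ∈ G, ω i := by
    rw [Finset.mul_sum, ← Finset.sum_sub_distrib]
    refine Finset.sum_congr rfl fun i _ => ?_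
    have : ⟪v, S i - wMean S ω⟫_ℝ = ⟪v, S i - μ⟫_ℝ - ⟪v, wMean S ω - μ⟫_ℝ := by
      rw [← inner_sub_right]; congr 1; abel
    rw [this]; ring
  rw [hgood] at hsum
  set W := ∑ i ∈ G, ω i
  set m := ⟪v, wMean S ω - μ⟫_ℝ
  set q := ⟪v, dev S Δ ω v⟫_ℝ
  set a := ∑ i ∈ G, ω i * ⟪v, S i - μ⟫_ℝ
  set b := ∑ i ∈ Gᶜ, ω i * ⟪v, S i - wMean S ω⟫_ℝ
  have hb : b ^ 2 ≤ ε * n * (n * q) := hcs.trans (by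
    have h0 : 0 ≤ ∑ i ∈ Gᶜ, ω i * ⟪v, S i - wMean S ω⟫_ℝ ^ 2 :=
      Finset.sum_nonneg fun i _ => mul_nonneg (hω.nonneg i) (sq_nonneg _)
    exact mul_le_mul hWB hbad h0 (mul_nonneg h.eps_pos.le hn.le))
  have ha2 : a ^ 2 ≤ (δ * ‖v‖ * W) ^ 2 := by
    rw [← sq_abs a]; exact pow_le_pow_left₀ (abs_nonneg _) ha 2
  have hmW : m * W = a + b := by linarith
  have h1 : W ^ 2 * m ^ 2 ≤ W ^ 2 * (2 * δ ^ 2 * ‖v‖ ^ 2 + 8 * ε * q) := by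
    have e1 : W ^ 2 * m ^ 2 ≤ 2 * a ^ 2 + 2 * b ^ 2 := by
      have : W ^ 2 * m ^ 2 = (a + b) ^ 2 := by rw [← hmW]; ring
      rw [this]; nlinarith [sq_nonneg (a - b)]
    -- The good weight is at least `n / 2`; this turns `2 * b ^ 2 ≤ 2 * ε * n ^ 2 * q` into the
    -- coefficient `8 * ε`.
    have e2 : (n : ℝ) ^ 2 ≤ 4 * W ^ 2 := by nlinarith
    have e3 : (n : ℝ) ^ 2 * (ε * q) ≤ 4 * W ^ 2 * (ε * q) :=
      mul_le_mul_of_nonneg_right e2 (mul_nonneg h.eps_pos.le hq)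
    nlinarith
  have hW2 : 0 < W ^ 2 := by
    have : 0 < W := by linarith
    positivity
  exact le_of_mul_le_mul_left h1 hW2

/-- Leaving out few good points does not change much. -/
lemma tail_le (h : Setting S μ G ε δ Δ) {r : Fin n → ℝ} (h0 : ∀ i, 0 ≤ r i) (h1 : ∀ i, r i ≤ 1)
    (hr : ∑ i ∈ G, r i ≤ ε * n) (v : Pt d) :
    ∑ i ∈ G, r i * ⟪v, S i - μ⟫_ℝ ^ 2 ≤ 3 * Δ * n * ‖v‖ ^ 2 := by
  have hn := h.cast_n_pos
  have hG := h.card_good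
  have hεn := mul_pos h.eps_pos hn
  have hone : ∑ _i ∈ G, (1 : ℝ) = G.card := by simp
  have hsub : ∑ i ∈ G, (1 - r i) = G.card - ∑ i ∈ G, r i := by
    rw [Finset.sum_sub_distrib, hone]
  -- The tail is the difference of two stable second moments, with all good points and with the
  -- weights `1 - r`. It costs `Δ` twice, and the lost mass `ε n ≤ Δ n` once more.
  have e1 := (abs_le.1 (h.second (fun _ => 1) v (fun _ => zero_le_one) (fun _ => le_rfl)
    (by rw [hone]; linarith))).2
  have e2 := (abs_le.1 (h.second (fun i => 1 - r i) v (fun i => by linarith [h1 i])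
    (fun i => by linarith [h0 i]) (by rw [hsub]; linarith))).1
  rw [hsub] at e2
  rw [hone] at e1
  have e3 : ∑ i ∈ G, (1 - r i) * ⟪v, S i - μ⟫_ℝ ^ 2 = ∑ i ∈ G, 1 * ⟪v, S i - μ⟫_ℝ ^ 2
      - ∑ i ∈ G, r i * ⟪v, S i - μ⟫_ℝ ^ 2 := by
    rw [← Finset.sum_sub_distrib]
    exact Finset.sum_congr rfl fun i _ => by ring
  rw [e3] at e2
  have hr0 : 0 ≤ ∑ i ∈ G, r i := Finset.sum_nonneg fun i _ => h0 i
  set V := ‖v‖ ^ 2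
  have hV : 0 ≤ V := by positivity
  have hGn := card_good_le G
  set K : ℝ := (G.card : ℝ)
  set R := ∑ i ∈ G, r i
  have hΔ := h.Delta_pos
  have f1 : Δ * V * K ≤ Δ * V * n := mul_le_mul_of_nonneg_left hGn (by positivity)
  have f2 : Δ * V * (K - R) ≤ Δ * V * n := mul_le_mul_of_nonneg_left (by linarith) (by positivity)
  have f3 : V * R ≤ V * (Δ * n) := mul_le_mul_of_nonneg_left
    (hr.trans (mul_le_mul_of_nonneg_right h.eps_le_Delta hn.le)) hV
  linarith

open Classical in
/-- Few good points are far from `μ` in any one direction. -/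
lemma card_far_le (h : Setting S μ G ε δ Δ) (v : Pt d) :
    ((G.filter fun i => 4 * (Δ / ε) * ‖v‖ ^ 2 < ⟪v, S i - μ⟫_ℝ ^ 2).card : ℝ) ≤ ε * n := by
  set H := G.filter fun i => 4 * (Δ / ε) * ‖v‖ ^ 2 < ⟪v, S i - μ⟫_ℝ ^ 2 with hH
  by_contra hlt
  push Not at hlt
  have hεn := mul_pos h.eps_pos h.cast_n_pos
  have hHp : (0 : ℝ) < H.card := hεn.trans hlt
  -- If there were too many far points, giving each of them the weight `t` would produce a tail of
  -- mass exactly `ε n` and second moment above `4 Δ n`, against the bound `3 Δ n` of `tail_le`.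
  set t := ε * n / H.card with ht
  have ht0 : 0 < t := by positivity
  have ht1 : t ≤ 1 := by rw [ht, div_le_one hHp]; exact hlt.le
  have hsum : ∀ f : Fin n → ℝ, ∑ i ∈ G, (if i ∈ H then t else 0) * f i = t * ∑ i ∈ H, f i := by
    intro f
    rw [Finset.mul_sum, hH, Finset.sum_filter]
    refine Finset.sum_congr rfl fun i hi => ?_
    by_cases hc : 4 * (Δ / ε) * ‖v‖ ^ 2 < ⟪v, S i - μ⟫_ℝ ^ 2
    · simp [hc, hi]
    · simp [hc]
  have htail := h.tail_le (r := fun i => if i ∈ H then t else 0)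
    (fun i => by split_ifs <;> linarith) (fun i => by split_ifs <;> linarith)
    (by
      have := hsum fun _ => 1
      simp only [mul_one, Finset.sum_const, nsmul_eq_mul] at this
      rw [this, ht, div_mul_cancel₀ _ hHp.ne']) v
  rw [hsum] at htail
  have hlow : H.card * (4 * (Δ / ε) * ‖v‖ ^ 2) < ∑ i ∈ H, ⟪v, S i - μ⟫_ℝ ^ 2 := by
    rw [← nsmul_eq_mul, ← Finset.sum_const]
    refine Finset.sum_lt_sum_of_nonempty (Finset.card_pos.1 (by exact_mod_cast hHp)) fun i hi => ?_
    exact (Finset.mem_filter.1 hi).2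
  have h2 := mul_lt_mul_of_pos_left hlow ht0
  have h3 : t * (H.card * (4 * (Δ / ε) * ‖v‖ ^ 2)) = 4 * Δ * n * ‖v‖ ^ 2 := by
    rw [ht]
    have := h.eps_pos.ne'
    field_simp
  have h4 : 0 ≤ Δ * n * ‖v‖ ^ 2 :=
    mul_nonneg (mul_nonneg h.Delta_pos.le h.cast_n_pos.le) (sq_nonneg _)
  linarith

/-- A good point within the threshold radius of `μ` can exceed the threshold only through the
displacement of the weighted mean, which is bounded by `mean_error_sq_le`. The few others are a tail
of mass at most `ε n`. -/
lemma good_score_le (h : Setting S μ G ε δ Δ) {ω : Fin n → ℝ} (hω : GoodWeights G ε ω)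
    (v : Pt d) :
    ∑ i ∈ G, ω i * excess v (wMean S ω) (threshold ε Δ v) (S i)
      ≤ n * scoreBound ε Δ v ⟪v, dev S Δ ω v⟫_ℝ := by
  classical
  have hn := h.cast_n_pos
  set m := ⟪v, wMean S ω - μ⟫_ℝ with hm
  -- Indicator of the far points. The threshold `8 Δ / ε` is twice the `4 Δ / ε` used here, which
  -- absorbs the factor 2 in `(a - m)² ≤ 2 a² + 2 m²`.
  set r : Fin n → ℝ := fun i => if 4 * (Δ / ε) * ‖v‖ ^ 2 < ⟪v, S i - μ⟫_ℝ ^ 2 then 1 else 0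
    with hr
  have hm2 := h.mean_error_sq_le hω v
  have hpt : ∀ i, ω i * excess v (wMean S ω) (threshold ε Δ v) (S i)
      ≤ 2 * (r i * ⟪v, S i - μ⟫_ℝ ^ 2) + ω i * (2 * m ^ 2) := by
    intro i
    have e : ⟪v, S i - wMean S ω⟫_ℝ = ⟪v, S i - μ⟫_ℝ - m := by
      rw [hm, ← inner_sub_right]; congr 1; abel
    have hrn : 0 ≤ r i * ⟪v, S i - μ⟫_ℝ ^ 2 := by
      simp only [hr]; split_ifs <;> positivity
    have h1 : excess v (wMean S ω) (threshold ε Δ v) (S i)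
        ≤ 2 * (r i * ⟪v, S i - μ⟫_ℝ ^ 2) + 2 * m ^ 2 := by
      refine max_le (by positivity) ?_
      rw [e, threshold]
      have h2 := sq_nonneg (⟪v, S i - μ⟫_ℝ + m)
      have h3 : 0 ≤ Δ / ε * ‖v‖ ^ 2 :=
        mul_nonneg (div_nonneg h.Delta_pos.le h.eps_pos.le) (sq_nonneg _)
      simp only [hr]
      split_ifs with hc
      · nlinarith
      · push Not at hc
        nlinarith
    calc _ ≤ ω i * (2 * (r i * ⟪v, S i - μ⟫_ℝ ^ 2) + 2 * m ^ 2) :=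
          mul_le_mul_of_nonneg_left h1 (hω.nonneg i)
      _ ≤ _ := by
        have := mul_le_mul_of_nonneg_right (hω.le_one i) hrn
        linarith
  refine (Finset.sum_le_sum fun i _ => hpt i).trans ?_
  rw [Finset.sum_add_distrib, ← Finset.mul_sum, ← Finset.sum_mul]
  have hcard : ∑ i ∈ G, r i ≤ ε * n := by
    have := h.card_far_le v
    simp only [hr, Finset.sum_ite, Finset.sum_const, nsmul_eq_mul, mul_one, mul_zero, add_zero]
    exact this
  have ht := h.tail_le (r := r) (fun i => by simp only [hr]; split_ifs <;> norm_num)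
    (fun i => by simp only [hr]; split_ifs <;> norm_num) hcard v
  have h2 := mul_le_mul_of_nonneg_right (h.sum_good_le hω.le_one)
    (by positivity : 0 ≤ 2 * m ^ 2)
  have hδ := mul_le_mul_of_nonneg_right h.delta_sq_le (sq_nonneg ‖v‖)
  have hV : 0 ≤ Δ * ‖v‖ ^ 2 := mul_nonneg h.Delta_pos.le (sq_nonneg _)
  have h3 : 2 * m ^ 2 ≤ Δ * ‖v‖ ^ 2 + 16 * ε * ⟪v, dev S Δ ω v⟫_ℝ := by linarith
  have h4 := mul_le_mul_of_nonneg_left h3 hn.le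
  rw [scoreBound]
  linarith

/-- The bad points carry most of the deviation. -/
lemma bad_second_ge (h : Setting S μ G ε δ Δ) {ω : Fin n → ℝ} (hω : GoodWeights G ε ω)
    (u : Pt d) :
    n * ((1 - 16 * ε) * ⟪u, dev S Δ ω u⟫_ℝ - 7 * Δ * ‖u‖ ^ 2)
      ≤ ∑ i ∈ Gᶜ, ω i * ⟪u, S i - wMean S ω⟫_ℝ ^ 2 := by
  have hn := h.cast_n_pos
  have hd := inner_devOp h.n_pos (max 0 (1 - 5 * Δ)) S ω u
  rw [← Finset.sum_add_sum_compl G, sum_good_recenter (μ := μ)] at hd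
  have hm2 := h.mean_error_sq_le hω u
  have hW := h.sum_good_ge_four hω
  have e1 := h.mean ω u hω.nonneg hω.le_one hW
  have e2 := (abs_le.1 (h.second ω u hω.nonneg hω.le_one hW)).2
  have hWle := h.sum_good_le hω.le_one
  have hWp : 0 ≤ ∑ i ∈ G, ω i := Finset.sum_nonneg fun i _ => hω.nonneg i
  set W := ∑ i ∈ G, ω i
  set m := ⟪u, wMean S ω - μ⟫_ℝ
  set a := ∑ i ∈ G, ω i * ⟪u, S i - μ⟫_ℝ
  set q := ⟪u, dev S Δ ω u⟫_ℝ
  set V := ‖u‖ ^ 2 with hV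
  have hV0 : 0 ≤ V := by positivity
  have hL : (1 - 5 * Δ) * V ≤ max 0 (1 - 5 * Δ) * V :=
    mul_le_mul_of_nonneg_right (le_max_right _ _) hV0
  have hL' := mul_le_mul_of_nonneg_left hL hn.le
  have h1 : -(2 * m * a) ≤ 2 * |m| * (δ * ‖u‖ * W) := by
    have : -(m * a) ≤ |m| * |a| := by rw [← abs_mul]; exact neg_le_abs _
    have : |m| * |a| ≤ |m| * (δ * ‖u‖ * W) := mul_le_mul_of_nonneg_left e1 (abs_nonneg _)
    linarith
  have h2 : 2 * |m| * (δ * ‖u‖ * W) ≤ (m ^ 2 + δ ^ 2 * V) * W := by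
    have := mul_nonneg (sq_nonneg (|m| - δ * ‖u‖)) hWp
    rw [← sq_abs m]
    nlinarith
  have h3 : (2 * m ^ 2 + δ ^ 2 * V + Δ * V + V) * W ≤ (2 * m ^ 2 + δ ^ 2 * V + Δ * V + V) * n :=
    mul_le_mul_of_nonneg_left hWle (by have := h.Delta_pos; positivity)
  have hδ := mul_le_mul_of_nonneg_right h.delta_sq_le hV0
  -- The seventh `Δ`: the other six are the gap between the upper bound `1 + Δ` and the shift `1 - 5
  -- * Δ`.
  have h4 : 2 * m ^ 2 + δ ^ 2 * V ≤ Δ * V + 16 * ε * q := by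
    have : 0 ≤ Δ * V := mul_nonneg h.Delta_pos.le hV0
    linarith
  have h5 := mul_le_mul_of_nonneg_left h4 hn.le
  have hd' : n * q = ((∑ i ∈ G, ω i * ⟪u, S i - μ⟫_ℝ ^ 2 - 2 * m * a + m ^ 2 * W)
    + ∑ i ∈ Gᶜ, ω i * ⟪u, S i - wMean S ω⟫_ℝ ^ 2) - n * (max 0 (1 - 5 * Δ) * V) := hd
  linarith

end Setting

end RobustMean

namespace RobustMean

/-! ### The step size by repeated halving. -/

section StepSize

variable {n : ℕ}

/-- The total score `∑ ω τ / (1 + s τ)` that is left when the weights are divided by `1 + s τ`. -/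
def leftScore (ω τ : Fin n → ℝ) (s : ℝ) : ℝ := ∑ i, ω i * τ i / (1 + s * τ i)

/-- The step size: `0` if the total score is already at most `4 n a`; otherwise `1 / (4 a)` is
halved, at most `ℓ` times, until the score that is left reaches `2 n a`. -/
def stepSize (F : ℝ → ℝ) (N a : ℝ) (ℓ : ℕ) : ℝ :=
  (fun s => if F s < 2 * N * a then s / 2 else s)^[ℓ] (if 4 * N * a < F 0 then 1 / (4 * a) else 0)

/-- Each term `τ / (1 + s τ)` is below `1 / s`. Starting from `s = 1 / (4 a)` therefore leaves at
most `4 n a`, without any knowledge of the scores. -/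
lemma leftScore_le_div {ω τ : Fin n → ℝ} (h1 : ∀ i, ω i ≤ 1)
    (hτ : ∀ i, 0 ≤ τ i) {s : ℝ} (hs : 0 < s) : leftScore ω τ s ≤ n / s := by
  have : ∀ i, ω i * τ i / (1 + s * τ i) ≤ 1 / s := fun i => by
    have h2 : 0 ≤ s * τ i := mul_nonneg hs.le (hτ i)
    rw [div_le_div_iff₀ (by linarith) hs]
    have := mul_le_mul_of_nonneg_right (h1 i) h2
    nlinarith
  refine (Finset.sum_le_sum fun i _ => this i).trans (le_of_eq ?_)
  simp [div_eq_mul_inv]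

/-- Halving cannot overshoot: a remaining score below `2 n a` stays below `4 n a`. -/
lemma leftScore_half_le {ω τ : Fin n → ℝ} (h0 : ∀ i, 0 ≤ ω i) (hτ : ∀ i, 0 ≤ τ i) {s : ℝ}
    (hs : 0 ≤ s) : leftScore ω τ (s / 2) ≤ 2 * leftScore ω τ s := by
  rw [leftScore, leftScore, Finset.mul_sum]
  refine Finset.sum_le_sum fun i _ => ?_
  have h2 : 0 ≤ s * τ i := mul_nonneg hs (hτ i)
  have h3 : 0 ≤ ω i * τ i := mul_nonneg (h0 i) (hτ i)
  rw [mul_div_assoc', div_le_div_iff₀ (by linarith) (by linarith)]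
  nlinarith [mul_nonneg h3 h2]

/-- Once `s` is below the reciprocal of the largest score, at least half of the original score
remains. This is why `ℓ` halvings are enough. -/
lemma half_le_leftScore {ω τ : Fin n → ℝ} (h0 : ∀ i, 0 ≤ ω i) (hτ : ∀ i, 0 ≤ τ i) {s : ℝ}
    (hs : 0 ≤ s) (hb : ∀ i, 0 < ω i → s * τ i ≤ 1) :
    leftScore ω τ 0 / 2 ≤ leftScore ω τ s := by
  rw [leftScore, leftScore, Finset.sum_div]
  refine Finset.sum_le_sum fun i _ => ?_
  rcases (h0 i).eq_or_lt with hz | hp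
  · simp [← hz]
  have h3 : 0 ≤ ω i * τ i := mul_nonneg (h0 i) (hτ i)
  have h4 := hb i hp
  have h2 : 0 ≤ s * τ i := mul_nonneg hs (hτ i)
  rw [zero_mul, add_zero, div_one]
  exact div_le_div_of_nonneg_left h3 (by linarith) (by linarith)

/-- The upper bound limits what the bad points may keep. The lower bound ensures that less than the
larger part of the removed weight comes from good points, whose score is at most `n a`; it is not
needed when the step size is zero, since then nothing is removed. -/
lemma stepSize_spec {ω τ : Fin n → ℝ} (h0 : ∀ i, 0 ≤ ω i) (h1 : ∀ i, ω i ≤ 1)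
    (hτ : ∀ i, 0 ≤ τ i) {a : ℝ} (ha : 4 * n * a < leftScore ω τ 0 → 0 < a) {ℓ : ℕ}
    (hb : ∀ i, 0 < ω i → τ i ≤ 2 ^ ℓ * (4 * a)) :
    0 ≤ stepSize (leftScore ω τ) n a ℓ ∧
    leftScore ω τ (stepSize (leftScore ω τ) n a ℓ) ≤ 4 * n * a ∧
    (stepSize (leftScore ω τ) n a ℓ = 0 ∨
      2 * n * a ≤ leftScore ω τ (stepSize (leftScore ω τ) n a ℓ)) := by
  set F := leftScore ω τ with hF
  set f : ℝ → ℝ := fun s => if F s < 2 * n * a then s / 2 else s with hf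
  by_cases hbig : 4 * n * a < F 0
  · have hap := ha hbig
    have hst : stepSize F n a ℓ = f^[ℓ] (1 / (4 * a)) := by rw [stepSize, if_pos hbig]
    rw [hst]
    -- Either the iteration has already stopped at an acceptable value, or every step so far was a
    -- halving and the value is known explicitly.
    have key : ∀ k, 0 < f^[k] (1 / (4 * a)) ∧ F (f^[k] (1 / (4 * a))) ≤ 4 * n * a ∧
        (2 * n * a ≤ F (f^[k] (1 / (4 * a))) ∨
          f^[k] (1 / (4 * a)) = 1 / (2 ^ k * (4 * a))) := by
      intro k
      induction k with
      | zero =>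
        refine ⟨by simpa using hap, ?_, Or.inr (by simp)⟩
        have := leftScore_le_div h1 hτ (s := 1 / (4 * a)) (by positivity)
        simp only [Function.iterate_zero, id_eq]
        refine this.trans (le_of_eq ?_)
        field_simp
      | succ k ih =>
        obtain ⟨i1, i2, i3⟩ := ih
        rw [Function.iterate_succ_apply']
        set s := f^[k] (1 / (4 * a)) with hs
        by_cases hc : F s < 2 * n * a
        · have e : f s = s / 2 := by simp only [hf]; rw [if_pos hc]
          rw [e]
          refine ⟨by positivity, ?_, Or.inr ?_⟩
          · have := leftScore_half_le h0 hτ i1.le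
            rw [← hF] at this
            linarith
          · rcases i3 with i3 | i3
            · exact absurd hc (not_lt.2 i3)
            · rw [i3, pow_succ]; field_simp
        · have e : f s = s := by simp only [hf]; rw [if_neg hc]
          rw [e]
          exact ⟨i1, i2, Or.inl (not_lt.1 hc)⟩
    obtain ⟨k1, k2, k3⟩ := key ℓ
    refine ⟨k1.le, k2, Or.inr ?_⟩
    rcases k3 with k3 | k3
    · exact k3
    · have := half_le_leftScore (s := f^[ℓ] (1 / (4 * a))) h0 hτ k1.le (fun i hi => by
        rw [k3, one_div, inv_mul_le_iff₀ (by positivity), mul_one]; exact hb i hi)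
      rw [← hF] at this
      linarith
  · have hst : stepSize F n a ℓ = 0 := by
      rw [stepSize, if_neg hbig]
      -- The iteration is run `ℓ` times in any case; the value `0` of the inactive filter survives
      -- it.
      have : Function.IsFixedPt f 0 := by simp [Function.IsFixedPt, hf]
      exact this.iterate ℓ
    rw [hst]
    exact ⟨le_rfl, not_lt.1 hbig, Or.inl rfl⟩

end StepSize

/-! ### One filter and its invariants. -/

section FilterStep

variable {d n : ℕ}

/-- The direction obtained from `z` by `ℓ` steps of the power method. -/
def powerDir (S : Fin n → Pt d) (Δ : ℝ) (ℓ : ℕ) (ω : Fin n → ℝ) (z : Pt d) : Pt d :=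
  (dev S Δ ω ^ ℓ) z

/-- The scores of the points in direction `v`. -/
def scores (S : Fin n → Pt d) (ε Δ : ℝ) (ω : Fin n → ℝ) (v : Pt d) (i : Fin n) : ℝ :=
  excess v (wMean S ω) (threshold ε Δ v) (S i)

/-- The step size of the filter in direction `v`. -/
def filterSize (S : Fin n → Pt d) (ε Δ : ℝ) (ℓ : ℕ) (ω : Fin n → ℝ) (v : Pt d) : ℝ :=
  stepSize (leftScore ω (scores S ε Δ ω v)) n (scoreBound ε Δ v ⟪v, dev S Δ ω v⟫_ℝ) ℓ

/-- The weights after filtering in direction `v`. -/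
def filterWeights (S : Fin n → Pt d) (ε Δ : ℝ) (ℓ : ℕ) (ω : Fin n → ℝ) (v : Pt d) (i : Fin n) :
    ℝ :=
  ω i / (1 + filterSize S ε Δ ℓ ω v * scores S ε Δ ω v i)

end FilterStep

/-- The weights are supported on points of squared distance at most `β` from a common centre, and
`β` is at most `2 ^ ℓ` times `7 Δ`. -/
structure BoundedSupport {d n : ℕ} (S : Fin n → Pt d) (Δ : ℝ) (ℓ : ℕ) (c : Pt d) (β : ℝ)
    (ω : Fin n → ℝ) : Prop where
  dist_le : ∀ i, 0 < ω i → ‖S i - c‖ ^ 2 ≤ β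
  bound_le : β ≤ 2 ^ ℓ * (7 * Δ)

namespace Setting

variable {d n : ℕ} {S : Fin n → Pt d} {μ : Pt d} {G : Finset (Fin n)} {ε δ Δ : ℝ}

/-- The weighted mean is a convex combination of points in the ball around `c`, so it lies in the
ball as well, and the diameter bounds the distance. -/
lemma norm_sub_wMean_sq_le (h : Setting S μ G ε δ Δ) {ω : Fin n → ℝ} (hω : GoodWeights G ε ω)
    {ℓ : ℕ} {c : Pt d} {β : ℝ} (hβ : BoundedSupport S Δ ℓ c β ω) {i : Fin n} (hi : 0 < ω i) :
    ‖S i - wMean S ω‖ ^ 2 ≤ 4 * β := by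
  have hβ0 : 0 ≤ β := (sq_nonneg _).trans (hβ.dist_le i hi)
  have hdist : ∀ j, 0 < ω j → ‖S j - c‖ ≤ √β := fun j hj => Real.le_sqrt_of_sq_le (hβ.dist_le j hj)
  have hW := h.sum_weights_pos hω
  have hmean : wMean S ω - c = (∑ j, ω j)⁻¹ • ∑ j, ω j • (S j - c) := by
    simp only [smul_sub, Finset.sum_sub_distrib, ← Finset.sum_smul]
    rw [smul_smul, inv_mul_cancel₀ hW.ne', one_smul, wMean]
  have h1 : ‖wMean S ω - c‖ ≤ √β := by
    rw [hmean, norm_smul, norm_inv, Real.norm_of_nonneg hW.le, inv_mul_le_iff₀ hW, Finset.sum_mul]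
    refine norm_sum_le_of_le _ fun j _ => ?_
    rw [norm_smul, Real.norm_of_nonneg (hω.nonneg j)]
    rcases (hω.nonneg j).eq_or_lt with hz | hp
    · simp [← hz]
    · exact mul_le_mul_of_nonneg_left (hdist j hp) hp.le
  have h2 : ‖S i - wMean S ω‖ ≤ 2 * √β := by
    have : S i - wMean S ω = (S i - c) - (wMean S ω - c) := by abel
    rw [this]
    exact (norm_sub_le _ _).trans (by linarith [hdist i hi])
  calc _ ≤ (2 * √β) ^ 2 := pow_le_pow_left₀ (norm_nonneg _) h2 2
    _ = 4 * β := by rw [mul_pow, Real.sq_sqrt hβ0]; norm_num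

/-- The hypothesis on the largest score under which `ℓ` halvings suffice; the term `7 * Δ * ‖v‖ ^ 2`
of `scoreBound` is what the maximal score is compared with. -/
lemma scores_le (h : Setting S μ G ε δ Δ) {ω : Fin n → ℝ} (hω : GoodWeights G ε ω)
    {ℓ : ℕ} {c : Pt d} {β : ℝ} (hβ : BoundedSupport S Δ ℓ c β ω) (v : Pt d) {i : Fin n}
    (hi : 0 < ω i) :
    scores S ε Δ ω v i ≤ 2 ^ ℓ * (4 * scoreBound ε Δ v ⟪v, dev S Δ ω v⟫_ℝ) := by
  have hV : 0 ≤ ‖v‖ ^ 2 := by positivity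
  have hq := h.dev_nonneg hω v
  have hε := h.eps_pos
  have hΔ := h.Delta_pos
  have hsb : 7 * Δ * ‖v‖ ^ 2 ≤ scoreBound ε Δ v ⟪v, dev S Δ ω v⟫_ℝ := by
    rw [scoreBound]
    have : 0 ≤ 16 * ε * ⟪v, dev S Δ ω v⟫_ℝ := by positivity
    linarith
  have h2 : (0 : ℝ) < 2 ^ ℓ := by positivity
  have hub : 4 * β * ‖v‖ ^ 2 ≤ 2 ^ ℓ * (4 * scoreBound ε Δ v ⟪v, dev S Δ ω v⟫_ℝ) := by
    have e1 := mul_le_mul_of_nonneg_right hβ.bound_le hV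
    have e2 := mul_le_mul_of_nonneg_left hsb h2.le
    nlinarith
  refine le_trans ?_ hub
  have hcs : ⟪v, S i - wMean S ω⟫_ℝ ^ 2 ≤ 4 * β * ‖v‖ ^ 2 := by
    have e1 := abs_real_inner_le_norm v (S i - wMean S ω)
    have e2 := h.norm_sub_wMean_sq_le hω hβ hi
    calc _ = |⟪v, S i - wMean S ω⟫_ℝ| ^ 2 := (sq_abs _).symm
      _ ≤ (‖v‖ * ‖S i - wMean S ω‖) ^ 2 := pow_le_pow_left₀ (abs_nonneg _) e1 2
      _ = ‖S i - wMean S ω‖ ^ 2 * ‖v‖ ^ 2 := by ring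
      _ ≤ _ := mul_le_mul_of_nonneg_right e2 hV
  have hth : 0 ≤ threshold ε Δ v := by rw [threshold]; positivity
  refine max_le ((sq_nonneg _).trans hcs) (by linarith)

lemma filterSize_spec (h : Setting S μ G ε δ Δ) {ω : Fin n → ℝ} (hω : GoodWeights G ε ω)
    {ℓ : ℕ} {c : Pt d} {β : ℝ} (hβ : BoundedSupport S Δ ℓ c β ω) (v : Pt d) :
    0 ≤ filterSize S ε Δ ℓ ω v ∧
    leftScore ω (scores S ε Δ ω v) (filterSize S ε Δ ℓ ω v)
      ≤ 4 * n * scoreBound ε Δ v ⟪v, dev S Δ ω v⟫_ℝ ∧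
    (filterSize S ε Δ ℓ ω v = 0 ∨ 2 * n * scoreBound ε Δ v ⟪v, dev S Δ ω v⟫_ℝ
      ≤ leftScore ω (scores S ε Δ ω v) (filterSize S ε Δ ℓ ω v)) := by
  have hε := h.eps_pos
  have hΔ := h.Delta_pos
  refine stepSize_spec hω.nonneg hω.le_one (fun i => excess_nonneg _ _ _ _) (fun hlt => ?_)
    (fun i hi => h.scores_le hω hβ v hi)
  have hq := h.dev_nonneg hω v
  rcases eq_or_ne v 0 with rfl | hv
  -- A zero direction has zero scores and zero bound, so the filter is inactive and the positivity
  -- of the bound is not required.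
  · simp [leftScore, excess, threshold, scoreBound] at hlt
  · have : 0 < ‖v‖ := norm_pos_iff.2 hv
    rw [scoreBound]
    positivity

section Filtered

variable {ω : Fin n → ℝ} {ℓ : ℕ} {c : Pt d} {β : ℝ}

lemma filterWeights_nonneg (h : Setting S μ G ε δ Δ) (hω : GoodWeights G ε ω)
    (hβ : BoundedSupport S Δ ℓ c β ω) (v : Pt d) (i : Fin n) :
    0 ≤ filterWeights S ε Δ ℓ ω v i :=
  div_nonneg (hω.nonneg i) (by
    have := mul_nonneg (h.filterSize_spec hω hβ v).1 (excess_nonneg v (wMean S ω)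
      (threshold ε Δ v) (S i))
    rw [scores]; linarith)

lemma filterWeights_le (h : Setting S μ G ε δ Δ) (hω : GoodWeights G ε ω)
    (hβ : BoundedSupport S Δ ℓ c β ω) (v : Pt d) (i : Fin n) :
    filterWeights S ε Δ ℓ ω v i ≤ ω i :=
  div_le_self (hω.nonneg i) (by
    have := mul_nonneg (h.filterSize_spec hω hβ v).1 (excess_nonneg v (wMean S ω)
      (threshold ε Δ v) (S i))
    rw [scores]; linarith)

/-- The form `ω / (1 + s τ)` makes the weight taken from a point equal to `s` times its remaining
score, so removed weight on any set of indices is compared by comparing remaining scores. -/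
lemma sub_filterWeights (h : Setting S μ G ε δ Δ) (hω : GoodWeights G ε ω)
    (hβ : BoundedSupport S Δ ℓ c β ω) (v : Pt d) (i : Fin n) :
    ω i - filterWeights S ε Δ ℓ ω v i
      = filterSize S ε Δ ℓ ω v * (filterWeights S ε Δ ℓ ω v i * scores S ε Δ ω v i) := by
  have h1 : 0 ≤ filterSize S ε Δ ℓ ω v * scores S ε Δ ω v i :=
    mul_nonneg (h.filterSize_spec hω hβ v).1 (excess_nonneg _ _ _ _)
  rw [filterWeights]
  have : 1 + filterSize S ε Δ ℓ ω v * scores S ε Δ ω v i ≠ 0 := by linarith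
  field_simp
  ring

lemma sum_filterWeights_scores {v : Pt d} :
    ∑ i, filterWeights S ε Δ ℓ ω v i * scores S ε Δ ω v i
      = leftScore ω (scores S ε Δ ω v) (filterSize S ε Δ ℓ ω v) :=
  Finset.sum_congr rfl fun i _ => by rw [filterWeights, div_mul_eq_mul_div]

/-- Filtering takes more weight from the bad points than from the good ones. -/
lemma goodWeights_filter (h : Setting S μ G ε δ Δ) (hω : GoodWeights G ε ω)
    (hβ : BoundedSupport S Δ ℓ c β ω) (v : Pt d) :
    GoodWeights G ε (filterWeights S ε Δ ℓ ω v) where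
  nonneg := h.filterWeights_nonneg hω hβ v
  le_one i := (h.filterWeights_le hω hβ v i).trans (hω.le_one i)
  loss := by
    obtain ⟨hs0, -, hs⟩ := h.filterSize_spec hω hβ v
    have e : ∀ A : Finset (Fin n), ∑ i ∈ A, (1 - filterWeights S ε Δ ℓ ω v i)
        = ∑ i ∈ A, (1 - ω i) + filterSize S ε Δ ℓ ω v
          * ∑ i ∈ A, filterWeights S ε Δ ℓ ω v i * scores S ε Δ ω v i := by
      intro A
      rw [Finset.mul_sum, ← Finset.sum_add_distrib]
      refine Finset.sum_congr rfl fun i _ => ?_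
      rw [← h.sub_filterWeights hω hβ]; ring
    rw [e, e]
    have hloss := hω.loss
    rcases hs with hs | hs
    · rw [hs]; linarith
    -- At least twice the bound of the good score remains in total, and at most once the bound on
    -- the good points, so the bad points hold at least as much of it.
    have hg : ∑ i ∈ G, filterWeights S ε Δ ℓ ω v i * scores S ε Δ ω v i
        ≤ n * scoreBound ε Δ v ⟪v, dev S Δ ω v⟫_ℝ :=
      (Finset.sum_le_sum fun i _ => mul_le_mul_of_nonneg_right (h.filterWeights_le hω hβ v i)
        (excess_nonneg _ _ _ _)).trans (h.good_score_le hω v)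
    rw [← sum_filterWeights_scores, ← Finset.sum_add_sum_compl G] at hs
    have := mul_le_mul_of_nonneg_left (hg.trans (by linarith : _ ≤
      ∑ i ∈ Gᶜ, filterWeights S ε Δ ℓ ω v i * scores S ε Δ ω v i)) hs0
    linarith

lemma boundedSupport_filter (h : Setting S μ G ε δ Δ) (hω : GoodWeights G ε ω)
    (hβ : BoundedSupport S Δ ℓ c β ω) (v : Pt d) :
    BoundedSupport S Δ ℓ c β (filterWeights S ε Δ ℓ ω v) where
  dist_le i hi := hβ.dist_le i (hi.trans_le (h.filterWeights_le hω hβ v i))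
  bound_le := hβ.bound_le

/-- After filtering, the bad points contribute little in the direction of the filter. -/
lemma bad_second_filter_le (h : Setting S μ G ε δ Δ) (hω : GoodWeights G ε ω)
    (hβ : BoundedSupport S Δ ℓ c β ω) (v : Pt d) :
    ∑ i ∈ Gᶜ, filterWeights S ε Δ ℓ ω v i * ⟪v, S i - wMean S ω⟫_ℝ ^ 2
      ≤ n * (36 * Δ * ‖v‖ ^ 2 + 64 * ε * ⟪v, dev S Δ ω v⟫_ℝ) := by
  obtain ⟨hs0, hs, -⟩ := h.filterSize_spec hω hβ v
  have hnn := h.filterWeights_nonneg hω hβ v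
  have hth : 0 ≤ threshold ε Δ v := by
    have := h.eps_pos
    have := h.Delta_pos
    rw [threshold]; positivity
  have h1 : ∑ i ∈ Gᶜ, filterWeights S ε Δ ℓ ω v i * ⟪v, S i - wMean S ω⟫_ℝ ^ 2
      ≤ ∑ i ∈ Gᶜ, filterWeights S ε Δ ℓ ω v i * scores S ε Δ ω v i
        + (∑ i ∈ Gᶜ, filterWeights S ε Δ ℓ ω v i) * threshold ε Δ v := by
    rw [Finset.sum_mul, ← Finset.sum_add_distrib]
    refine Finset.sum_le_sum fun i _ => ?_
    rw [← mul_add]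
    refine mul_le_mul_of_nonneg_left ?_ (hnn i)
    have := le_max_right 0 (⟪v, S i - wMean S ω⟫_ℝ ^ 2 - threshold ε Δ v)
    rw [scores, excess]; linarith
  have h2 : ∑ i ∈ Gᶜ, filterWeights S ε Δ ℓ ω v i * scores S ε Δ ω v i
      ≤ leftScore ω (scores S ε Δ ω v) (filterSize S ε Δ ℓ ω v) := by
    rw [← sum_filterWeights_scores]
    exact Finset.sum_le_univ_sum_of_nonneg fun i => mul_nonneg (hnn i) (excess_nonneg _ _ _ _)
  have h3 : (∑ i ∈ Gᶜ, filterWeights S ε Δ ℓ ω v i) * threshold ε Δ v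
      ≤ ε * n * threshold ε Δ v :=
    mul_le_mul_of_nonneg_right (h.sum_bad_le (h.goodWeights_filter hω hβ v).le_one) hth
  -- The part below the threshold, at bad mass `ε n`, contributes `8 Δ`; four times `scoreBound`
  -- contributes the other `28 Δ` and the `64 ε`.
  have h4 : ε * n * threshold ε Δ v = n * (8 * Δ * ‖v‖ ^ 2) := by
    rw [threshold]
    have := h.eps_pos.ne'
    field_simp
  rw [scoreBound] at hs
  linarith

end Filtered

end Setting

end RobustMean

/-! ### Decay of the potential in one round. -/

namespace RobustMean

/-- The potential `tr (dev ^ (2 ℓ + 1))`. -/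
def potential {d n : ℕ} (S : Fin n → Pt d) (Δ : ℝ) (ℓ : ℕ) (ω : Fin n → ℝ) : ℝ :=
  LinearMap.trace ℝ (Pt d) (dev S Δ ω ^ (2 * ℓ + 1))

/-- One round: the weights are filtered in the direction that the power method finds from a random
sign vector. -/
def filterRound {d n : ℕ} (S : Fin n → Pt d) (ε Δ : ℝ) (ℓ : ℕ) (ω : Fin n → ℝ)
    (b : Fin d → Bool) : Fin n → ℝ :=
  filterWeights S ε Δ ℓ ω (powerDir S Δ ℓ ω (signVec b))

namespace Setting

variable {d n : ℕ} {S : Fin n → Pt d} {μ : Pt d} {G : Finset (Fin n)} {ε δ Δ : ℝ}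
  {ω : Fin n → ℝ} {ℓ : ℕ} {c : Pt d} {β : ℝ}

lemma potential_nonneg (h : Setting S μ G ε δ Δ) (hω : GoodWeights G ε ω) (ℓ : ℕ) :
    0 ≤ potential S Δ ℓ ω :=
  trace_pow_nonneg (devOp_symmetric _ _ _) (h.dev_nonneg hω) _

/-- Lowering the weights lowers the quadratic form of `dev` at least by the contribution of the
weights taken from the bad points. -/
lemma inner_dev_le (h : Setting S μ G ε δ Δ) {ω' : Fin n → ℝ} (h0 : ∀ i, 0 ≤ ω' i)
    (h1 : ∀ i, ω' i ≤ ω i) (u : Pt d) :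
    n * ⟪u, dev S Δ ω' u⟫_ℝ ≤ n * ⟪u, dev S Δ ω u⟫_ℝ
      - ∑ i ∈ Gᶜ, (ω i - ω' i) * ⟪u, S i - wMean S ω⟫_ℝ ^ 2 := by
  rw [inner_devOp h.n_pos, inner_devOp h.n_pos]
  have e1 := sum_mul_sq_wMean_le S h0 u (wMean S ω)
  have e2 : ∑ i ∈ Gᶜ, (ω i - ω' i) * ⟪u, S i - wMean S ω⟫_ℝ ^ 2
      ≤ ∑ i, (ω i - ω' i) * ⟪u, S i - wMean S ω⟫_ℝ ^ 2 :=
    Finset.sum_le_univ_sum_of_nonneg fun i => mul_nonneg (by linarith [h1 i]) (sq_nonneg _)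
  simp only [sub_mul, Finset.sum_sub_distrib] at e2 ⊢
  linarith

/-- After `trace_pow_succ_le` the outer powers are those of the old operator and only the innermost
factor is new. Hence the loss is linear in the removed weights and can be averaged over the random
direction. -/
lemma potential_le_of_le (h : Setting S μ G ε δ Δ) {ω' : Fin n → ℝ}
    (hω' : GoodWeights G ε ω') (h1 : ∀ i, ω' i ≤ ω i) (ℓ : ℕ) :
    n * potential S Δ ℓ ω' ≤ n * potential S Δ ℓ ω
      - ∑ i ∈ Gᶜ, (ω i - ω' i) * ‖(dev S Δ ω ^ ℓ) (S i - wMean S ω)‖ ^ 2 := by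
  have hn := h.cast_n_pos
  have hsym := devOp_symmetric (max 0 (1 - 5 * Δ)) S ω
  let e := EuclideanSpace.basisFun (Fin d) ℝ
  have hle : ∀ u, ⟪u, dev S Δ ω' u⟫_ℝ ≤ ⟪u, dev S Δ ω u⟫_ℝ := fun u => by
    have e1 := h.inner_dev_le hω'.nonneg h1 u
    have e2 : 0 ≤ ∑ i ∈ Gᶜ, (ω i - ω' i) * ⟪u, S i - wMean S ω⟫_ℝ ^ 2 :=
      Finset.sum_nonneg fun i _ => mul_nonneg (by linarith [h1 i]) (sq_nonneg _)
    exact le_of_mul_le_mul_left (by linarith) hn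
  have hT := trace_pow_succ_le hsym (devOp_symmetric (max 0 (1 - 5 * Δ)) S ω')
    (h.dev_nonneg hω') hle (2 * ℓ)
  rw [trace_pow_mul_eq_sum e hsym] at hT
  have hP : potential S Δ ℓ ω
      = ∑ j, ⟪(dev S Δ ω ^ ℓ) (e j), dev S Δ ω ((dev S Δ ω ^ ℓ) (e j))⟫_ℝ := by
    rw [potential, pow_succ, trace_pow_mul_eq_sum e hsym]
  calc n * potential S Δ ℓ ω'
      ≤ n * ∑ j, ⟪(dev S Δ ω ^ ℓ) (e j), dev S Δ ω' ((dev S Δ ω ^ ℓ) (e j))⟫_ℝ :=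
        mul_le_mul_of_nonneg_left hT hn.le
    _ ≤ ∑ j, (n * ⟪(dev S Δ ω ^ ℓ) (e j), dev S Δ ω ((dev S Δ ω ^ ℓ) (e j))⟫_ℝ
        - ∑ i ∈ Gᶜ, (ω i - ω' i) * ⟪(dev S Δ ω ^ ℓ) (e j), S i - wMean S ω⟫_ℝ ^ 2) := by
        rw [Finset.mul_sum]
        exact Finset.sum_le_sum fun j _ => h.inner_dev_le hω'.nonneg h1 _
    _ = _ := by
        rw [Finset.sum_sub_distrib, ← Finset.mul_sum, ← hP, Finset.sum_comm]
        congr 1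
        refine Finset.sum_congr rfl fun i _ => ?_
        rw [← Finset.mul_sum, sum_inner_pow_sq e hsym]

/-- Summation of `bad_second_ge` over the images of an orthonormal basis under `dev ^ ℓ`: up to `tr
(dev ^ (2 ℓ))` times `Δ`, the potential sits on the bad points. -/
lemma bad_power_ge (h : Setting S μ G ε δ Δ) (hω : GoodWeights G ε ω) (ℓ : ℕ) :
    n * ((1 - 16 * ε) * potential S Δ ℓ ω
        - 7 * Δ * LinearMap.trace ℝ (Pt d) (dev S Δ ω ^ (2 * ℓ)))
      ≤ ∑ i ∈ Gᶜ, ω i * ‖(dev S Δ ω ^ ℓ) (S i - wMean S ω)‖ ^ 2 := by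
  have hsym := devOp_symmetric (max 0 (1 - 5 * Δ)) S ω
  let e := EuclideanSpace.basisFun (Fin d) ℝ
  have hP : potential S Δ ℓ ω
      = ∑ j, ⟪(dev S Δ ω ^ ℓ) (e j), dev S Δ ω ((dev S Δ ω ^ ℓ) (e j))⟫_ℝ := by
    rw [potential, pow_succ, trace_pow_mul_eq_sum e hsym]
  have hψ : LinearMap.trace ℝ (Pt d) (dev S Δ ω ^ (2 * ℓ)) = ∑ j, ‖(dev S Δ ω ^ ℓ) (e j)‖ ^ 2 := by
    rw [← mul_one (dev S Δ ω ^ (2 * ℓ)), trace_pow_mul_eq_sum e hsym]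
    simp
  have hrhs : ∑ i ∈ Gᶜ, ω i * ‖(dev S Δ ω ^ ℓ) (S i - wMean S ω)‖ ^ 2
      = ∑ j, ∑ i ∈ Gᶜ, ω i * ⟪(dev S Δ ω ^ ℓ) (e j), S i - wMean S ω⟫_ℝ ^ 2 := by
    rw [Finset.sum_comm]
    refine Finset.sum_congr rfl fun i _ => ?_
    rw [← Finset.mul_sum, sum_inner_pow_sq e hsym]
  rw [hP, hψ, hrhs, Finset.mul_sum, Finset.mul_sum, ← Finset.sum_sub_distrib, Finset.mul_sum]
  exact Finset.sum_le_sum fun j _ => h.bad_second_ge hω _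

lemma expect_norm_powerDir_sq (S : Fin n → Pt d) (Δ : ℝ) (ℓ : ℕ) (ω : Fin n → ℝ) :
    𝔼 b : Fin d → Bool, ‖powerDir S Δ ℓ ω (signVec b)‖ ^ 2
      = LinearMap.trace ℝ (Pt d) (dev S Δ ω ^ (2 * ℓ)) := by
  have hsym := devOp_symmetric (max 0 (1 - 5 * Δ)) S ω
  rw [← expect_inner_signVec_apply (hsym.pow _)]
  refine Finset.expect_congr rfl fun b _ => ?_
  rw [← real_inner_self_eq_norm_sq, powerDir, hsym.pow ℓ, two_mul, pow_add, Module.End.mul_apply]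

/-- Reason for the odd exponent: the quadratic form of `dev` at `dev ^ ℓ z` is that of `dev ^ (2 ℓ +
1)` at `z`, and a sign vector averages it to the trace. -/
lemma expect_inner_powerDir (S : Fin n → Pt d) (Δ : ℝ) (ℓ : ℕ) (ω : Fin n → ℝ) :
    𝔼 b : Fin d → Bool, ⟪powerDir S Δ ℓ ω (signVec b),
      dev S Δ ω (powerDir S Δ ℓ ω (signVec b))⟫_ℝ = potential S Δ ℓ ω := by
  have hsym := devOp_symmetric (max 0 (1 - 5 * Δ)) S ω
  rw [potential, ← expect_inner_signVec_apply (hsym.pow _)]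
  refine Finset.expect_congr rfl fun b _ => ?_
  have : 2 * ℓ + 1 = ℓ + (1 + ℓ) := by ring
  rw [powerDir, hsym.pow ℓ, this, pow_add, pow_add, pow_one, Module.End.mul_apply,
    Module.End.mul_apply]

lemma filterRound_nonneg (h : Setting S μ G ε δ Δ) (hω : GoodWeights G ε ω)
    (hβ : BoundedSupport S Δ ℓ c β ω) (b : Fin d → Bool) (i : Fin n) :
    0 ≤ filterRound S ε Δ ℓ ω b i := h.filterWeights_nonneg hω hβ _ i

/-- On average, a round decreases the potential by a constant factor, up to a term that is
negligible once the deviation is of order `Δ`. -/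
theorem expect_potential_le (h : Setting S μ G ε δ Δ) (hω : GoodWeights G ε ω)
    (hβ : BoundedSupport S Δ ℓ c β ω) :
    𝔼 b, potential S Δ ℓ (filterRound S ε Δ ℓ ω b)
      ≤ 4 / 5 * potential S Δ ℓ ω + d / 10 * (270 * Δ) ^ (2 * ℓ + 1) := by
  have hn := h.cast_n_pos
  have hsym := devOp_symmetric (max 0 (1 - 5 * Δ)) S ω
  set A := dev S Δ ω with hA
  set y : Fin n → Pt d := fun i => S i - wMean S ω with hy
  set φ := potential S Δ ℓ ω with hφ
  set ψ := LinearMap.trace ℝ (Pt d) (A ^ (2 * ℓ)) with hψ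
  set Q := ∑ i ∈ Gᶜ, ω i * ‖(A ^ ℓ) (y i)‖ ^ 2 with hQ
  have hφ0 : 0 ≤ φ := h.potential_nonneg hω ℓ
  have hQge : n * ((1 - 16 * ε) * φ - 7 * Δ * ψ) ≤ Q := h.bad_power_ge hω ℓ
  have hstep : ∀ b, n * potential S Δ ℓ (filterRound S ε Δ ℓ ω b)
      ≤ n * φ - Q + ∑ i ∈ Gᶜ, filterRound S ε Δ ℓ ω b i * ‖(A ^ ℓ) (y i)‖ ^ 2 := by
    intro b
    have := h.potential_le_of_le (ω := ω) (h.goodWeights_filter hω hβ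
      (powerDir S Δ ℓ ω (signVec b))) (h.filterWeights_le hω hβ _) ℓ
    simp only [sub_mul, Finset.sum_sub_distrib] at this
    rw [filterRound]
    linarith
  have hbad : ∑ i ∈ Gᶜ, 𝔼 b, filterRound S ε Δ ℓ ω b i * ‖(A ^ ℓ) (y i)‖ ^ 2
      ≤ 2 / 3 * Q + 2 / 3 * (n * (36 * Δ * ψ + 64 * ε * φ)) := by
    have h1 : ∀ i, 𝔼 b, filterRound S ε Δ ℓ ω b i * ‖(A ^ ℓ) (y i)‖ ^ 2
        ≤ 2 / 3 * (ω i * ‖(A ^ ℓ) (y i)‖ ^ 2)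
          + 2 / 3 * 𝔼 b, filterRound S ε Δ ℓ ω b i
            * ⟪powerDir S Δ ℓ ω (signVec b), y i⟫_ℝ ^ 2 := by
      intro i
      have := expect_weight_mul_sq_le ((A ^ ℓ) (y i)) (ω i)
        (fun b => filterRound S ε Δ ℓ ω b i) (fun b => h.filterRound_nonneg hω hβ b i)
        (fun b => h.filterWeights_le hω hβ _ i)
      simp only [powerDir]
      simpa only [hsym.pow ℓ _ _] using this
    refine (Finset.sum_le_sum fun i _ => h1 i).trans ?_
    rw [Finset.sum_add_distrib, ← Finset.mul_sum, ← Finset.mul_sum, ← hQ,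
      ← Finset.expect_sum_comm]
    have h2 : 𝔼 b, ∑ i ∈ Gᶜ, filterRound S ε Δ ℓ ω b i
          * ⟪powerDir S Δ ℓ ω (signVec b), y i⟫_ℝ ^ 2
        ≤ 𝔼 b : Fin d → Bool, n * (36 * Δ * ‖powerDir S Δ ℓ ω (signVec b)‖ ^ 2 + 64 * ε *
          ⟪powerDir S Δ ℓ ω (signVec b), A (powerDir S Δ ℓ ω (signVec b))⟫_ℝ) :=
      Finset.expect_le_expect fun b _ => h.bad_second_filter_le hω hβ _
    rw [← Finset.mul_expect, Finset.expect_add_distrib, ← Finset.mul_expect, ← Finset.mul_expect,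
      expect_norm_powerDir_sq, expect_inner_powerDir] at h2
    linarith
  have hE : n * 𝔼 b, potential S Δ ℓ (filterRound S ε Δ ℓ ω b)
      ≤ n * φ - Q + ∑ i ∈ Gᶜ, 𝔼 b, filterRound S ε Δ ℓ ω b i * ‖(A ^ ℓ) (y i)‖ ^ 2 := by
    rw [Finset.mul_expect]
    refine (Finset.expect_le_expect fun b _ => hstep b).trans (le_of_eq ?_)
    rw [Finset.expect_add_distrib, Fintype.expect_const, Finset.expect_sum_comm]
  -- The lower-order trace now carries `Δ` with the total factor `79 / 3`. Comparing at level `270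
  -- Δ` turns this into less than a tenth of the potential and a tenth of the error term.
  have hψ1 := mul_trace_pow_le hsym (h.dev_nonneg hω) (θ := 270 * Δ)
    (by linarith [h.Delta_pos]) (2 * ℓ)
  rw [finrank_euclideanSpace_fin] at hψ1
  have hψ2 : 270 * Δ * ψ ≤ φ + d * (270 * Δ) ^ (2 * ℓ + 1) := hψ1
  have hεφ := mul_le_mul_of_nonneg_right h.eps_le hφ0
  have hΘ : 0 ≤ d * (270 * Δ) ^ (2 * ℓ + 1) :=
    mul_nonneg (Nat.cast_nonneg _) (pow_nonneg (by linarith [h.Delta_pos]) _)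
  rw [div_mul_eq_mul_div (d : ℝ)]
  have hfin : n * 𝔼 b, potential S Δ ℓ (filterRound S ε Δ ℓ ω b)
      ≤ n * (4 / 5 * φ + d * (270 * Δ) ^ (2 * ℓ + 1) / 10) := by
    -- Two thirds of the potential remain, `48 ε` times the potential is negligible, and less than a
    -- tenth comes from the trace of order `2 ℓ`; together this is below `4 / 5`.
    have hin : φ - 1 / 3 * ((1 - 16 * ε) * φ - 7 * Δ * ψ) + 2 / 3 * (36 * Δ * ψ + 64 * ε * φ)
        ≤ 4 / 5 * φ + d * (270 * Δ) ^ (2 * ℓ + 1) / 10 := by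
      generalize d * (270 * Δ) ^ (2 * ℓ + 1) = Θ at *
      linarith
    have := mul_le_mul_of_nonneg_left hin hn.le
    linarith
  exact le_of_mul_le_mul_left hfin hn

end Setting

end RobustMean

/-! ### Iteration of the rounds and accuracy of the final mean. -/

namespace RobustMean

/-- The weights after `T` rounds that use the sign vectors encoded by `z`. -/
def rounds {d n : ℕ} (S : Fin n → Pt d) (ε Δ : ℝ) (ℓ : ℕ) (ω : Fin n → ℝ) :
    (T : ℕ) → (Fin T → Fin d → Bool) → Fin n → ℝ
  | 0, _ => ω
  | T + 1, z => filterRound S ε Δ ℓ (rounds S ε Δ ℓ ω T (fun i => z i.castSucc)) (z (Fin.last T))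

/-- Conditioning on all rounds but the last, whose sign vector is independent of the weights it
meets. -/
lemma expect_snoc {γ : Type} [Fintype γ] [Nonempty γ] {T : ℕ} (f : (Fin (T + 1) → γ) → ℝ) :
    𝔼 z, f z = 𝔼 z : Fin T → γ, 𝔼 a, f (Fin.snoc z a) := by
  classical
  rw [← Fintype.expect_equiv (Fin.snocEquiv fun _ : Fin (T + 1) => γ)
    (fun p => f (Fin.snoc p.2 p.1)) f (fun _ => rfl), ← Finset.univ_product_univ,
    Finset.expect_product]
  exact Finset.expect_comm _ _ _

namespace Setting

variable {d n : ℕ} {S : Fin n → Pt d} {μ : Pt d} {G : Finset (Fin n)} {ε δ Δ : ℝ}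
  {ω : Fin n → ℝ} {ℓ : ℕ} {c : Pt d} {β : ℝ}

lemma rounds_good (h : Setting S μ G ε δ Δ) (hω : GoodWeights G ε ω)
    (hβ : BoundedSupport S Δ ℓ c β ω) (T : ℕ) (z : Fin T → Fin d → Bool) :
    GoodWeights G ε (rounds S ε Δ ℓ ω T z) ∧ BoundedSupport S Δ ℓ c β (rounds S ε Δ ℓ ω T z) := by
  induction T with
  | zero => exact ⟨hω, hβ⟩
  | succ T ih =>
    obtain ⟨h1, h2⟩ := ih (fun i => z i.castSucc)
    exact ⟨h.goodWeights_filter h1 h2 _, h.boundedSupport_filter h1 h2 _⟩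

/-- Geometric recursion; the additive term is a tenth of `d (270 Δ) ^ (2 ℓ + 1)`, and division by `1
- 4 / 5` makes it a half. -/
lemma expect_potential_rounds_le (h : Setting S μ G ε δ Δ) (hω : GoodWeights G ε ω)
    (hβ : BoundedSupport S Δ ℓ c β ω) (T : ℕ) :
    𝔼 z, potential S Δ ℓ (rounds S ε Δ ℓ ω T z)
      ≤ (4 / 5) ^ T * potential S Δ ℓ ω + d * (270 * Δ) ^ (2 * ℓ + 1) / 2 := by
  have hΘ : 0 ≤ d * (270 * Δ) ^ (2 * ℓ + 1) :=
    mul_nonneg (Nat.cast_nonneg _) (pow_nonneg (by linarith [h.Delta_pos]) _)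
  induction T with
  | zero =>
    simp only [rounds, Fintype.expect_const, pow_zero, one_mul]
    linarith
  | succ T ih =>
    rw [expect_snoc]
    have h1 : ∀ z : Fin T → Fin d → Bool,
        𝔼 a, potential S Δ ℓ (rounds S ε Δ ℓ ω (T + 1) (Fin.snoc z a))
        ≤ 4 / 5 * potential S Δ ℓ (rounds S ε Δ ℓ ω T z)
          + d / 10 * (270 * Δ) ^ (2 * ℓ + 1) := by
      intro z
      obtain ⟨g1, g2⟩ := h.rounds_good hω hβ T z
      simp only [rounds, Fin.snoc_castSucc, Fin.snoc_last]
      exact h.expect_potential_le g1 g2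
    refine (Finset.expect_le_expect fun z _ => h1 z).trans ?_
    rw [Finset.expect_add_distrib, ← Finset.mul_expect, Fintype.expect_const, pow_succ' (4 / 5 : ℝ),
      div_mul_eq_mul_div (d : ℝ)]
    linarith

/-- The second moment about the mean is at most the one about the pruning centre, so `dev` is at
most `β`. The `7` of `BoundedSupport` is enlarged to `270` to match the error term of the recursion.
-/
lemma potential_le_initial (h : Setting S μ G ε δ Δ) (hω : GoodWeights G ε ω)
    (hβ : BoundedSupport S Δ ℓ c β ω) (hβ0 : 0 ≤ β) :
    potential S Δ ℓ ω ≤ d * (2 ^ ℓ * (270 * Δ)) ^ (2 * ℓ + 1) := by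
  have hn := h.cast_n_pos
  have hΔ := h.Delta_pos
  have hle : ∀ u, ⟪u, dev S Δ ω u⟫_ℝ ≤ β * ‖u‖ ^ 2 := fun u => by
    have h1 := inner_devOp h.n_pos (max 0 (1 - 5 * Δ)) S ω u
    have h2 := sum_mul_sq_wMean_le S hω.nonneg u c
    have h3 : ∑ i, ω i * ⟪u, S i - c⟫_ℝ ^ 2 ≤ ∑ _i : Fin n, β * ‖u‖ ^ 2 := by
      refine Finset.sum_le_sum fun i _ => ?_
      rcases (hω.nonneg i).eq_or_lt with hz | hp
      · rw [← hz, zero_mul]; positivity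
      have e1 : ⟪u, S i - c⟫_ℝ ^ 2 ≤ β * ‖u‖ ^ 2 := by
        calc _ = |⟪u, S i - c⟫_ℝ| ^ 2 := (sq_abs _).symm
          _ ≤ (‖u‖ * ‖S i - c‖) ^ 2 :=
            pow_le_pow_left₀ (abs_nonneg _) (abs_real_inner_le_norm _ _) 2
          _ = ‖S i - c‖ ^ 2 * ‖u‖ ^ 2 := by ring
          _ ≤ _ := mul_le_mul_of_nonneg_right (hβ.dist_le i hp) (sq_nonneg _)
      exact (mul_le_of_le_one_left (sq_nonneg _) (hω.le_one i)).trans e1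
    have h4 : 0 ≤ n * (max 0 (1 - 5 * Δ) * ‖u‖ ^ 2) := by positivity
    simp only [Finset.sum_const, Finset.card_univ, Fintype.card_fin, nsmul_eq_mul] at h3
    exact le_of_mul_le_mul_left (h1.le.trans (by linarith)) hn
  have := trace_pow_le_of_inner_le (devOp_symmetric _ _ _) (h.dev_nonneg hω) hle (2 * ℓ + 1)
  rw [finrank_euclideanSpace_fin] at this
  refine this.trans (mul_le_mul_of_nonneg_left (pow_le_pow_left₀ hβ0 ?_ _) (Nat.cast_nonneg _))
  refine hβ.bound_le.trans (mul_le_mul_of_nonneg_left (by linarith) (by positivity))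

/-- Fixes the number of rounds: four of them gain a factor 2, since `(4 / 5) ^ 4 ≤ 1 / 2`, and `4 ℓ²
≥ ℓ (2 ℓ + 1) + 1`. -/
lemma four_fifths_pow_mul_le {ℓ : ℕ} (hℓ : 1 ≤ ℓ) :
    (4 / 5 : ℝ) ^ (16 * ℓ ^ 2) * (2 ^ ℓ) ^ (2 * ℓ + 1) ≤ 1 / 2 := by
  have h1 : (4 / 5 : ℝ) ^ (16 * ℓ ^ 2) ≤ (1 / 2) ^ (4 * ℓ ^ 2) := by
    have : 16 * ℓ ^ 2 = 4 * (4 * ℓ ^ 2) := by ring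
    rw [this, pow_mul]
    exact pow_le_pow_left₀ (by positivity) (by norm_num) _
  have h2 : (1 / 2 : ℝ) ^ (4 * ℓ ^ 2) ≤ (1 / 2) ^ (ℓ * (2 * ℓ + 1) + 1) :=
    pow_le_pow_of_le_one (by norm_num) (by norm_num) (by nlinarith)
  calc (4 / 5 : ℝ) ^ (16 * ℓ ^ 2) * (2 ^ ℓ) ^ (2 * ℓ + 1)
      ≤ (1 / 2) ^ (ℓ * (2 * ℓ + 1) + 1) * (2 ^ ℓ) ^ (2 * ℓ + 1) :=
        mul_le_mul_of_nonneg_right (h1.trans h2) (by positivity)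
    _ = 1 / 2 := by
      rw [← pow_mul, pow_succ, mul_right_comm, ← mul_pow]
      norm_num

lemma expect_potential_final (h : Setting S μ G ε δ Δ) (hω : GoodWeights G ε ω)
    (hβ : BoundedSupport S Δ ℓ c β ω) (hβ0 : 0 ≤ β) (hℓ : 1 ≤ ℓ) :
    𝔼 z, potential S Δ ℓ (rounds S ε Δ ℓ ω (16 * ℓ ^ 2) z) ≤ d * (270 * Δ) ^ (2 * ℓ + 1) := by
  have h1 := h.expect_potential_rounds_le hω hβ (16 * ℓ ^ 2)
  have h2 := h.potential_le_initial hω hβ hβ0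
  have hΘ : 0 ≤ d * (270 * Δ) ^ (2 * ℓ + 1) :=
    mul_nonneg (Nat.cast_nonneg _) (pow_nonneg (by linarith [h.Delta_pos]) _)
  have h3 := mul_le_mul_of_nonneg_left h2 (by positivity : (0 : ℝ) ≤ (4 / 5) ^ (16 * ℓ ^ 2))
  have h4 := mul_le_mul_of_nonneg_right (four_fifths_pow_mul_le hℓ) hΘ
  rw [mul_pow] at h3
  linarith

/-- If the potential is small, the weighted mean is accurate. -/
lemma norm_wMean_sub_le (h : Setting S μ G ε δ Δ) (hω : GoodWeights G ε ω)
    (hφ : potential S Δ ℓ ω ≤ (2 * (270 * Δ)) ^ (2 * ℓ + 1)) :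
    ‖wMean S ω - μ‖ ≤ 66 * δ := by
  have hΔ := h.Delta_pos
  have hδ := h.delta_pos
  rcases eq_or_ne (wMean S ω - μ) 0 with hz | hne
  · rw [hz, norm_zero]; positivity
  have hpos : 0 < ‖wMean S ω - μ‖ := norm_pos_iff.2 hne
  set v := ‖wMean S ω - μ‖⁻¹ • (wMean S ω - μ) with hv
  have hv1 : ‖v‖ = 1 := by
    rw [hv, norm_smul, norm_inv, norm_norm, inv_mul_cancel₀ hpos.ne']
  have hin : ⟪v, wMean S ω - μ⟫_ℝ = ‖wMean S ω - μ‖ := by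
    rw [hv, inner_smul_left, real_inner_self_eq_norm_sq]
    simp only [conj_trivial]
    field_simp
  have h1 := inner_pow_le_trace_pow (devOp_symmetric _ _ _) (h.dev_nonneg hω) hv1 (2 * ℓ + 1)
  have h2 : ⟪v, dev S Δ ω v⟫_ℝ ≤ 2 * (270 * Δ) :=
    le_of_pow_le_pow_left₀ (by omega) (by positivity) (h1.trans hφ)
  have h3 := h.mean_error_sq_le hω v
  rw [hv1, hin] at h3
  have h4 := mul_le_mul_of_nonneg_left h2 h.eps_pos.le
  have h5 := h.eps_mul
  -- Numerically `2 δ² + 8 ε * 540 Δ = 4322 δ²`, and `66² = 4356`.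
  refine le_of_pow_le_pow_left₀ two_ne_zero (by positivity) ?_
  nlinarith

open Classical in
/-- Few sequences of sign vectors lead to an inaccurate mean. -/
theorem card_inaccurate_le (h : Setting S μ G ε δ Δ) (hω : GoodWeights G ε ω)
    (hβ : BoundedSupport S Δ ℓ c β ω) (hβ0 : 0 ≤ β) (hℓ : 1 ≤ ℓ) {τ : ℝ} (hτ : 0 < τ)
    (hd : 2 * d / τ ≤ 2 ^ ℓ) :
    ((Finset.univ.filter fun z : Fin (16 * ℓ ^ 2) → Fin d → Bool =>
        66 * δ < ‖wMean S (rounds S ε Δ ℓ ω (16 * ℓ ^ 2) z) - μ‖).card : ℝ)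
      ≤ τ / 2 * Fintype.card (Fin (16 * ℓ ^ 2) → Fin d → Bool) := by
  set A := Finset.univ.filter fun z : Fin (16 * ℓ ^ 2) → Fin d → Bool =>
        66 * δ < ‖wMean S (rounds S ε Δ ℓ ω (16 * ℓ ^ 2) z) - μ‖ with hA
  set Θ := (270 * Δ) ^ (2 * ℓ + 1) with hΘ
  have hΘ0 : 0 < Θ := pow_pos (by linarith [h.Delta_pos]) _
  have hE := h.expect_potential_final hω hβ hβ0 hℓ
  rw [Fintype.expect_eq_sum_div_card, div_le_iff₀ (by exact_mod_cast Fintype.card_pos)] at hE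
  set N : ℝ := (Fintype.card (Fin (16 * ℓ ^ 2) → Fin d → Bool) : ℝ)
  have hN : 0 ≤ N := Nat.cast_nonneg _
  have h1 : A.card * (2 ^ (2 * ℓ + 1) * Θ)
      ≤ ∑ z, potential S Δ ℓ (rounds S ε Δ ℓ ω (16 * ℓ ^ 2) z) := by
    rw [← nsmul_eq_mul, ← Finset.sum_const]
    refine (Finset.sum_le_sum (g := fun z => potential S Δ ℓ (rounds S ε Δ ℓ ω (16 * ℓ ^ 2) z))
      fun z hz => ?_).trans (Finset.sum_le_univ_sum_of_nonneg fun z =>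
        h.potential_nonneg (h.rounds_good hω hβ _ z).1 ℓ)
    by_contra hlt
    push Not at hlt
    rw [hΘ, ← mul_pow] at hlt
    exact absurd (h.norm_wMean_sub_le (h.rounds_good hω hβ _ z).1 hlt.le)
      (not_le.2 (Finset.mem_filter.1 hz).2)
  -- Markov's inequality: an inaccurate mean forces the potential above `2 ^ (2 ℓ + 1)` times `Θ`,
  -- while its average is at most `d` times `Θ`.
  have h2 : (d : ℝ) ≤ τ / 2 * 2 ^ (2 * ℓ + 1) := by
    rw [div_le_iff₀ hτ] at hd
    have : (2 : ℝ) ^ ℓ ≤ 2 ^ (2 * ℓ + 1) := pow_le_pow_right₀ (by norm_num) (by omega)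
    nlinarith
  have h3 : A.card * (2 ^ (2 * ℓ + 1) * Θ) ≤ τ / 2 * N * (2 ^ (2 * ℓ + 1) * Θ) := by
    refine h1.trans (hE.trans ?_)
    have := mul_le_mul_of_nonneg_right h2 (mul_nonneg hΘ0.le hN)
    linarith
  exact le_of_mul_le_mul_right h3 (by positivity)

end Setting

end RobustMean

namespace RobustMean

/-! ### From stability to index weights. -/

section Stability

variable {d n : ℕ}

open Classical in
/-- Average weights given to the indices over the indices of equal points. -/
def fiberAverage (S : Fin n → Pt d) (ρ : Fin n → ℝ) (x : Pt d) : ℝ :=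
  (∑ i with S i = x, ρ i) / (Finset.univ.filter fun i => S i = x).card

lemma fiberAverage_nonneg (S : Fin n → Pt d) {ρ : Fin n → ℝ} (h0 : ∀ i, 0 ≤ ρ i) (x : Pt d) :
    0 ≤ fiberAverage S ρ x :=
  div_nonneg (Finset.sum_nonneg fun i _ => h0 i) (Nat.cast_nonneg _)

lemma fiberAverage_le_one (S : Fin n → Pt d) {ρ : Fin n → ℝ} (h1 : ∀ i, ρ i ≤ 1) (x : Pt d) :
    fiberAverage S ρ x ≤ 1 := by
  classical
  refine div_le_one_of_le₀ ?_ (Nat.cast_nonneg _)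
  refine (Finset.sum_le_sum fun i _ => h1 i).trans (le_of_eq ?_)
  simp

/-- Stability speaks of weights that are functions of the point, so equal points get equal weight,
whereas corruption distinguishes indices. Averaging over indices with equal points removes the
difference without changing any sum of the form needed. -/
lemma sum_fiberAverage_smul {F : Type*} [AddCommGroup F] [Module ℝ F] (S : Fin n → Pt d)
    (ρ : Fin n → ℝ) (f : Pt d → F) :
    ∑ i, fiberAverage S ρ (S i) • f (S i) = ∑ i, ρ i • f (S i) := by
  classical
  rw [Finset.sum_comp (fun x => fiberAverage S ρ x • f x) S,
    ← Finset.sum_fiberwise_of_maps_to (t := Finset.univ.image S) (g := S)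
      (fun i _ => Finset.mem_image_of_mem S (Finset.mem_univ i)) (fun i => ρ i • f (S i))]
  refine Finset.sum_congr rfl fun x hx => ?_
  obtain ⟨i, -, rfl⟩ := Finset.mem_image.1 hx
  have hc : ((Finset.univ.filter fun j => S j = S i).card : ℝ) ≠ 0 := by
    rw [Nat.cast_ne_zero]
    exact Finset.card_ne_zero_of_mem (Finset.mem_filter.2 ⟨Finset.mem_univ i, rfl⟩)
  rw [← Nat.cast_smul_eq_nsmul ℝ, smul_smul, fiberAverage, mul_div_cancel₀ _ hc, Finset.sum_smul]
  exact Finset.sum_congr rfl fun j hj => by rw [(Finset.mem_filter.1 hj).2]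

lemma toEuclideanCLM_vecMulVec (y v : Pt d) :
    Matrix.toEuclideanCLM (𝕜 := ℝ) (Matrix.vecMulVec y y) v = ⟪y, v⟫_ℝ • y := by
  ext i
  rw [Matrix.toEuclideanCLM_toLp]
  simp [Matrix.mulVec, dotProduct, Matrix.vecMulVec_apply, PiLp.inner_apply, mul_comm]
  rw [Finset.mul_sum]
  exact Finset.sum_congr rfl fun j _ => by ring

lemma inner_weightedSecondMoment (S : Fin n → Pt d) (w : Pt d → ℝ) (μ v : Pt d) :
    ⟪v, Matrix.toEuclideanCLM (𝕜 := ℝ) (weightedSecondMoment S w μ - 1) v⟫_ℝ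
      = (expect S w)⁻¹ * ((n : ℝ)⁻¹ * ∑ i, w (S i) * ⟪v, S i - μ⟫_ℝ ^ 2) - ‖v‖ ^ 2 := by
  have hM : weightedSecondMoment S w μ = (expect S w)⁻¹ • ((n : ℝ)⁻¹ •
    ∑ i, w (S i) • Matrix.vecMulVec (S i - μ) (S i - μ)) := rfl
  rw [map_sub, map_one, hM, map_smul, map_smul, map_sum]
  simp only [sub_apply, smul_apply, sum_apply, map_smul, one_apply_eq_self, inner_sub_right,
    inner_smul_right, inner_sum, real_inner_self_eq_norm_sq]
  congr 3
  refine Finset.sum_congr rfl fun i _ => ?_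
  have := toEuclideanCLM_vecMulVec (S i - μ) v
  rw [this, inner_smul_right, real_inner_comm v, inner_sub_right]
  ring

/-- Stability, stated for weights on the indices and in one direction. -/
lemma IsStable.index_bounds {S : Fin n → Pt d} {μ : Pt d} {ε δ : ℝ} (h : IsStable ε δ μ S)
    (hn : 0 < n) (hε : ε < 1) {ρ : Fin n → ℝ} (h0 : ∀ i, 0 ≤ ρ i) (h1 : ∀ i, ρ i ≤ 1)
    (hρ : (1 - ε) * n ≤ ∑ i, ρ i) (v : Pt d) :
    |∑ i, ρ i * ⟪v, S i - μ⟫_ℝ| ≤ δ * ‖v‖ * ∑ i, ρ i ∧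
    |∑ i, ρ i * ⟪v, S i - μ⟫_ℝ ^ 2 - ‖v‖ ^ 2 * ∑ i, ρ i| ≤ δ ^ 2 / ε * ‖v‖ ^ 2 * ∑ i, ρ i := by
  have hn' : (0 : ℝ) < n := by exact_mod_cast hn
  set w := fiberAverage S ρ with hw
  set R := ∑ i, ρ i with hR
  have hRp : 0 < R := lt_of_lt_of_le (mul_pos (by linarith) hn') hρ
  have hsum : ∑ i, w (S i) = R := by
    simpa using sum_fiberAverage_smul S ρ (fun _ => (1 : ℝ))
  have hE : expect S w = (n : ℝ)⁻¹ * R := by rw [expect, hsum, smul_eq_mul]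
  obtain ⟨s1, s2⟩ := h w (fun x => ⟨fiberAverage_nonneg S h0 x, fiberAverage_le_one S h1 x⟩)
    (by rw [hE, inv_mul_eq_div, le_div_iff₀ hn']; exact hρ)
  constructor
  · have e : ∑ i, ρ i * ⟪v, S i - μ⟫_ℝ = R * ⟪v, weightedMean S w - μ⟫_ℝ := by
      have hm : weightedMean S w = R⁻¹ • ∑ i, ρ i • S i := by
        rw [weightedMean, hE, expect, hw, sum_fiberAverage_smul S ρ (fun x => x), smul_smul]
        congr 1
        field_simp
      rw [inner_sub_right, hm, inner_smul_right, inner_sum, mul_sub, mul_inv_cancel_left₀ hRp.ne',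
        hR, Finset.sum_mul, ← Finset.sum_sub_distrib]
      exact Finset.sum_congr rfl fun i _ => by rw [inner_smul_right, inner_sub_right]; ring
    rw [e, abs_mul, abs_of_pos hRp, mul_comm]
    refine mul_le_mul_of_nonneg_right ?_ hRp.le
    refine (abs_real_inner_le_norm _ _).trans ?_
    rw [mul_comm]
    exact mul_le_mul_of_nonneg_right s1 (norm_nonneg _)
  · have e : ∑ i, ρ i * ⟪v, S i - μ⟫_ℝ ^ 2 - ‖v‖ ^ 2 * R
        = R * ⟪v, Matrix.toEuclideanCLM (𝕜 := ℝ) (weightedSecondMoment S w μ - 1) v⟫_ℝ := by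
      have := sum_fiberAverage_smul S ρ (fun x => ⟪v, x - μ⟫_ℝ ^ 2)
      simp only [smul_eq_mul] at this
      rw [inner_weightedSecondMoment, hE, hw, this]
      field_simp
    rw [e, abs_mul, abs_of_pos hRp, mul_comm]
    refine mul_le_mul_of_nonneg_right ?_ hRp.le
    refine (abs_real_inner_le_norm _ _).trans ?_
    have := (Matrix.toEuclideanCLM (𝕜 := ℝ) (weightedSecondMoment S w μ - 1)).le_opNorm v
    rw [specNorm] at s2
    calc _ ≤ ‖v‖ * (δ ^ 2 / ε * ‖v‖) := mul_le_mul_of_nonneg_left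
            (this.trans (mul_le_mul_of_nonneg_right s2 (norm_nonneg _))) (norm_nonneg _)
      _ = _ := by ring

open Classical in
/-- Corrupted versions of stable families. -/
theorem setting_of_stable {S₀ S : Fin n → Pt d} {μ : Pt d} {ε δ : ℝ} (hn : 0 < n) (hε : 0 < ε)
    (hε' : ε ≤ 1 / 10000) (hδ : ε ≤ δ) (hst : IsStable (4 * ε) δ μ S₀)
    (hco : IsCorrupted ε S₀ S) :
    Setting S μ (Finset.univ.filter fun i => S i = S₀ i) ε δ (δ ^ 2 / ε) := by
  have hδp : 0 < δ := hε.trans_le hδ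
  have hsum : ∀ (ω : Fin n → ℝ) (f : Pt d → ℝ),
      ∑ i with S i = S₀ i, ω i * f (S i) = ∑ i, (if S i = S₀ i then ω i else 0) * f (S₀ i) := by
    intro ω f
    rw [Finset.sum_filter]
    refine Finset.sum_congr rfl fun i _ => ?_
    split_ifs with h
    · rw [h]
    · simp
  have hsum1 : ∀ ω : Fin n → ℝ,
      ∑ i with S i = S₀ i, ω i = ∑ i, (if S i = S₀ i then ω i else 0) := fun ω =>
    Finset.sum_filter _ _
  have key := fun (ω : Fin n → ℝ) (v : Pt d) (h0 : ∀ i, 0 ≤ ω i) (h1 : ∀ i, ω i ≤ 1)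
      (hW : (1 - 4 * ε) * n ≤ ∑ i with S i = S₀ i, ω i) =>
    hst.index_bounds hn (by linarith) (ρ := fun i => if S i = S₀ i then ω i else 0)
      (fun i => by split_ifs; exacts [h0 i, le_rfl])
      (fun i => by split_ifs; exacts [h1 i, zero_le_one]) (by rw [← hsum1]; exact hW) v
  refine ⟨hn, hε, hε', hδp, by field_simp, ?_, ?_, ?_, ?_⟩
  · rw [le_div_iff₀ hε, ← sq]
    exact pow_le_pow_left₀ hε.le hδ 2
  · rw [Finset.compl_filter]; exact hco
  · intro ω v h0 h1 hW
    rw [hsum ω (fun x => ⟪v, x - μ⟫_ℝ), hsum1]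
    exact (key ω v h0 h1 hW).1
  · intro ω v h0 h1 hW
    have hk := (key ω v h0 h1 hW).2
    rw [← hsum ω (fun x => ⟪v, x - μ⟫_ℝ ^ 2), ← hsum1] at hk
    refine hk.trans ?_
    refine mul_le_mul_of_nonneg_right (mul_le_mul_of_nonneg_right ?_ (sq_nonneg _))
      (Finset.sum_nonneg fun i _ => h0 i)
    -- Stability at level `4 * ε` gives the second-moment bound `δ ^ 2 / (4 * ε)`, which is stronger
    -- than the bound `δ ^ 2 / ε` kept in `Setting`.
    exact div_le_div_of_nonneg_left (by positivity) hε (by linarith)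

end Stability

/-! ### The rough centre and pruning. -/

/-- The square of the pruning radius. -/
def pruneSq (d : ℕ) (ε Δ : ℝ) : ℝ := 100 * d * (1 + Δ) / ε

/-- The initial weights: points of squared distance more than `r` from the centre `c` are
discarded. -/
def pruneWeights {d n : ℕ} (S : Fin n → Pt d) (r : ℝ) (c : Pt d) (i : Fin n) : ℝ :=
  if r < ‖S i - c‖ ^ 2 then 0 else 1

open Classical in
/-- A centre is accepted if more than half of the points have squared distance at most `r`. -/
def Accepted {d n : ℕ} (S : Fin n → Pt d) (r : ℝ) (c : Pt d) : Prop :=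
  n < 2 * (Finset.univ.filter fun i => ‖S i - c‖ ^ 2 ≤ r).card

namespace Setting

variable {d n : ℕ} {S : Fin n → Pt d} {μ : Pt d} {G : Finset (Fin n)} {ε δ Δ : ℝ}

lemma pruneSq_nonneg (h : Setting S μ G ε δ Δ) : 0 ≤ pruneSq d ε Δ := by
  have := h.eps_pos
  have := h.Delta_pos
  rw [pruneSq]; positivity

/-- The second-moment bound along each of the `d` coordinate axes, added up. -/
lemma sum_norm_sq_le (h : Setting S μ G ε δ Δ) :
    ∑ i ∈ G, ‖S i - μ‖ ^ 2 ≤ d * (1 + Δ) * n := by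
  let e := EuclideanSpace.basisFun (Fin d) ℝ
  have h1 : ∀ i, ‖S i - μ‖ ^ 2 = ∑ j, 1 * ⟪e j, S i - μ⟫_ℝ ^ 2 := fun i => by
    rw [← e.sum_sq_norm_inner_right]
    exact Finset.sum_congr rfl fun j _ => by rw [Real.norm_eq_abs, sq_abs, one_mul]
  rw [Finset.sum_congr rfl fun i _ => h1 i, Finset.sum_comm]
  have hG := h.card_good
  have hn := h.cast_n_pos
  have hεn := mul_pos h.eps_pos hn
  have hone : ∑ _i ∈ G, (1 : ℝ) = G.card := by simp
  have h2 : ∀ j, ∑ i ∈ G, 1 * ⟪e j, S i - μ⟫_ℝ ^ 2 ≤ (1 + Δ) * n := fun j => by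
    have := (abs_le.1 (h.second (fun _ => 1) (e j) (fun _ => zero_le_one) (fun _ => le_rfl)
      (by rw [hone]; linarith))).2
    rw [hone, e.norm_eq_one] at this
    have h3 := mul_le_mul_of_nonneg_left (card_good_le G)
      (by linarith [h.Delta_pos] : 0 ≤ 1 + Δ)
    linarith
  refine (Finset.sum_le_sum fun j _ => h2 j).trans (le_of_eq ?_)
  simp
  ring

open Classical in
lemma card_far_norm_le (h : Setting S μ G ε δ Δ) (hd : 0 < d) :
    ((G.filter fun i => pruneSq d ε Δ < ‖S i - μ‖ ^ 2).card : ℝ) ≤ ε * n := by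
  set H := G.filter fun i => pruneSq d ε Δ < ‖S i - μ‖ ^ 2 with hH
  have hε := h.eps_pos
  have hΔ := h.Delta_pos
  have hn := h.cast_n_pos
  have hd' : (0 : ℝ) < d := by exact_mod_cast hd
  have h1 : H.card * pruneSq d ε Δ ≤ d * (1 + Δ) * n := by
    refine le_trans ?_ h.sum_norm_sq_le
    rw [← nsmul_eq_mul, ← Finset.sum_const]
    exact (Finset.sum_le_sum fun i hi => (Finset.mem_filter.1 hi).2.le).trans
      (Finset.sum_le_sum_of_subset_of_nonneg (Finset.filter_subset _ _) fun i _ _ => sq_nonneg _)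
  have hp : 0 < pruneSq d ε Δ := by rw [pruneSq]; positivity
  refine le_of_mul_le_mul_right (h1.trans ?_) hp
  have : ε * n * pruneSq d ε Δ = 100 * (d * (1 + Δ) * n) := by
    rw [pruneSq]; field_simp
  rw [this]
  have : 0 ≤ d * (1 + Δ) * n := by positivity
  linarith

open Classical in
lemma card_near_ge (h : Setting S μ G ε δ Δ) (hd : 0 < d) :
    3 / 4 * (n : ℝ) ≤ (Finset.univ.filter fun i => ‖S i - μ‖ ^ 2 ≤ pruneSq d ε Δ).card := by
  have h1 := h.card_far_norm_le hd
  have h2 := h.card_good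
  have h3 := Finset.card_filter_add_card_filter_not (s := G)
    (fun i => pruneSq d ε Δ < ‖S i - μ‖ ^ 2)
  have h4 : (G.filter fun i => ¬ pruneSq d ε Δ < ‖S i - μ‖ ^ 2).card
      ≤ (Finset.univ.filter fun i => ‖S i - μ‖ ^ 2 ≤ pruneSq d ε Δ).card := by
    refine Finset.card_le_card fun i hi => ?_
    simp only [Finset.mem_filter, Finset.mem_univ, true_and] at hi ⊢
    exact not_lt.1 hi.2
  have h3' : ((G.filter fun i => pruneSq d ε Δ < ‖S i - μ‖ ^ 2).card : ℝ)
      + (G.filter fun i => ¬ pruneSq d ε Δ < ‖S i - μ‖ ^ 2).card = G.card := by exact_mod_cast h3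
  have h4' : ((G.filter fun i => ¬ pruneSq d ε Δ < ‖S i - μ‖ ^ 2).card : ℝ)
      ≤ (Finset.univ.filter fun i => ‖S i - μ‖ ^ 2 ≤ pruneSq d ε Δ).card := by exact_mod_cast h4
  have h5 := mul_le_mul_of_nonneg_right h.eps_le h.cast_n_pos.le
  linarith [h.cast_n_pos]

/-- The triangle inequality for squared distances. Radii occur only squared, as the machine has no
square roots. -/
lemma norm_add_sq_le_of_sq_le {x y : Pt d} {r : ℝ} (a b : ℝ) (hr : 0 ≤ r) (ha : 0 ≤ a)
    (hb : 0 ≤ b) (hx : ‖x‖ ^ 2 ≤ a ^ 2 * r) (hy : ‖y‖ ^ 2 ≤ b ^ 2 * r) :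
    ‖x + y‖ ^ 2 ≤ (a + b) ^ 2 * r := by
  have h1 : ‖x‖ ≤ a * √r := by
    rw [← Real.sqrt_sq ha, ← Real.sqrt_mul (sq_nonneg a)]; exact Real.le_sqrt_of_sq_le hx
  have h2 : ‖y‖ ≤ b * √r := by
    rw [← Real.sqrt_sq hb, ← Real.sqrt_mul (sq_nonneg b)]; exact Real.le_sqrt_of_sq_le hy
  calc ‖x + y‖ ^ 2 ≤ ((a + b) * √r) ^ 2 :=
        pow_le_pow_left₀ (norm_nonneg _) ((norm_add_le _ _).trans (by linarith)) 2
    _ = _ := by rw [mul_pow, Real.sq_sqrt hr]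

/-- Points near `μ` are accepted as centres. -/
lemma accepted_of_near (h : Setting S μ G ε δ Δ) (hd : 0 < d) {c : Pt d}
    (hc : ‖c - μ‖ ^ 2 ≤ pruneSq d ε Δ) : Accepted S (4 * pruneSq d ε Δ) c := by
  classical
  have h1 := h.card_near_ge hd
  have h2 : (Finset.univ.filter fun i => ‖S i - μ‖ ^ 2 ≤ pruneSq d ε Δ).card
      ≤ (Finset.univ.filter fun i => ‖S i - c‖ ^ 2 ≤ 4 * pruneSq d ε Δ).card := by
    refine Finset.card_le_card fun i hi => ?_
    simp only [Finset.mem_filter, Finset.mem_univ, true_and] at hi ⊢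
    have := norm_add_sq_le_of_sq_le (x := S i - μ) (y := μ - c) 1 1 h.pruneSq_nonneg zero_le_one
      zero_le_one (by linarith) (by rw [norm_sub_rev]; linarith)
    rw [sub_add_sub_cancel] at this
    linarith
  have h2' : ((Finset.univ.filter fun i => ‖S i - μ‖ ^ 2 ≤ pruneSq d ε Δ).card : ℝ)
      ≤ (Finset.univ.filter fun i => ‖S i - c‖ ^ 2 ≤ 4 * pruneSq d ε Δ).card := by
    exact_mod_cast h2
  rw [Accepted]
  have : (n : ℝ) < 2 * (Finset.univ.filter fun i => ‖S i - c‖ ^ 2 ≤ 4 * pruneSq d ε Δ).card := by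
    linarith [h.cast_n_pos]
  convert (by exact_mod_cast this : n < 2 * (Finset.univ.filter fun i =>
    ‖S i - c‖ ^ 2 ≤ 4 * pruneSq d ε Δ).card)

/-- Accepted centres are not too far from `μ`. -/
lemma norm_sub_le_of_accepted (h : Setting S μ G ε δ Δ) (hd : 0 < d) {c : Pt d}
    (hc : Accepted S (4 * pruneSq d ε Δ) c) : ‖c - μ‖ ^ 2 ≤ 9 * pruneSq d ε Δ := by
  classical
  have h1 := h.card_near_ge hd
  rw [Accepted] at hc
  set A := Finset.univ.filter fun i => ‖S i - c‖ ^ 2 ≤ 4 * pruneSq d ε Δ with hA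
  set B := Finset.univ.filter fun i => ‖S i - μ‖ ^ 2 ≤ pruneSq d ε Δ with hB
  have hc' : n < 2 * A.card := by convert hc
  -- More than half of the points are near the centre and three quarters are near `μ`, so some point
  -- is near both.
  have hnd : ¬ Disjoint A B := by
    intro hdis
    have h2 := Finset.card_union_of_disjoint hdis
    have h3 := (A ∪ B).card_le_univ
    rw [Fintype.card_fin, h2] at h3
    have h3' : (A.card : ℝ) + B.card ≤ n := by exact_mod_cast h3
    have hc'' : (n : ℝ) < 2 * A.card := by exact_mod_cast hc'
    linarith [h.cast_n_pos]
  obtain ⟨i, hiA, hiB⟩ := Finset.not_disjoint_iff.1 hnd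
  rw [hA, Finset.mem_filter] at hiA
  rw [hB, Finset.mem_filter] at hiB
  have := norm_add_sq_le_of_sq_le (x := c - S i) (y := S i - μ) 2 1 h.pruneSq_nonneg
    (by norm_num) zero_le_one (by rw [norm_sub_rev]; linarith [hiA.2]) (by linarith [hiB.2])
  rw [sub_add_sub_cancel] at this
  linarith

/-- Pruning may discard good points without discarding bad ones. The term `ε * n` in
`GoodWeights.loss` pays for this. -/
lemma goodWeights_prune (h : Setting S μ G ε δ Δ) (hd : 0 < d) {c : Pt d}
    (hc : ‖c - μ‖ ^ 2 ≤ 9 * pruneSq d ε Δ) :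
    GoodWeights G ε (pruneWeights S (16 * pruneSq d ε Δ) c) := by
  classical
  have hle : ∀ i, pruneWeights S (16 * pruneSq d ε Δ) c i ≤ 1 := fun i => by
    rw [pruneWeights]; split_ifs <;> norm_num
  refine ⟨fun i => by rw [pruneWeights]; split_ifs <;> norm_num, hle, ?_⟩
  have h1 : ∑ i ∈ G, (1 - pruneWeights S (16 * pruneSq d ε Δ) c i)
      ≤ ∑ i ∈ G, if pruneSq d ε Δ < ‖S i - μ‖ ^ 2 then (1 : ℝ) else 0 := by
    refine Finset.sum_le_sum fun i _ => ?_
    rw [pruneWeights]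
    split_ifs with h1 h2
    · norm_num
    -- In units of the pruning radius, a point within 1 of `μ` is within `1 + 3 = 4` of the centre
    -- and is therefore kept.
    · exfalso
      have := norm_add_sq_le_of_sq_le (x := S i - μ) (y := μ - c) 1 3 h.pruneSq_nonneg zero_le_one
        (by norm_num) (by linarith) (by rw [norm_sub_rev]; linarith)
      rw [sub_add_sub_cancel] at this
      linarith
    · norm_num
    · norm_num
  have h2 := h.card_far_norm_le hd
  have h3 : 0 ≤ ∑ i ∈ Gᶜ, (1 - pruneWeights S (16 * pruneSq d ε Δ) c i) :=
    Finset.sum_nonneg fun i _ => by linarith [hle i]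
  rw [← Finset.sum_filter, Finset.sum_const, nsmul_eq_mul, mul_one] at h1
  linarith

/-- Through `ε ≤ Δ` one has `(1 + Δ) * ε ≤ 2 * Δ`, so the squared radius is at most `Δ` times a
multiple of `d / ε ^ 2`. Hence a logarithmic `ℓ` suffices. -/
lemma boundedSupport_prune (h : Setting S μ G ε δ Δ) {ℓ : ℕ} (hℓ : 1000 * d / ε ^ 2 ≤ 2 ^ ℓ)
    (c : Pt d) :
    BoundedSupport S Δ ℓ c (16 * pruneSq d ε Δ) (pruneWeights S (16 * pruneSq d ε Δ) c) where
  dist_le i hi := by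
    rw [pruneWeights] at hi
    split_ifs at hi with h1
    · exact absurd hi (lt_irrefl _)
    · exact not_lt.1 h1
  bound_le := by
    have hε := h.eps_pos
    have hΔ := h.Delta_pos
    have h1 := mul_le_mul_of_nonneg_right hℓ (by positivity : 0 ≤ 7 * Δ)
    refine le_trans ?_ h1
    rw [pruneSq, mul_div_assoc', div_mul_eq_mul_div, div_le_div_iff₀ hε (by positivity)]
    have h2 : (1 + Δ) * ε ≤ 2 * Δ := by
      have := h.eps_le_Delta
      nlinarith [h.eps_le]
    have hd : (0 : ℝ) ≤ d := Nat.cast_nonneg _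
    have h3 : 1600 * (d * ε) * ((1 + Δ) * ε) ≤ 1600 * (d * ε) * (2 * Δ) :=
      mul_le_mul_of_nonneg_left h2 (by positivity)
    have h4 : 0 ≤ d * ε * Δ := by positivity
    nlinarith

end Setting

end RobustMean

/-! ### Finitely many fair coins. -/

namespace StreamRAM

open MeasureTheory

instance : IsProbabilityMeasure fairCoins := by
  rw [fairCoins]; infer_instance

/-- The event is a box over the image of `e`; injectivity guarantees that the conditions at
different coins do not interact and that each has probability one half. -/
lemma fairCoins_cylinder {ι : Type} [Fintype ι] {e : ι → ℕ} (he : Function.Injective e)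
    (a : ι → Bool) :
    fairCoins {coins | coins ∘ e = a} = (2 ^ Fintype.card ι)⁻¹ := by
  classical
  have hset : {coins : ℕ → Bool | coins ∘ e = a}
      = Set.pi (Finset.univ.image e) fun m => {b | ∀ x, e x = m → b = a x} := by
    ext coins
    simp only [Set.mem_ofPred_eq, Set.mem_pi, Finset.coe_image, Finset.coe_univ, Set.image_univ,
      Set.mem_range, forall_exists_index, forall_apply_eq_imp_iff, funext_iff, Function.comp_apply]
    constructor
    · intro h x y hxy
      rw [← hxy]; exact h y
    · intro h x
      exact h x x rfl
  rw [hset, fairCoins, Measure.infinitePi_pi _ (fun i _ => MeasurableSet.of_discrete),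
    Finset.prod_image fun x _ y _ h => he h]
  have h1 : ∀ x, {b | ∀ y, e y = e x → b = a y} = {a x} := by
    intro x
    ext b
    simp only [Set.mem_ofPred_eq, Set.mem_singleton_iff]
    exact ⟨fun h => h x rfl, fun h y hy => by rw [h, he hy]⟩
  have h2 : ∀ x, (PMF.uniformOfFintype Bool).toMeasure {b | ∀ y, e y = e x → b = a y} = 2⁻¹ := by
    intro x
    rw [h1, PMF.toMeasure_apply_singleton _ _ (measurableSet_singleton _)]
    simp
  rw [Finset.prod_congr rfl fun x _ => h2 x, Finset.prod_const, Finset.card_univ,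
    ENNReal.inv_pow]

/-- Finitely many coins are uniformly distributed. -/
lemma fairCoins_real_preimage {ι : Type} [Fintype ι] [DecidableEq ι] {e : ι → ℕ}
    (he : Function.Injective e) (A : Finset (ι → Bool)) :
    fairCoins.real {coins | coins ∘ e ∈ A} = A.card / Fintype.card (ι → Bool) := by
  have hset : {coins : ℕ → Bool | coins ∘ e ∈ A} = ⋃ a ∈ A, {coins | coins ∘ e = a} := by
    ext coins; simp
  have hmeas : ∀ a, MeasurableSet {coins : ℕ → Bool | coins ∘ e = a} := fun a =>
    measurableSet_eq_fun (f := fun coins : ℕ → Bool => coins ∘ e) (g := fun _ => a)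
      (measurable_pi_lambda _ fun x => measurable_pi_apply (e x)) measurable_const
  rw [hset, measureReal_biUnion_finset]
  · simp only [measureReal_def, fairCoins_cylinder he]
    simp [div_eq_mul_inv]
  · intro a _ b _ hab
    refine Set.disjoint_left.2 fun coins h1 h2 => hab ?_
    rw [← h1, ← h2]
  · exact fun a _ => hmeas a

end StreamRAM

/-! ### Random candidates and the probability of success. -/

namespace RobustMean

/-- The number with binary digits `b`. -/
def bitsVal : (k : ℕ) → (Fin k → Bool) → ℕ
  | 0, _ => 0
  | k + 1, b => 2 * bitsVal k (fun i => b i.castSucc) + (b (Fin.last k)).toNat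

lemma bitsVal_surj (k : ℕ) {m : ℕ} (hm : m < 2 ^ k) : ∃ b, bitsVal k b = m := by
  induction k generalizing m with
  | zero => exact ⟨fun _ => true, by simp only [pow_zero, Nat.lt_one_iff] at hm; simp [bitsVal, hm]⟩
  | succ k ih =>
    obtain ⟨b, hb⟩ := ih (m := m / 2) (by rw [pow_succ] at hm; omega)
    refine ⟨Fin.snoc b (decide (m % 2 = 1)), ?_⟩
    simp only [bitsVal, Fin.snoc_castSucc, Fin.snoc_last]
    rw [hb]
    rcases Nat.mod_two_eq_zero_or_one m with h | h <;> simp [h] <;> omega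

section Centre

variable {d n : ℕ}

/-- The point at position `U`, or `old` if there is none. -/
def pointAt (pts : Fin n → Pt d) (U : ℕ) (old : Pt d) : Pt d :=
  if h : U < n then pts ⟨U, h⟩ else old

open Classical in
/-- The last candidate and the last accepted candidate, when candidate number `j` is the point at
position `U j` of the arrangement `pts j`. -/
def centreSeq (S : Fin n → Pt d) (pts : ℕ → Fin n → Pt d) (r : ℝ) :
    (N : ℕ) → (Fin N → ℕ) → Pt d × Pt d
  | 0, _ => (0, 0)
  | N + 1, U =>
    (pointAt (pts N) (U (Fin.last N)) (centreSeq S pts r N fun i => U i.castSucc).1,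
      if Accepted S r
          (pointAt (pts N) (U (Fin.last N)) (centreSeq S pts r N fun i => U i.castSucc).1) then
        pointAt (pts N) (U (Fin.last N)) (centreSeq S pts r N fun i => U i.castSucc).1
      else (centreSeq S pts r N fun i => U i.castSucc).2)

namespace Setting

variable {S : Fin n → Pt d} {μ : Pt d} {G : Finset (Fin n)} {ε δ Δ : ℝ}

/-- A stored centre is replaced only by accepted candidates, so one candidate near `μ` is enough,
whatever is drawn afterwards. -/
lemma centreSeq_accepted (h : Setting S μ G ε δ Δ) (hd : 0 < d) (pts : ℕ → Fin n → Pt d) (N : ℕ)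
    (U : Fin N → ℕ) (j : Fin N) (hj : U j < n)
    (hnear : ‖pts j ⟨U j, hj⟩ - μ‖ ^ 2 ≤ pruneSq d ε Δ) :
    Accepted S (4 * pruneSq d ε Δ) (centreSeq S pts (4 * pruneSq d ε Δ) N U).2 := by
  induction N with
  | zero => exact j.elim0
  | succ N ih =>
    rw [centreSeq]
    dsimp only
    split_ifs with hacc
    · exact hacc
    · induction j using Fin.lastCases with
      | last =>
        exfalso
        apply hacc
        rw [pointAt, dif_pos hj]
        exact h.accepted_of_near hd hnear
      | cast j => exact ih (fun i => U i.castSucc) j hj hnear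

end Setting

/-- The output of the algorithm as a function of the random bits `b` that choose the candidates for
the rough centre and the random bits `z` of the sign vectors. -/
def finalMean (S : Fin n → Pt d) (pts : ℕ → Fin n → Pt d) (ε Δ : ℝ) (ℓ k : ℕ)
    (b : Fin (2 * ℓ) → Fin k → Bool) (z : Fin (16 * ℓ ^ 2) → Fin d → Bool) : Pt d :=
  wMean S (rounds S ε Δ ℓ (pruneWeights S (16 * pruneSq d ε Δ)
    (centreSeq S pts (4 * pruneSq d ε Δ) (2 * ℓ) fun j => bitsVal k (b j)).2) (16 * ℓ ^ 2) z)

end Centre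

namespace Setting

variable {d n : ℕ} {S : Fin n → Pt d} {μ : Pt d} {G : Finset (Fin n)} {ε δ Δ : ℝ}

open Classical in
-- Three quarters of at most `n` positions are good draws and there are `2 ^ k ≤ 2 n` bit strings,
-- so at least three eighths of them succeed; strings that point beyond the end count as failures.
lemma card_bits_far_le (h : Setting S μ G ε δ Δ) (hd : 0 < d) (σ : Equiv.Perm (Fin n)) {k : ℕ}
    (hk : n ≤ 2 ^ k) (hk' : 2 ^ k ≤ 2 * n) :
    ((Finset.univ.filter fun b : Fin k → Bool =>
      ∀ hb : bitsVal k b < n, pruneSq d ε Δ < ‖S (σ ⟨bitsVal k b, hb⟩) - μ‖ ^ 2).card : ℝ)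
      ≤ 5 / 8 * 2 ^ k := by
  set F := Finset.univ.filter fun b : Fin k → Bool =>
      ∀ hb : bitsVal k b < n, pruneSq d ε Δ < ‖S (σ ⟨bitsVal k b, hb⟩) - μ‖ ^ 2 with hF
  have h1 : (Finset.univ.filter fun i => ‖S i - μ‖ ^ 2 ≤ pruneSq d ε Δ).card ≤ (Fᶜ).card := by
    let g : (Fin k → Bool) → Fin n := fun b => if hb : bitsVal k b < n then σ ⟨bitsVal k b, hb⟩
      else ⟨0, h.n_pos⟩
    refine Finset.card_le_card_of_surjOn g fun i hi => ?_
    simp only [Finset.coe_filter, Finset.mem_univ, true_and, Set.mem_ofPred_eq] at hi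
    obtain ⟨b, hb⟩ := bitsVal_surj k ((σ.symm i).2.trans_le hk)
    have hbn : bitsVal k b < n := by rw [hb]; exact (σ.symm i).2
    have hgi : σ ⟨bitsVal k b, hbn⟩ = i := by
      have : (⟨bitsVal k b, hbn⟩ : Fin n) = σ.symm i := Fin.ext hb
      rw [this, Equiv.apply_symm_apply]
    refine ⟨b, ?_, ?_⟩
    · simp only [hF, Finset.compl_filter, Finset.coe_filter, Finset.mem_univ, true_and,
        Set.mem_ofPred_eq, not_forall, not_lt]
      exact ⟨hbn, by rw [hgi]; exact hi⟩
    · simp only [g, dif_pos hbn, hgi]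
  have h2 := h.card_near_ge hd
  have h3 : F.card + (Fᶜ).card = 2 ^ k := by
    rw [Finset.card_add_card_compl]; simp
  have h1' : ((Finset.univ.filter fun i => ‖S i - μ‖ ^ 2 ≤ pruneSq d ε Δ).card : ℝ) ≤ (Fᶜ).card := by
    exact_mod_cast h1
  have h3' : (F.card : ℝ) + (Fᶜ).card = 2 ^ k := by exact_mod_cast h3
  have hk2 : (2 : ℝ) ^ k ≤ 2 * n := by exact_mod_cast hk'
  linarith

open Classical in
/-- Few outcomes of the random bits lead to an inaccurate output. -/
theorem card_bits_inaccurate_le (h : Setting S μ G ε δ Δ) (hd : 0 < d)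
    (σ : ℕ → Equiv.Perm (Fin n)) {k : ℕ} (hk : n ≤ 2 ^ k) (hk' : 2 ^ k ≤ 2 * n) {ℓ : ℕ}
    (hℓ : 1 ≤ ℓ) {τ : ℝ} (hτ : 0 < τ) (hτ1 : τ < 1) (hℓ2 : 1000 * d / (ε ^ 2 * τ) ≤ 2 ^ ℓ) :
    ((Finset.univ.filter fun p : (Fin (2 * ℓ) → Fin k → Bool) × (Fin (16 * ℓ ^ 2) → Fin d → Bool) =>
      66 * δ < ‖finalMean S (fun j i => S (σ j i)) ε Δ ℓ k p.1 p.2 - μ‖).card : ℝ)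
    ≤ τ * Fintype.card ((Fin (2 * ℓ) → Fin k → Bool) × (Fin (16 * ℓ ^ 2) → Fin d → Bool)) := by
  have hε := h.eps_pos
  have hΔ := h.Delta_pos
  have hd1 : (1 : ℝ) ≤ d := by exact_mod_cast hd
  have hε1 : ε ^ 2 ≤ 1 := pow_le_one₀ hε.le (by linarith [h.eps_le])
  have hA : 1000 * d / ε ^ 2 ≤ (2 : ℝ) ^ ℓ := le_trans (by
    apply div_le_div_of_nonneg_left (by positivity) (by positivity)
    exact mul_le_of_le_one_right (by positivity) hτ1.le) hℓ2
  have hB : 2 * d / τ ≤ (2 : ℝ) ^ ℓ := le_trans (by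
    rw [div_le_div_iff₀ hτ (by positivity)]
    have : ε ^ 2 * τ ≤ τ := mul_le_of_le_one_left hτ.le hε1
    have h2 : (d : ℝ) * (ε ^ 2 * τ) ≤ d * τ := mul_le_mul_of_nonneg_left this (by positivity)
    have h3 : 0 ≤ (d : ℝ) * τ := by positivity
    linarith) hℓ2
  set B1 := Fin (2 * ℓ) → Fin k → Bool
  set B2 := Fin (16 * ℓ ^ 2) → Fin d → Bool
  let far : ℕ → Finset (Fin k → Bool) := fun j => Finset.univ.filter fun b =>
    ∀ hb : bitsVal k b < n, pruneSq d ε Δ < ‖S (σ j ⟨bitsVal k b, hb⟩) - μ‖ ^ 2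
  -- The event that all candidates miss is a product over independent blocks of bits, although each
  -- draw may see its own arrangement of the points.
  let F1 : Finset B1 := Fintype.piFinset fun j => far j
  have hF1 : (F1.card : ℝ) ≤ τ / 2 * Fintype.card B1 := by
    have e1 : (F1.card : ℝ) ≤ ∏ _j : Fin (2 * ℓ), (5 / 8 * 2 ^ k : ℝ) := by
      rw [Fintype.card_piFinset]
      push_cast
      exact Finset.prod_le_prod (fun _ _ => Nat.cast_nonneg _)
        fun j _ => h.card_bits_far_le hd (σ j) hk hk'
    have e2 : (Fintype.card B1 : ℝ) = (2 ^ k) ^ (2 * ℓ) := by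
      simp [B1]
    rw [Finset.prod_const, Finset.card_univ, Fintype.card_fin, mul_pow] at e1
    rw [e2]
    refine e1.trans (mul_le_mul_of_nonneg_right ?_ (by positivity))
    -- Reason for `2 * ℓ` candidates: two of them fail together with probability at most `25 / 64`.
    have e3 : (5 / 8 : ℝ) ^ (2 * ℓ) ≤ (1 / 2) ^ ℓ := by
      rw [pow_mul]; exact pow_le_pow_left₀ (by norm_num) (by norm_num) _
    have e4 : (1 / 2 : ℝ) ^ ℓ ≤ τ / 2 := by
      rw [div_le_iff₀ hτ] at hB
      rw [one_div, inv_pow, inv_le_iff_one_le_mul₀ (by positivity)]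
      nlinarith
    exact e3.trans e4
  have hin : ∀ b : B1, b ∉ F1 → ((Finset.univ.filter fun z : B2 =>
      66 * δ < ‖finalMean S (fun j i => S (σ j i)) ε Δ ℓ k b z - μ‖).card : ℝ)
      ≤ τ / 2 * Fintype.card B2 := by
    intro b hb
    replace hb : ¬ ∀ j : Fin (2 * ℓ), b j ∈ far j := fun hh => hb (Fintype.mem_piFinset.2 hh)
    simp only [not_forall, far, Finset.mem_filter, Finset.mem_univ, true_and, not_lt] at hb
    obtain ⟨j, hj, hnear⟩ := hb
    have hacc := h.centreSeq_accepted hd (fun j i => S (σ j i)) (2 * ℓ)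
      (fun j => bitsVal k (b j)) j hj hnear
    have hc := h.norm_sub_le_of_accepted hd hacc
    exact h.card_inaccurate_le (h.goodWeights_prune hd hc) (h.boundedSupport_prune hA _)
      (by linarith [h.pruneSq_nonneg]) hℓ hτ hB
  have hsum : ((Finset.univ.filter fun p : B1 × B2 =>
      66 * δ < ‖finalMean S (fun j i => S (σ j i)) ε Δ ℓ k p.1 p.2 - μ‖).card : ℝ)
      = ∑ b : B1, ((Finset.univ.filter fun z : B2 =>
      66 * δ < ‖finalMean S (fun j i => S (σ j i)) ε Δ ℓ k b z - μ‖).card : ℝ) := by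
    simp only [Finset.card_filter, Nat.cast_sum]
    exact Fintype.sum_prod_type _
  rw [hsum, ← Finset.sum_add_sum_compl F1]
  have s1 : ∑ b ∈ F1, ((Finset.univ.filter fun z : B2 =>
      66 * δ < ‖finalMean S (fun j i => S (σ j i)) ε Δ ℓ k b z - μ‖).card : ℝ)
      ≤ F1.card * Fintype.card B2 := by
    rw [← nsmul_eq_mul, ← Finset.sum_const]
    exact Finset.sum_le_sum fun b _ => by exact_mod_cast Finset.card_le_univ _
  have s2 : ∑ b ∈ F1ᶜ, ((Finset.univ.filter fun z : B2 =>
      66 * δ < ‖finalMean S (fun j i => S (σ j i)) ε Δ ℓ k b z - μ‖).card : ℝ)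
      ≤ Fintype.card B1 * (τ / 2 * Fintype.card B2) := by
    refine (Finset.sum_le_sum fun b hb => hin b (Finset.mem_compl.1 hb)).trans ?_
    rw [Finset.sum_const, nsmul_eq_mul]
    exact mul_le_mul_of_nonneg_right (by exact_mod_cast Finset.card_le_univ _) (by positivity)
  have s3 := mul_le_mul_of_nonneg_right hF1 (Nat.cast_nonneg (α := ℝ) (Fintype.card B2))
  rw [Fintype.card_prod]
  push_cast
  linarith

/-- The positions of the coins that are used: `2 ℓ` blocks of length `k`, followed by blocks of
length `d`. -/
def coinIndex (ℓ k d T : ℕ) : (Fin (2 * ℓ) × Fin k) ⊕ (Fin T × Fin d) → ℕ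
  | .inl p => p.1 * k + p.2
  | .inr p => 2 * ℓ * k + p.1 * d + p.2

lemma block_injective {a b a' b' k : ℕ} (hb : b < k) (hb' : b' < k)
    (h : a * k + b = a' * k + b') : a = a' ∧ b = b' := by
  have hk : 0 < k := by omega
  have h1 : (a * k + b) / k = a := by
    rw [Nat.add_comm, Nat.add_mul_div_right _ _ hk, Nat.div_eq_of_lt hb, Nat.zero_add]
  have h2 : (a' * k + b') / k = a' := by
    rw [Nat.add_comm, Nat.add_mul_div_right _ _ hk, Nat.div_eq_of_lt hb', Nat.zero_add]
  have : a = a' := by rw [← h1, ← h2, h]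
  exact ⟨this, by subst this; omega⟩

lemma coinIndex_injective (ℓ k d T : ℕ) : Function.Injective (coinIndex ℓ k d T) := by
  have hlt : ∀ (a : Fin (2 * ℓ)) (b : Fin k), a * k + b < 2 * ℓ * k := fun a b =>
    calc a * k + b < a * k + k := by have := b.2; omega
      _ = (a + 1) * k := by ring
      _ ≤ 2 * ℓ * k := Nat.mul_le_mul_right _ (by have := a.2; omega)
  rintro (⟨a, b⟩ | ⟨a, b⟩) (⟨a', b'⟩ | ⟨a', b'⟩) h
  · simp only [coinIndex] at h
    obtain ⟨h1, h2⟩ := block_injective b.2 b'.2 h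
    rw [Fin.ext h1, Fin.ext h2]
  · simp only [coinIndex] at h
    have := hlt a b
    omega
  · simp only [coinIndex] at h
    have := hlt a' b'
    omega
  · simp only [coinIndex] at h
    obtain ⟨h1, h2⟩ := block_injective b.2 b'.2 (by omega : a * d + b = a' * d + b')
    rw [Fin.ext h1, Fin.ext h2]

/-- The output is accurate with probability at least `1 - τ`. -/
theorem probability_accurate (h : Setting S μ G ε δ Δ) (hd : 0 < d)
    (σ : ℕ → Equiv.Perm (Fin n)) {k : ℕ} (hk : n ≤ 2 ^ k) (hk' : 2 ^ k ≤ 2 * n) {ℓ : ℕ}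
    (hℓ : 1 ≤ ℓ) {τ : ℝ} (hτ : 0 < τ) (hτ1 : τ < 1) (hℓ2 : 1000 * d / (ε ^ 2 * τ) ≤ 2 ^ ℓ) :
    1 - τ ≤ StreamRAM.fairCoins.real {coins | ‖μ - finalMean S (fun j i => S (σ j i)) ε Δ ℓ k
      (fun j i => coins (j * k + i)) (fun t i => coins (2 * ℓ * k + t * d + i))‖ ≤ 66 * δ} := by
  classical
  let ι := (Fin (2 * ℓ) × Fin k) ⊕ (Fin (16 * ℓ ^ 2) × Fin d)
  let split : (ι → Bool) ≃ (Fin (2 * ℓ) → Fin k → Bool) × (Fin (16 * ℓ ^ 2) → Fin d → Bool) :=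
    (Equiv.sumArrowEquivProdArrow _ _ _).trans ((Equiv.curry _ _ _).prodCongr (Equiv.curry _ _ _))
  let bad : Finset ((Fin (2 * ℓ) → Fin k → Bool) × (Fin (16 * ℓ ^ 2) → Fin d → Bool)) :=
    Finset.univ.filter fun p =>
      66 * δ < ‖finalMean S (fun j i => S (σ j i)) ε Δ ℓ k p.1 p.2 - μ‖
  let good : Finset (ι → Bool) := (bad.map split.symm.toEmbedding)ᶜ
  have hset : {coins : ℕ → Bool | ‖μ - finalMean S (fun j i => S (σ j i)) ε Δ ℓ k
      (fun j i => coins (j * k + i)) (fun t i => coins (2 * ℓ * k + t * d + i))‖ ≤ 66 * δ}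
      = {coins | coins ∘ coinIndex ℓ k d (16 * ℓ ^ 2) ∈ good} := by
    ext coins
    simp only [good, bad, Set.mem_ofPred_eq, Finset.mem_compl, Finset.mem_map_equiv,
      Equiv.symm_symm, Finset.mem_filter, Finset.mem_univ, true_and, not_lt]
    rw [norm_sub_rev]
    rfl
  rw [hset, StreamRAM.fairCoins_real_preimage (coinIndex_injective ℓ k d _)]
  have hcard := h.card_bits_inaccurate_le hd σ hk hk' hℓ hτ hτ1 hℓ2
  have hc1 : bad.card + good.card = Fintype.card (ι → Bool) := by
    rw [← Finset.card_add_card_compl (bad.map split.symm.toEmbedding), Finset.card_map]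
  have hc2 : Fintype.card ((Fin (2 * ℓ) → Fin k → Bool) × (Fin (16 * ℓ ^ 2) → Fin d → Bool))
      = Fintype.card (ι → Bool) := (Fintype.card_congr split).symm
  rw [hc2] at hcard
  have hc1' : (bad.card : ℝ) + good.card = Fintype.card (ι → Bool) := by exact_mod_cast hc1
  have hp : (0 : ℝ) < Fintype.card (ι → Bool) := by exact_mod_cast Fintype.card_pos
  rw [le_div_iff₀ hp]
  have hcard' : (bad.card : ℝ) ≤ τ * Fintype.card (ι → Bool) := hcard
  linarith

end Setting

end RobustMean

namespace StreamRAM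

/-! ### A program logic with time and space bounds. -/

section Logic

variable {d n a b c : ℕ}

/-- A state without its time and space records. -/
def State.core (s : State d a b c) : State d a b c := { s with time := 0, span := 0 }

/-- Time and span are never read by expressions or tests. Assertions can therefore be made about
cores only, with the costs kept apart. -/
lemma NatExp.eval_core (s : State d a b c) (e : NatExp a) : e.eval s.core = e.eval s := by
  induction e with
  | lit | dim | reg => rfl
  | add e f he hf | sub e f he hf | mul e f he hf => simp only [NatExp.eval, he, hf]

lemma RealExp.eval_core (I : Input d n) (s : State d a b c) (x : RealExp a b c) :
    x.eval I s.core = x.eval I s := by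
  induction x with
  | lit | eps | delta | tau | reg => rfl
  | ofNat e => simp only [RealExp.eval, NatExp.eval_core]
  | arr k e | item e => simp only [RealExp.eval, NatExp.eval_core]; rfl
  | add x y hx hy | sub x y hx hy | mul x y hx hy | div x y hx hy => simp only [RealExp.eval, hx, hy]

lemma RealExp.span_core (s : State d a b c) (x : RealExp a b c) : x.span s.core = x.span s := by
  induction x with
  | lit | eps | delta | tau | reg | ofNat | item => rfl
  | arr k e => simp only [RealExp.span, NatExp.eval_core]
  | add x y hx hy | sub x y hx hy | mul x y hx hy | div x y hx hy => simp only [RealExp.span, hx, hy]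

lemma BoolExp.holds_core (I : Input d n) (s : State d a b c) (t : BoolExp a b c) :
    t.Holds I s.core ↔ t.Holds I s := by
  induction t with
  | natLt e f => simp only [BoolExp.Holds, NatExp.eval_core]
  | realLt x y => simp only [BoolExp.Holds, RealExp.eval_core]
  | atEnd => rfl
  | neg p hp => simp only [BoolExp.Holds, hp]
  | conj p q hp hq => simp only [BoolExp.Holds, hp, hq]

lemma BoolExp.span_core (s : State d a b c) (t : BoolExp a b c) : t.span s.core = t.span s := by
  induction t with
  | natLt | atEnd => rfl
  | realLt x y => simp only [BoolExp.span, RealExp.span_core]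
  | neg p hp => simp only [BoolExp.span, hp]
  | conj p q hp hq => simp only [BoolExp.span, hp, hq]

/-- The natural-number registers that a command may change. -/
def Cmd.writesNat : Cmd a b c → Fin a → Bool
  | .setNat r _, x => decide (x = r)
  | .flip r, x => decide (x = r)
  | .seq p q, x => p.writesNat x || q.writesNat x
  | .ite _ p q, x => p.writesNat x || q.writesNat x
  | .loop _ p, x => p.writesNat x
  | _, _ => false

/-- The real registers that a command may change. -/
def Cmd.writesReal : Cmd a b c → Fin b → Bool
  | .setReal r _, x => decide (x = r)
  | .seq p q, x => p.writesReal x || q.writesReal x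
  | .ite _ p q, x => p.writesReal x || q.writesReal x
  | .loop _ p, x => p.writesReal x
  | _, _ => false

/-- The arrays that a command may change. -/
def Cmd.writesArr : Cmd a b c → Fin c → Bool
  | .setArr k _ _, x => decide (x = k)
  | .seq p q, x => p.writesArr x || q.writesArr x
  | .ite _ p q, x => p.writesArr x || q.writesArr x
  | .loop _ p, x => p.writesArr x
  | _, _ => false

/-- Whether a command may move in the stream. -/
def Cmd.moves : Cmd a b c → Bool
  | .next => true
  | .rewind => true
  | .seq p q => p.moves || q.moves
  | .ite _ p q => p.moves || q.moves
  | .loop _ p => p.moves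
  | _ => false

/-- Whether a command may flip coins. -/
def Cmd.flips : Cmd a b c → Bool
  | .flip _ => true
  | .seq p q => p.flips || q.flips
  | .ite _ p q => p.flips || q.flips
  | .loop _ p => p.flips
  | _ => false

/-- The states `s` and `s'` agree on everything that the command `p` cannot change. -/
structure Agree (p : Cmd a b c) (s s' : State d a b c) : Prop where
  nat : ∀ r, p.writesNat r = false → s'.nat r = s.nat r
  real : ∀ r, p.writesReal r = false → s'.real r = s.real r
  arr : ∀ k, p.writesArr k = false → s'.arr k = s.arr k
  item : p.moves = false → s'.item = s.item
  pass : p.moves = false → s'.pass = s.pass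
  pos : p.moves = false → s'.pos = s.pos
  coin : p.flips = false → s'.coin = s.coin

lemma Agree.refl (p : Cmd a b c) (s : State d a b c) : Agree p s s :=
  ⟨fun _ _ => rfl, fun _ _ => rfl, fun _ _ => rfl, fun _ => rfl, fun _ => rfl, fun _ => rfl,
    fun _ => rfl⟩

lemma Agree.trans {p : Cmd a b c} {s s' s'' : State d a b c} (h : Agree p s s')
    (h' : Agree p s' s'') : Agree p s s'' :=
  ⟨fun r hr => (h'.nat r hr).trans (h.nat r hr), fun r hr => (h'.real r hr).trans (h.real r hr),
    fun r hr => (h'.arr r hr).trans (h.arr r hr), fun hr => (h'.item hr).trans (h.item hr),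
    fun hr => (h'.pass hr).trans (h.pass hr), fun hr => (h'.pos hr).trans (h.pos hr),
    fun hr => (h'.coin hr).trans (h.coin hr)⟩

/-- Every command that may change what `q` may change inherits agreement. -/
lemma Agree.mono {p q : Cmd a b c} {s s' : State d a b c} (h : Agree q s s')
    (h1 : ∀ r, p.writesNat r = false → q.writesNat r = false)
    (h2 : ∀ r, p.writesReal r = false → q.writesReal r = false)
    (h3 : ∀ r, p.writesArr r = false → q.writesArr r = false)
    (h4 : p.moves = false → q.moves = false) (h5 : p.flips = false → q.flips = false) :
    Agree p s s' :=
  ⟨fun r hr => h.nat r (h1 r hr), fun r hr => h.real r (h2 r hr), fun r hr => h.arr r (h3 r hr),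
    fun hr => h.item (h4 hr), fun hr => h.pass (h4 hr), fun hr => h.pos (h4 hr),
    fun hr => h.coin (h5 hr)⟩

lemma Agree.seq_left {p q : Cmd a b c} {s s' : State d a b c} (h : Agree p s s') :
    Agree (.seq p q) s s' :=
  h.mono (by simp +contextual [Cmd.writesNat]) (by simp +contextual [Cmd.writesReal])
    (by simp +contextual [Cmd.writesArr]) (by simp +contextual [Cmd.moves])
    (by simp +contextual [Cmd.flips])

lemma Agree.seq_right {p q : Cmd a b c} {s s' : State d a b c} (h : Agree q s s') :
    Agree (.seq p q) s s' :=
  h.mono (by simp +contextual [Cmd.writesNat]) (by simp +contextual [Cmd.writesReal])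
    (by simp +contextual [Cmd.writesArr]) (by simp +contextual [Cmd.moves])
    (by simp +contextual [Cmd.flips])

lemma Agree.ite_left {t : BoolExp a b c} {p q : Cmd a b c} {s s' : State d a b c}
    (h : Agree p s s') : Agree (.ite t p q) s s' :=
  h.mono (by simp +contextual [Cmd.writesNat]) (by simp +contextual [Cmd.writesReal])
    (by simp +contextual [Cmd.writesArr]) (by simp +contextual [Cmd.moves])
    (by simp +contextual [Cmd.flips])

lemma Agree.ite_right {t : BoolExp a b c} {p q : Cmd a b c} {s s' : State d a b c}
    (h : Agree q s s') : Agree (.ite t p q) s s' :=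
  h.mono (by simp +contextual [Cmd.writesNat]) (by simp +contextual [Cmd.writesReal])
    (by simp +contextual [Cmd.writesArr]) (by simp +contextual [Cmd.moves])
    (by simp +contextual [Cmd.flips])

lemma Agree.loop {t : BoolExp a b c} {p : Cmd a b c} {s s' : State d a b c}
    (h : Agree p s s') : Agree (.loop t p) s s' :=
  h.mono (by simp +contextual [Cmd.writesNat]) (by simp +contextual [Cmd.writesReal])
    (by simp +contextual [Cmd.writesArr]) (by simp +contextual [Cmd.moves])
    (by simp +contextual [Cmd.flips])

/-- Executing a command changes only what it may change. -/
lemma Exec.agree {I : Input d n} {p : Cmd a b c} {s s' : State d a b c} (h : Exec I p s s') :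
    Agree p s.core s'.core := by
  induction h with
  | skip s => exact Agree.refl _ _
  | setNat s r e =>
    refine ⟨fun x hx => ?_, fun _ _ => rfl, fun _ _ => rfl, fun _ => rfl, fun _ => rfl,
      fun _ => rfl, fun _ => rfl⟩
    simp only [Cmd.writesNat, decide_eq_false_iff_not] at hx
    exact Function.update_of_ne hx _ _
  | setReal s r x =>
    refine ⟨fun _ _ => rfl, fun x hx => ?_, fun _ _ => rfl, fun _ => rfl, fun _ => rfl,
      fun _ => rfl, fun _ => rfl⟩
    simp only [Cmd.writesReal, decide_eq_false_iff_not] at hx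
    exact Function.update_of_ne hx _ _
  | setArr s k e x =>
    refine ⟨fun _ _ => rfl, fun _ _ => rfl, fun x hx => ?_, fun _ => rfl, fun _ => rfl,
      fun _ => rfl, fun _ => rfl⟩
    simp only [Cmd.writesArr, decide_eq_false_iff_not] at hx
    exact Function.update_of_ne hx _ _
  | flip s r =>
    refine ⟨fun x hx => ?_, fun _ _ => rfl, fun _ _ => rfl, fun _ => rfl, fun _ => rfl,
      fun _ => rfl, fun h => ?_⟩
    · simp only [Cmd.writesNat, decide_eq_false_iff_not] at hx
      exact Function.update_of_ne hx _ _
    · simp [Cmd.flips] at h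
  | next s h =>
    exact ⟨fun _ _ => rfl, fun _ _ => rfl, fun _ _ => rfl, fun h => by simp [Cmd.moves] at h,
      fun h => by simp [Cmd.moves] at h, fun h => by simp [Cmd.moves] at h, fun _ => rfl⟩
  | nextAtEnd s h => exact Agree.refl _ _
  | rewind s =>
    exact ⟨fun _ _ => rfl, fun _ _ => rfl, fun _ _ => rfl, fun h => by simp [Cmd.moves] at h,
      fun h => by simp [Cmd.moves] at h, fun h => by simp [Cmd.moves] at h, fun _ => rfl⟩
  | seq _ _ h1 h2 => exact h1.seq_left.trans h2.seq_right
  | iteTrue _ _ h => exact h.ite_left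
  | iteFalse _ _ h => exact h.ite_right
  | loopTrue _ _ _ h1 h2 => exact Agree.trans (Agree.loop h1) h2
  | loopFalse _ => exact Agree.refl _ _

/-- From every state with core `σ`, the command `p` terminates within time `t`, accesses only array
cells with addresses below `m`, and ends in a state whose core satisfies `Q`. -/
def Runs (I : Input d n) (p : Cmd a b c) (σ : State d a b c) (t m : ℕ)
    (Q : State d a b c → Prop) : Prop :=
  ∀ s : State d a b c, s.core = σ → ∃ s', Exec I p s s' ∧ s'.time ≤ s.time + t ∧
    s'.span ≤ max s.span m ∧ Q s'.core ∧ Agree p σ s'.core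

namespace Runs

variable {I : Input d n} {p q : Cmd a b c} {σ : State d a b c} {t t' m : ℕ}
  {Q Q' : State d a b c → Prop}

lemma mono (h : Runs I p σ t m Q) (ht : t ≤ t') (hQ : ∀ σ', Agree p σ σ' → Q σ' → Q' σ') :
    Runs I p σ t' m Q' := fun s hs => by
  obtain ⟨s', h1, h2, h3, h4, h5⟩ := h s hs
  exact ⟨s', h1, by omega, h3, hQ _ h5 h4, h5⟩

lemma time_le (h : Runs I p σ t m Q) (ht : t ≤ t') : Runs I p σ t' m Q :=
  h.mono ht fun _ _ h => h

lemma weaken (h : Runs I p σ t m Q) (hQ : ∀ σ', Agree p σ σ' → Q σ' → Q' σ') :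
    Runs I p σ t m Q' := h.mono le_rfl hQ

lemma seq {t₁ t₂ : ℕ} (h1 : Runs I p σ t₁ m Q')
    (h2 : ∀ σ', Agree p σ σ' → Q' σ' → Runs I q σ' t₂ m Q) :
    Runs I (.seq p q) σ (t₁ + t₂) m Q := fun s hs => by
  obtain ⟨s₁, e1, e2, e3, e4, e5⟩ := h1 s hs
  obtain ⟨s₂, f1, f2, f3, f4, f5⟩ := h2 _ e5 e4 s₁ rfl
  exact ⟨s₂, .seq e1 f1, by omega, f3.trans (max_le e3 (le_max_right _ _)), f4,
    e5.seq_left.trans f5.seq_right⟩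

lemma ite {τ : BoolExp a b c} {t₁ t₂ : ℕ} (hm : τ.span σ ≤ m)
    (h1 : τ.Holds I σ → Runs I p σ t₁ m Q) (h2 : ¬ τ.Holds I σ → Runs I q σ t₂ m Q) :
    Runs I (.ite τ p q) σ (τ.cost + 1 + max t₁ t₂) m Q := fun s hs => by
  have hsp : (s.charge (τ.cost + 1) (τ.span s)).span ≤ max s.span m := by
    subst hs
    rw [BoolExp.span_core] at hm
    exact max_le_max le_rfl hm
  have hti : (s.charge (τ.cost + 1) (τ.span s)).time = s.time + (τ.cost + 1) := rfl
  by_cases hτ : τ.Holds I s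
  · obtain ⟨s₁, e1, e2, e3, e4, e5⟩ := h1 (by subst hs; rwa [BoolExp.holds_core])
      (s.charge (τ.cost + 1) (τ.span s)) hs
    refine ⟨s₁, .iteTrue hτ e1, ?_, e3.trans (max_le hsp (le_max_right _ _)), e4, e5.ite_left⟩
    have := le_max_left t₁ t₂
    omega
  · obtain ⟨s₁, e1, e2, e3, e4, e5⟩ := h2 (by subst hs; rwa [BoolExp.holds_core])
      (s.charge (τ.cost + 1) (τ.span s)) hs
    refine ⟨s₁, .iteFalse hτ e1, ?_, e3.trans (max_le hsp (le_max_right _ _)), e4, e5.ite_right⟩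
    have := le_max_right t₁ t₂
    omega

/-- A loop whose test succeeds exactly `N` times. -/
lemma loop {τ : BoolExp a b c} (N : ℕ) (Inv : ℕ → State d a b c → Prop) (h0 : Inv 0 σ)
    (hstep : ∀ k < N, ∀ σ', Agree (.loop τ p) σ σ' → Inv k σ' → τ.Holds I σ' ∧ τ.span σ' ≤ m ∧
      Runs I p σ' t m (Inv (k + 1)))
    (hend : ∀ σ', Agree (.loop τ p) σ σ' → Inv N σ' → ¬ τ.Holds I σ' ∧ τ.span σ' ≤ m) :
    Runs I (.loop τ p) σ (N * (τ.cost + 1 + t) + (τ.cost + 1)) m (Inv N) := by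
  -- Induction on the number `j` of iterations that remain, for all intermediate states at once.
  have key : ∀ j k, k + j = N → ∀ σ', Agree (.loop τ p) σ σ' → Inv k σ' →
      Runs I (.loop τ p) σ' (j * (τ.cost + 1 + t) + (τ.cost + 1)) m (Inv N) := by
    intro j
    induction j with
    | zero =>
      intro k hk σ' hag hinv s hs
      obtain rfl : k = N := by omega
      obtain ⟨h1, h2⟩ := hend σ' hag hinv
      subst hs
      rw [BoolExp.holds_core] at h1
      rw [BoolExp.span_core] at h2
      refine ⟨_, .loopFalse h1, ?_, max_le_max le_rfl h2, hinv, Agree.refl _ _⟩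
      change s.time + (τ.cost + 1) ≤ _
      omega
    | succ j ih =>
      intro k hk σ' hag hinv s hs
      obtain ⟨h1, h2, h3⟩ := hstep k (by omega) σ' hag hinv
      obtain ⟨s₁, e1, e2, e3, e4, e5⟩ := h3 (s.charge (τ.cost + 1) (τ.span s)) hs
      obtain ⟨s₂, f1, f2, f3, f4, f5⟩ := ih (k + 1) (by omega) s₁.core (hag.trans e5.loop) e4 s₁ rfl
      subst hs
      rw [BoolExp.holds_core] at h1
      rw [BoolExp.span_core] at h2
      refine ⟨s₂, .loopTrue h1 e1 f1, ?_, ?_, f4, Agree.trans e5.loop f5⟩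
      · have : (s.charge (τ.cost + 1) (τ.span s)).time = s.time + (τ.cost + 1) := rfl
        rw [Nat.add_mul]
        omega
      · have : (s.charge (τ.cost + 1) (τ.span s)).span ≤ max s.span m := max_le_max le_rfl h2
        exact f3.trans (max_le (e3.trans (max_le this (le_max_right _ _))) (le_max_right _ _))
  exact key N 0 (by omega) σ (Agree.refl _ _) h0

lemma next {k : ℕ} (hk : k < n) (hpos : σ.pos = k)
    (hQ : Q { σ with item := I.stream σ.pass ⟨k, hk⟩, pos := k + 1 }) :
    Runs I .next σ (d + 1) m Q := fun s hs => by
  subst hs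
  obtain rfl : s.pos = k := hpos
  have e := Exec.next (I := I) s hk
  exact ⟨_, e, le_rfl, max_le_max le_rfl (Nat.zero_le _), hQ, e.agree⟩

end Runs

/-- The effect of a command without loops and `next` on the core of a state. -/
def Cmd.sem (I : Input d n) : Cmd a b c → State d a b c → State d a b c
  | .skip, σ => σ
  | .setNat r e, σ => { σ with nat := Function.update σ.nat r (e.eval σ) }
  | .setReal r x, σ => { σ with real := Function.update σ.real r (x.eval I σ) }
  | .setArr k e x, σ => { σ with
      arr := Function.update σ.arr k (Function.update (σ.arr k) (e.eval σ) (x.eval I σ)) }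
  | .flip r, σ => { σ with
      nat := Function.update σ.nat r (I.coins σ.coin).toNat
      coin := σ.coin + 1 }
  | .next, σ => σ
  | .rewind, σ => { σ with pass := σ.pass + 1, pos := 0 }
  | .seq p q, σ => q.sem I (p.sem I σ)
  | .ite t p q, σ => open Classical in if t.Holds I σ then p.sem I σ else q.sem I σ
  | .loop _ _, σ => σ

/-- Commands without loops and `next`. -/
def Cmd.simple : Cmd a b c → Bool
  | .next => false
  | .loop _ _ => false
  | .seq p q => p.simple && q.simple
  | .ite _ p q => p.simple && q.simple
  | _ => true

/-- A bound for the time that a simple command takes. -/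
def Cmd.budget : Cmd a b c → ℕ
  | .setNat _ e => e.cost + 1
  | .setReal _ x => x.cost + 1
  | .setArr _ e x => e.cost + x.cost + 1
  | .seq p q => p.budget + q.budget
  | .ite t p q => t.cost + 1 + max p.budget q.budget
  | _ => 1

/-- A simple command accesses only array cells with addresses below `m`. -/
def Cmd.SpanLe (I : Input d n) (m : ℕ) : Cmd a b c → State d a b c → Prop
  | .setReal _ x, σ => x.span σ ≤ m
  | .setArr _ e x, σ => e.eval σ + 1 ≤ m ∧ x.span σ ≤ m
  | .seq p q, σ => p.SpanLe I m σ ∧ q.SpanLe I m (p.sem I σ)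
  | .ite t p q, σ => t.span σ ≤ m ∧ (t.Holds I σ → p.SpanLe I m σ) ∧
      (¬ t.Holds I σ → q.SpanLe I m σ)
  | _, _ => True

/-- Straight-line code is handled by computing its effect `Cmd.sem`; real logical work remains only
for loops and stream access. -/
lemma Runs.simple {I : Input d n} {p : Cmd a b c} {σ : State d a b c} {m : ℕ}
    {Q : State d a b c → Prop} (hp : p.simple = true) (hm : p.SpanLe I m σ)
    (hQ : Q (p.sem I σ)) : Runs I p σ p.budget m Q := by
  induction p generalizing σ Q with
  | skip =>
    intro s hs
    subst hs
    exact ⟨_, .skip s, le_rfl, max_le_max le_rfl (Nat.zero_le _), hQ, Agree.refl _ _⟩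
  | setNat r e =>
    intro s hs
    subst hs
    have h := Exec.setNat (I := I) s r e
    refine ⟨_, h, le_rfl, max_le_max le_rfl (Nat.zero_le _), ?_, h.agree⟩
    simp only [Cmd.sem, NatExp.eval_core] at hQ; exact hQ
  | setReal r x =>
    intro s hs
    subst hs
    have h := Exec.setReal (I := I) s r x
    refine ⟨_, h, le_rfl, max_le_max le_rfl ?_, ?_, h.agree⟩
    · simpa only [Cmd.SpanLe, RealExp.span_core] using hm
    · simp only [Cmd.sem, RealExp.eval_core] at hQ; exact hQ
  | setArr k e x =>
    intro s hs
    subst hs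
    have h := Exec.setArr (I := I) s k e x
    refine ⟨_, h, le_rfl, max_le_max le_rfl ?_, ?_, h.agree⟩
    · simp only [Cmd.SpanLe, RealExp.span_core, NatExp.eval_core] at hm
      exact max_le hm.1 hm.2
    · simp only [Cmd.sem, RealExp.eval_core, NatExp.eval_core] at hQ; exact hQ
  | flip r =>
    intro s hs
    subst hs
    have h := Exec.flip (I := I) s r
    exact ⟨_, h, le_rfl, max_le_max le_rfl (Nat.zero_le _), hQ, h.agree⟩
  | next => simp [Cmd.simple] at hp
  | rewind =>
    intro s hs
    subst hs
    have h := Exec.rewind (I := I) s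
    exact ⟨_, h, le_rfl, max_le_max le_rfl (Nat.zero_le _), hQ, h.agree⟩
  | seq p q ihp ihq =>
    simp only [Cmd.simple, Bool.and_eq_true] at hp
    exact Runs.seq (ihp hp.1 hm.1 (Q := fun σ' => σ' = p.sem I σ) rfl)
      fun σ' _ h => by subst h; exact ihq hp.2 hm.2 hQ
  | ite t p q ihp ihq =>
    simp only [Cmd.simple, Bool.and_eq_true] at hp
    refine Runs.ite hm.1 (fun ht => ihp hp.1 (hm.2.1 ht) ?_) (fun ht => ihq hp.2 (hm.2.2 ht) ?_)
    · simpa only [Cmd.sem, if_pos ht] using hQ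
    · simpa only [Cmd.sem, if_neg ht] using hQ
  | loop t p => simp [Cmd.simple] at hp

/-- `for r < e do p`. -/
def Cmd.forLoop (r : Fin a) (e : NatExp a) (p : Cmd a b c) : Cmd a b c :=
  .seq (.setNat r (.lit 0))
    (.loop (.natLt (.reg r) e) (.seq p (.setNat r (.add (.reg r) (.lit 1)))))

/-- `for each point of the stream do p`, followed by the start of a new pass. -/
def Cmd.forStream (p : Cmd a b c) : Cmd a b c :=
  .seq (.loop (.neg .atEnd) (.seq .next p)) .rewind

namespace Runs

variable {I : Input d n} {p : Cmd a b c} {σ : State d a b c} {t m : ℕ}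

/-- The invariant at `k + 1` is required after the counter has been advanced, hence the updated
register in `hstep`. The body may not write the counter, and the bound must keep its value
throughout. -/
lemma forLoop {r : Fin a} {e : NatExp a} (N : ℕ) (Inv : ℕ → State d a b c → Prop)
    (hr : p.writesNat r = false)
    (he : ∀ σ', Agree (Cmd.forLoop r e p) σ σ' → e.eval σ' = N)
    (h0 : Inv 0 { σ with nat := Function.update σ.nat r 0 })
    (hstep : ∀ k < N, ∀ σ', Agree (Cmd.forLoop r e p) σ σ' → σ'.nat r = k → Inv k σ' →
      Runs I p σ' t m fun σ'' => Inv (k + 1) { σ'' with nat := Function.update σ''.nat r (k + 1) }) :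
    Runs I (Cmd.forLoop r e p) σ (N * (e.cost + t + 7) + e.cost + 5) m
      fun σ' => σ'.nat r = N ∧ Inv N σ' := by
  refine (Runs.seq (Runs.simple (Q := fun σ' => σ' = { σ with nat := Function.update σ.nat r 0 })
    rfl (by exact trivial) rfl) (Q := fun σ' => σ'.nat r = N ∧ Inv N σ')
    (t₂ := N * (e.cost + t + 7) + (e.cost + 3)) ?_).time_le ?_
  · intro σ₁ hag hσ₁
    have hag1 : Agree (Cmd.forLoop r e p) σ σ₁ := hag.seq_left
    refine (Runs.loop (t := t + 4) N (fun k σ' => σ'.nat r = k ∧ Inv k σ')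
      ?_ ?_ ?_).time_le ?_
    · subst hσ₁
      exact ⟨Function.update_self _ _ _, h0⟩
    · rintro k hk σ' hag' ⟨hk', hinv⟩
      have hag2 : Agree (Cmd.forLoop r e p) σ σ' := hag1.trans hag'.seq_right
      refine ⟨?_, Nat.zero_le _, ?_⟩
      · change σ'.nat r < e.eval σ'
        rw [he _ hag2, hk']
        exact hk
      · refine Runs.seq (hstep k hk σ' hag2 hk' hinv) fun σ'' hag'' hQ => ?_
        refine (Runs.simple rfl (by exact trivial) ?_).time_le (le_refl _)
        have hk2 : σ''.nat r = k := by rw [hag''.nat r hr, hk']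
        have hev : (NatExp.add (.reg r) (.lit 1) : NatExp a).eval σ'' = k + 1 := by
          change σ''.nat r + 1 = k + 1
          rw [hk2]
        simp only [Cmd.sem, hev]
        exact ⟨Function.update_self _ _ _, hQ⟩
    · rintro σ' hag' ⟨hk', -⟩
      have hag2 : Agree (Cmd.forLoop r e p) σ σ' := hag1.trans hag'.seq_right
      refine ⟨?_, Nat.zero_le _⟩
      change ¬ σ'.nat r < e.eval σ'
      rw [he _ hag2, hk']
      exact lt_irrefl _
    · simp only [BoolExp.cost, NatExp.cost]
      have : 1 + e.cost + 1 + 1 + (t + 4) = e.cost + t + 7 := by omega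
      rw [this]
      omega
  · simp only [Cmd.budget, NatExp.cost]
    omega

/-- Since the body may not move in the stream, its run number `k` sees exactly item `k` of one pass.
The final rewind leaves the position ready for the next pass. -/
lemma forStream (Inv : ℕ → State d a b c → Prop) (hp : p.moves = false) (hpos : σ.pos = 0)
    (h0 : Inv 0 σ)
    (hstep : ∀ k (hk : k < n), ∀ σ', Agree (Cmd.forStream p) σ σ' → σ'.pass = σ.pass →
      Inv k σ' → Runs I p { σ' with item := I.stream σ.pass ⟨k, hk⟩, pos := k + 1 } t m
        (Inv (k + 1))) :
    Runs I (Cmd.forStream p) σ (n * (t + d + 4) + 4) m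
      fun σ' => ∃ σ'' : State d a b c, Inv n σ'' ∧
        σ' = { σ'' with pos := 0, pass := σ.pass + 1 } := by
  refine (Runs.seq (Q' := fun σ' => Inv n σ' ∧ σ'.pass = σ.pass)
    (t₁ := n * (t + d + 4) + 3) ?_ ?_ (t₂ := 1)).time_le (by omega)
  · refine ((Runs.loop (t := d + 1 + t) n
      (fun k σ' => Inv k σ' ∧ σ'.pos = k ∧ σ'.pass = σ.pass) ⟨h0, hpos, rfl⟩ ?_ ?_).weaken
        ?_).time_le ?_
    · rintro k hk σ' hag ⟨hinv, hk', hpass⟩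
      refine ⟨?_, Nat.zero_le _, ?_⟩
      · change ¬ n ≤ σ'.pos
        omega
      · refine Runs.seq (Runs.next hk hk' (Q := fun σ'' => σ'' =
          { σ' with item := I.stream σ.pass ⟨k, hk⟩, pos := k + 1 }) (by rw [hpass])) ?_
        rintro σ'' - rfl
        refine (hstep k hk σ' hag.seq_left hpass hinv).weaken fun σ₃ hag3 hinv3 => ⟨hinv3, ?_, ?_⟩
        · rw [hag3.pos hp]
        · rw [hag3.pass hp]; exact hpass
    · rintro σ' - ⟨-, hk', -⟩
      refine ⟨?_, Nat.zero_le _⟩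
      change ¬ ¬ n ≤ σ'.pos
      omega
    · rintro σ' - ⟨h1, -, h2⟩
      exact ⟨h1, h2⟩
    · simp only [BoolExp.cost]
      have : 1 + 1 + 1 + (d + 1 + t) = t + d + 4 := by omega
      rw [this]
  · rintro σ' - ⟨h1, h2⟩
    refine (Runs.simple rfl (by exact trivial) ?_).time_le (le_refl _)
    exact ⟨σ', h1, by simp only [Cmd.sem, h2]⟩

end Runs

end Logic

end StreamRAM

namespace StreamRAM

open RobustMean

/-! ### Vectors stored in arrays. -/

section Vectors

variable {d n : ℕ}

/-- The vector stored in the `d` cells from address `o` on. -/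
def vecAt (f : ℕ → ℝ) (o : ℕ) : Pt d := WithLp.toLp 2 fun i : Fin d => f (o + i)

/-- Coordinate number `i`, or `0` if there is none. -/
def coord (x : Pt d) (i : ℕ) : ℝ := if h : i < d then x ⟨i, h⟩ else 0

@[simp] lemma vecAt_apply (f : ℕ → ℝ) (o : ℕ) (i : Fin d) : (vecAt f o : Pt d) i = f (o + i) := rfl

@[simp] lemma coord_fin (x : Pt d) (i : Fin d) : coord x i = x i := by simp [coord]

/-- `f` with `k` cells from address `o` on replaced by the values of `g`. -/
def fill (f : ℕ → ℝ) (o : ℕ) (g : ℕ → ℝ) (k : ℕ) (i : ℕ) : ℝ :=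
  if o ≤ i ∧ i < o + k then g (i - o) else f i

lemma fill_zero (f : ℕ → ℝ) (o : ℕ) (g : ℕ → ℝ) : fill f o g 0 = f := by
  ext i
  rw [fill, if_neg (by omega)]

lemma update_fill (f : ℕ → ℝ) (o : ℕ) (g : ℕ → ℝ) (k : ℕ) :
    Function.update (fill f o g k) (o + k) (g k) = fill f o g (k + 1) := by
  ext i
  rcases eq_or_ne i (o + k) with rfl | h
  · rw [Function.update_self, fill, if_pos (by omega), Nat.add_sub_cancel_left]
  · rw [Function.update_of_ne h, fill, fill]
    congr 1
    apply propext
    omega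

/-- The cell about to be written still has its old content, so vectors can be updated in place. -/
lemma fill_apply_add (f : ℕ → ℝ) (o : ℕ) (g : ℕ → ℝ) (k : ℕ) :
    fill f o g k (o + k) = f (o + k) := by
  rw [fill, if_neg (by omega)]

lemma fill_of_lt (f : ℕ → ℝ) {o : ℕ} (g : ℕ → ℝ) (k : ℕ) {i : ℕ} (hi : i < o) :
    fill f o g k i = f i := by
  rw [fill, if_neg (by omega)]

lemma vecAt_fill (f : ℕ → ℝ) (o : ℕ) (g : ℕ → ℝ) :
    (vecAt (fill f o g d) o : Pt d) = WithLp.toLp 2 fun i : Fin d => g i := by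
  ext i
  have := i.2
  simp only [vecAt_apply]
  rw [fill, if_pos (by omega), Nat.add_sub_cancel_left]

/-- Writing the block of the current filter leaves the blocks of earlier filters intact. -/
lemma vecAt_fill_block (f : ℕ → ℝ) {t t' : ℕ} (ht : t' < t) (g : ℕ → ℝ) (k : ℕ) :
    (vecAt (fill f (t * d) g k) (t' * d) : Pt d) = vecAt f (t' * d) := by
  ext i
  simp only [vecAt_apply]
  refine fill_of_lt _ _ _ ?_
  have h1 : (t' + 1) * d ≤ t * d := Nat.mul_le_mul_right _ ht
  have h2 := i.2
  rw [Nat.add_mul] at h1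
  omega

/-- The sum of the first `k` values. -/
def partialSum {F : Type*} [AddCommMonoid F] (f : Fin n → F) (k : ℕ) : F :=
  ∑ j ∈ Finset.range k, if h : j < n then f ⟨j, h⟩ else 0

@[simp] lemma partialSum_zero {F : Type*} [AddCommMonoid F] (f : Fin n → F) :
    partialSum f 0 = 0 := by simp [partialSum]

lemma partialSum_succ {F : Type*} [AddCommMonoid F] (f : Fin n → F) {k : ℕ} (hk : k < n) :
    partialSum f (k + 1) = partialSum f k + f ⟨k, hk⟩ := by
  rw [partialSum, Finset.sum_range_succ, dif_pos hk, partialSum]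

lemma partialSum_self {F : Type*} [AddCommMonoid F] (f : Fin n → F) :
    partialSum f n = ∑ i, f i := by
  rw [partialSum, Finset.sum_fin_eq_sum_range]

lemma norm_sub_vecAt_sq (x : Pt d) (f : ℕ → ℝ) (o : ℕ) :
    ∑ i ∈ Finset.range d, (coord x i - f (o + i)) * (coord x i - f (o + i))
      = ‖x - vecAt f o‖ ^ 2 := by
  rw [Finset.sum_range, EuclideanSpace.real_norm_sq_eq]
  refine Finset.sum_congr rfl fun i _ => ?_
  simp [sq]

lemma inner_vecAt (x : Pt d) (f g : ℕ → ℝ) (o : ℕ) :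
    ∑ i ∈ Finset.range d, f (o + i) * (coord x i - g (o + i))
      = ⟪(vecAt f o : Pt d), x - vecAt g o⟫_ℝ := by
  rw [Finset.sum_range, PiLp.inner_apply]
  refine Finset.sum_congr rfl fun i _ => ?_
  simp [mul_comm]

end Vectors

/-! ### The program -/

/-- The number of points of the stream. -/
@[simp] abbrev rN : Fin 12 := 0
/-- The number of steps of the power method. -/
@[simp] abbrev rL : Fin 12 := 1
/-- The current round. -/
@[simp] abbrev rT : Fin 12 := 2
/-- The filter that is being applied. -/
@[simp] abbrev rK : Fin 12 := 3
/-- The current coordinate. -/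
@[simp] abbrev rI : Fin 12 := 4
/-- The current step of an inner loop. -/
@[simp] abbrev rQ : Fin 12 := 5
/-- A random bit. -/
@[simp] abbrev rB : Fin 12 := 6
/-- A random position in the stream. -/
@[simp] abbrev rU : Fin 12 := 7
/-- A power of two. -/
@[simp] abbrev rY : Fin 12 := 8
/-- The current position in the stream. -/
@[simp] abbrev rP : Fin 12 := 9
/-- The number of points near the candidate. -/
@[simp] abbrev rC : Fin 12 := 10
/-- The number of the candidate. -/
@[simp] abbrev rJ : Fin 12 := 11

/-- A power of two. -/
@[simp] abbrev xY : Fin 12 := 0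
/-- The weight of the current point. -/
@[simp] abbrev xW : Fin 12 := 1
/-- An accumulator. -/
@[simp] abbrev xA : Fin 12 := 2
/-- The total weight. -/
@[simp] abbrev xS : Fin 12 := 3
/-- The second moment in the current direction. -/
@[simp] abbrev xM : Fin 12 := 4
/-- The total score that is left. -/
@[simp] abbrev xF : Fin 12 := 5
/-- The square of the pruning radius. -/
@[simp] abbrev xR : Fin 12 := 6
/-- The multiple of the identity that is subtracted. -/
@[simp] abbrev xL : Fin 12 := 7
/-- The squared length of the current direction. -/
@[simp] abbrev xV : Fin 12 := 8
/-- The bound for the score of the good points. -/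
@[simp] abbrev xB : Fin 12 := 9
/-- The quantity `δ ^ 2 / ε`. -/
@[simp] abbrev xD : Fin 12 := 10
/-- The score of the current point. -/
@[simp] abbrev xT : Fin 12 := 11

/-- The centres of the filters. -/
@[simp] abbrev aCen : Fin 9 := 0
/-- The directions of the filters. -/
@[simp] abbrev aDir : Fin 9 := 1
/-- The thresholds of the filters. -/
@[simp] abbrev aThr : Fin 9 := 2
/-- The step sizes of the filters. -/
@[simp] abbrev aSz : Fin 9 := 3
/-- The weighted sum of the points. -/
@[simp] abbrev aSum : Fin 9 := 4
/-- The weighted second moment applied to the current direction. -/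
@[simp] abbrev aMom : Fin 9 := 5
/-- The rough centre. -/
@[simp] abbrev aC0 : Fin 9 := 6
/-- The candidate for the rough centre. -/
@[simp] abbrev aCand : Fin 9 := 7
/-- The output. -/
@[simp] abbrev aOut : Fin 9 := 8

abbrev NExp : Type := NatExp 12
abbrev RExp : Type := RealExp 12 12 9
abbrev Code : Type := Cmd 12 12 9
abbrev St (d : ℕ) : Type := State d 12 12 9

/-- Assign to the `d` cells of the array `A` from address `e` on. -/
def vecCmd (A : Fin 9) (e : NExp) (x : RExp) : Code :=
  .forLoop rI .dim (.setArr A (.add e (.reg rI)) x)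

/-- Sum an expression over the coordinates. -/
def sumCmd (r : Fin 12) (x : RExp) : Code :=
  .seq (.setReal r (.lit 0)) (.forLoop rI .dim (.setReal r (.add (.reg r) x)))

section Specs

variable {d n : ℕ} {I : Input d n} {σ : St d} {m : ℕ}

/-- The content of the target array during the loop is available to `hx`, so the assigned expression
may read the array being overwritten. -/
lemma runs_vecCmd (A : Fin 9) (e : NExp) (x : RExp) (o : ℕ) (g : ℕ → ℝ) (ho : o + d ≤ m)
    (hx : ∀ k < d, ∀ σ' : St d, Agree (vecCmd A e x) σ σ' → σ'.nat rI = k →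
      σ'.arr A = fill (σ.arr A) o g k → e.eval σ' = o ∧ x.eval I σ' = g k ∧ x.span σ' ≤ m) :
    Runs I (vecCmd A e x) σ (d * (e.cost + x.cost + 11) + 6) m
      fun σ' => σ'.arr A = fill (σ.arr A) o g d := by
  refine ((Runs.forLoop (t := e.cost + x.cost + 3) d
    (fun k σ' => σ'.arr A = fill (σ.arr A) o g k) rfl (fun _ _ => rfl) ?_ ?_).weaken
      fun σ' _ h => h.2).time_le ?_
  · simp [fill_zero]
  · intro k hk σ' hag hi hinv
    obtain ⟨h1, h2, h3⟩ := hx k hk σ' hag hi hinv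
    have he : (NatExp.add e (.reg rI) : NExp).eval σ' = o + k := by
      simp only [NatExp.eval, h1, hi]
    refine (Runs.simple rfl ?_ ?_).time_le ?_
    · simp only [Cmd.SpanLe, he]
      exact ⟨by omega, h3⟩
    · simp only [Cmd.sem, he, h2, Function.update_self, hinv, update_fill]
    · simp only [Cmd.budget, NatExp.cost]
      omega
  · simp only [NatExp.cost]
    have : 1 + (e.cost + x.cost + 3) + 7 = e.cost + x.cost + 11 := by omega
    rw [this]

lemma runs_sumCmd (r : Fin 12) (x : RExp) (g : ℕ → ℝ)
    (hx : ∀ k < d, ∀ σ' : St d, Agree (sumCmd r x) σ σ' → σ'.nat rI = k →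
      x.eval I σ' = g k ∧ x.span σ' ≤ m) :
    Runs I (sumCmd r x) σ (d * (x.cost + 11) + 8) m
      fun σ' => σ'.real r = ∑ i ∈ Finset.range d, g i := by
  refine (Runs.seq (Runs.simple (Q := fun σ' => σ'.real r = 0) rfl (Nat.zero_le _) (by
    simp [Cmd.sem, RealExp.eval])) (t₂ := d * (x.cost + 11) + 6) ?_).time_le ?_
  · intro σ₁ hag₁ h₁
    refine ((Runs.forLoop (t := x.cost + 3) d
      (fun k σ' => σ'.real r = ∑ i ∈ Finset.range k, g i) rfl (fun _ _ => rfl) ?_ ?_).weaken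
        fun σ' _ h => h.2).time_le ?_
    · simpa using h₁
    · intro k hk σ' hag hi hinv
      obtain ⟨h2, h3⟩ := hx k hk σ' (hag₁.seq_left.trans hag.seq_right) hi
      refine (Runs.simple rfl ?_ ?_).time_le ?_
      · simpa only [Cmd.SpanLe, RealExp.span, Nat.zero_max] using h3
      · simp only [Cmd.sem, RealExp.eval, h2, Function.update_self, hinv, Finset.sum_range_succ]
      · simp only [Cmd.budget, RealExp.cost]
        omega
    · simp only [NatExp.cost]
      have : 1 + (x.cost + 3) + 7 = x.cost + 11 := by omega
      rw [this]
  · simp only [Cmd.budget, RealExp.cost]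
    omega

/-- The squared distance of the current point from the vector in the array `A`. -/
def distCmd (A : Fin 9) : Code :=
  sumCmd xA (.mul (.sub (.item (.reg rI)) (.arr A (.reg rI)))
    (.sub (.item (.reg rI)) (.arr A (.reg rI))))

lemma runs_distCmd (A : Fin 9) (hd : 0 < d) (hm : d ≤ m) :
    Runs I (distCmd A) σ (40 * d) m
      fun σ' => σ'.real xA = ‖σ.item - vecAt (σ.arr A) 0‖ ^ 2 := by
  refine ((runs_sumCmd (I := I) (σ := σ) (m := m) xA _ (fun i => (coord σ.item i - σ.arr A (0 + i))
    * (coord σ.item i - σ.arr A (0 + i))) ?_).weaken fun σ' _ h => ?_).time_le ?_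
  · intro k hk σ' hag hi
    have h1 := hag.item rfl
    have h2 := hag.arr A rfl
    constructor
    · simp only [RealExp.eval, NatExp.eval, hi, h1, h2, coord, Nat.zero_add]
    · simp only [RealExp.span, NatExp.eval, hi]
      simp
      omega
  · rw [h, norm_sub_vecAt_sq]
  · simp only [RealExp.cost, NatExp.cost]
    omega

/-- The projection of the current point on the direction of filter number `rK`, centred at the
centre of the filter. -/
def dotCmd : Code :=
  sumCmd xA (.mul (.arr aDir (.add (.mul (.reg rK) .dim) (.reg rI)))
    (.sub (.item (.reg rI)) (.arr aCen (.add (.mul (.reg rK) .dim) (.reg rI)))))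

/-- The direction of filter number `t`. -/
def dirAt (σ : St d) (t : ℕ) : Pt d := vecAt (σ.arr aDir) (t * d)

/-- The centre of filter number `t`. -/
def cenAt (σ : St d) (t : ℕ) : Pt d := vecAt (σ.arr aCen) (t * d)

lemma block_le {t M d m : ℕ} (ht : t ≤ M) (hm : (M + 1) * d ≤ m) : t * d + d ≤ m := by
  have : (t + 1) * d ≤ (M + 1) * d := Nat.mul_le_mul_right _ (by omega)
  rw [Nat.add_mul, Nat.one_mul] at this
  omega

lemma runs_dotCmd {t M : ℕ} (hd : 0 < d) (hK : σ.nat rK = t) (ht : t ≤ M)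
    (hm : (M + 1) * d ≤ m) :
    Runs I dotCmd σ (50 * d) m
      fun σ' => σ'.real xA = ⟪dirAt σ t, σ.item - cenAt σ t⟫_ℝ := by
  have hb := block_le ht hm
  refine ((runs_sumCmd (I := I) (σ := σ) (m := m) xA _ (fun i => σ.arr aDir (t * d + i)
    * (coord σ.item i - σ.arr aCen (t * d + i))) ?_).weaken fun σ' _ h => ?_).time_le ?_
  · intro k hk σ' hag hi
    have h1 := hag.item rfl
    have h2 := hag.arr aDir rfl
    have h3 := hag.arr aCen rfl
    have h4 := (hag.nat rK rfl).trans hK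
    constructor
    · simp only [RealExp.eval, NatExp.eval, hi, h1, h2, h3, h4, coord]
    · simp only [RealExp.span, NatExp.eval, hi, h4]
      simp
      omega
  · rw [h, inner_vecAt, dirAt, cenAt]
  · simp only [RealExp.cost, NatExp.cost]
    omega

/-- The weight of a point after the first `t` filters. -/
def weightAt (c : Pt d) (r : ℝ) (cen dir : ℕ → Pt d) (thr sz : ℕ → ℝ) (x : Pt d) : ℕ → ℝ
  | 0 => if r < ‖x - c‖ ^ 2 then 0 else 1
  | t + 1 => weightAt c r cen dir thr sz x t / (1 + sz t * excess (dir t) (cen t) (thr t) x)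

/-- The weight of a point after the first `t` filters stored in a state. -/
def weightOf (σ : St d) (x : Pt d) (t : ℕ) : ℝ :=
  weightAt (vecAt (σ.arr aC0) 0) (16 * σ.real xR) (cenAt σ) (dirAt σ) (σ.arr aThr) (σ.arr aSz) x t

/-- Compute the weight of the current point after the first `rT` filters. -/
def weightCmd : Code :=
  .seq (distCmd aC0)
    (.seq (.ite (.realLt (.mul (.lit 16) (.reg xR)) (.reg xA)) (.setReal xW (.lit 0))
        (.setReal xW (.lit 1)))
      (.forLoop rK (.reg rT)
        (.seq dotCmd
          (.seq (.setReal xT (.sub (.mul (.reg xA) (.reg xA)) (.arr aThr (.reg rK))))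
            (.ite (.realLt (.lit 0) (.reg xT))
              (.setReal xW (.div (.reg xW) (.add (.lit 1) (.mul (.arr aSz (.reg rK)) (.reg xT)))))
              .skip)))))

lemma Agree.weightOf_eq {p : Code} {σ σ' : St d} (h : Agree p σ σ') (hC : p.writesArr aC0 = false)
    (h0 : p.writesArr aCen = false) (h1 : p.writesArr aDir = false) (h2 : p.writesArr aThr = false)
    (h3 : p.writesArr aSz = false) (hR : p.writesReal xR = false) (x : Pt d) (t : ℕ) :
    weightOf σ' x t = weightOf σ x t := by
  have e1 : cenAt σ' = cenAt σ := by ext1 t; rw [cenAt, cenAt, h.arr _ h0]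
  have e2 : dirAt σ' = dirAt σ := by ext1 t; rw [dirAt, dirAt, h.arr _ h1]
  rw [weightOf, weightOf, e1, e2, h.arr _ hC, h.arr _ h2, h.arr _ h3, h.real _ hR]

/-- The weight is recomputed from all stored filters. This replaces a memory of size `n` by a factor
of the number of filters in the time per point; on exit `rK` points to filter `t`, the one under
construction. -/
lemma runs_weightCmd {t M : ℕ} (hd : 0 < d) (hT : σ.nat rT = t) (ht : t ≤ M)
    (hm : (M + 1) * d ≤ m) :
    Runs I weightCmd σ (200 * (d * (M + 1))) m
      fun σ' => σ'.nat rK = t ∧ σ'.real xW = weightOf σ σ.item t := by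
  have hdm : d ≤ m := by have := block_le (Nat.zero_le M) hm; omega
  have hM1 : M + 1 ≤ m := le_trans (Nat.le_mul_of_pos_right _ hd) hm
  refine (Runs.seq (runs_distCmd aC0 hd hdm) (t₂ := 20 + (t * (50 * d + 40) + 20))
    fun σ₁ hag₁ h₁ => ?_).time_le ?_
  swap
  · have h1 : d * 1 ≤ d * (M + 1) := Nat.mul_le_mul_left _ (by omega)
    have h2 : t * (50 * d + 40) ≤ (M + 1) * (90 * d) := Nat.mul_le_mul (by omega) (by omega)
    have h3 : (M + 1) * (90 * d) = 90 * (d * (M + 1)) := by ring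
    omega
  refine Runs.seq (Q' := fun σ' => σ'.real xW = weightOf σ σ.item 0)
    ((Runs.simple rfl ?_ ?_).time_le ?_) fun σ₂ hag₂ h₂ => ?_
  · simp [Cmd.SpanLe, BoolExp.span, RealExp.span]
  · have hR := hag₁.real xR rfl
    simp only [Cmd.sem, BoolExp.Holds, RealExp.eval, h₁, hR, weightOf, weightAt, Rat.cast_ofNat]
    split_ifs <;> simp
  · simp [Cmd.budget, BoolExp.cost, RealExp.cost]
  have hag : Agree weightCmd σ σ₂ := hag₁.seq_left.trans hag₂.seq_left.seq_right
  refine (Runs.forLoop (t := 50 * d + 32) t (fun k σ' => σ'.real xW = weightOf σ σ.item k) rfl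
    ?_ ?_ ?_).time_le ?_
  · intro σ' hag'
    exact (hag'.nat rT rfl).trans ((hag.nat rT rfl).trans hT)
  · simpa using h₂
  · intro k hk σ' hag' hk' hinv
    have hag3 : Agree weightCmd σ σ' := hag.trans hag'.seq_right.seq_right
    have hkM : k ≤ M := by omega
    refine Runs.seq (runs_dotCmd hd hk' hkM hm) fun σ₃ hag₃ h₃ => ?_
    have hag4 : Agree weightCmd σ σ₃ := hag3.trans
      hag₃.seq_left.seq_left.loop.seq_right.seq_right.seq_right
    have hw3 : σ₃.real xW = weightOf σ σ.item k := (hag₃.real xW rfl).trans hinv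
    have hK3 : σ₃.nat rK = k := (hag₃.nat rK rfl).trans hk'
    have hthr := hag4.arr aThr rfl
    have hsz := hag4.arr aSz rfl
    have hx : σ₃.real xA = ⟪dirAt σ k, σ.item - cenAt σ k⟫_ℝ := by
      rw [h₃, dirAt, dirAt, cenAt, cenAt, hag3.arr aDir rfl, hag3.arr aCen rfl, hag3.item rfl]
    refine (Runs.simple rfl ?_ ?_).time_le ?_
    · simp [Cmd.SpanLe, BoolExp.span, RealExp.span, NatExp.eval, Cmd.sem, hK3]
      have : k + 1 ≤ m := by omega
      tauto
    · simp only [Cmd.sem, BoolExp.Holds, RealExp.eval, NatExp.eval, hx, hthr, hsz, hK3, weightOf,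
        weightAt, excess, Function.update_self]
      split_ifs with hpos
      · rw [max_eq_right (by simpa [sq] using hpos.le)]
        simp [hw3, sq, weightOf]
      · rw [max_eq_left (by simpa [sq] using hpos)]
        simp [hw3, weightOf]
    · simp [Cmd.budget, BoolExp.cost, RealExp.cost, NatExp.cost]
  · simp only [NatExp.cost]
    have : 1 + (50 * d + 32) + 7 = 50 * d + 40 := by omega
    rw [this]
    omega

end Specs

end StreamRAM

/-! ### The statistics gathered in one pass. -/

namespace StreamRAM

open RobustMean

/-- Add the contribution of the current point to the statistics of the current pass. -/
def pointCmd : Code :=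
  .seq weightCmd (.seq dotCmd (.seq
    (.seq
      (.seq (.setReal xT (.sub (.mul (.reg xA) (.reg xA)) (.arr aThr (.reg rK))))
        (.ite (.realLt (.lit 0) (.reg xT)) .skip (.setReal xT (.lit 0))))
      (.seq (.setReal xS (.add (.reg xS) (.reg xW)))
        (.seq (.setReal xM (.add (.reg xM) (.mul (.reg xW) (.mul (.reg xA) (.reg xA)))))
          (.setReal xF (.add (.reg xF) (.div (.mul (.reg xW) (.reg xT))
            (.add (.lit 1) (.mul (.arr aSz (.reg rK)) (.reg xT)))))))))
    (.seq
      (vecCmd aSum (.lit 0) (.add (.arr aSum (.reg rI)) (.mul (.reg xW) (.item (.reg rI)))))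
      (vecCmd aMom (.lit 0) (.add (.arr aMom (.reg rI)) (.mul (.mul (.reg xW) (.reg xA))
        (.sub (.item (.reg rI)) (.arr aCen (.add (.mul (.reg rK) .dim) (.reg rI))))))))))

/-- Collect the statistics of the filtered points in one pass. -/
def passCmd : Code :=
  .seq (.seq (.setReal xS (.lit 0)) (.seq (.setReal xM (.lit 0)) (.setReal xF (.lit 0))))
    (.seq (vecCmd aSum (.lit 0) (.lit 0))
      (.seq (vecCmd aMom (.lit 0) (.lit 0)) (.forStream pointCmd)))

section Specs

variable {d n : ℕ} {I : Input d n} {σ : St d} {m : ℕ}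

lemma vecAt_fill_add (f g : ℕ → ℝ) (y : Pt d) (hg : ∀ i : Fin d, g i = f i + y i) :
    (vecAt (fill f 0 g d) 0 : Pt d) = vecAt f 0 + y := by
  rw [vecAt_fill]
  ext i
  simp [hg]

lemma runs_pointCmd {t M : ℕ} (hd : 0 < d) (hT : σ.nat rT = t) (ht : t ≤ M)
    (hm : (M + 1) * d ≤ m) :
    Runs I pointCmd σ (400 * (d * (M + 1))) m fun σ' =>
      σ'.real xS = σ.real xS + weightOf σ σ.item t ∧
      σ'.real xM = σ.real xM + weightOf σ σ.item t * ⟪dirAt σ t, σ.item - cenAt σ t⟫_ℝ ^ 2 ∧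
      σ'.real xF = σ.real xF + weightOf σ σ.item t *
        excess (dirAt σ t) (cenAt σ t) (σ.arr aThr t) σ.item /
          (1 + σ.arr aSz t * excess (dirAt σ t) (cenAt σ t) (σ.arr aThr t) σ.item) ∧
      (vecAt (σ'.arr aSum) 0 : Pt d) = vecAt (σ.arr aSum) 0 + weightOf σ σ.item t • σ.item ∧
      (vecAt (σ'.arr aMom) 0 : Pt d) = vecAt (σ.arr aMom) 0 +
        (weightOf σ σ.item t * ⟪dirAt σ t, σ.item - cenAt σ t⟫_ℝ) • (σ.item - cenAt σ t) := by
  have hb := block_le ht hm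
  have hdm : d ≤ m := by omega
  have htm : t + 1 ≤ m := by
    have := Nat.le_mul_of_pos_right (M + 1) hd
    omega
  refine (Runs.seq (runs_weightCmd hd hT ht hm) (t₂ := 50 * d + (50 + ((d * 20 + 6) +
    (d * 30 + 6)))) fun σ₁ hag₁ h₁ => ?_).time_le ?_
  swap
  · have h1 : d * 1 ≤ d * (M + 1) := Nat.mul_le_mul_left _ (by omega)
    omega
  obtain ⟨hK₁, hW₁⟩ := h₁
  refine Runs.seq (runs_dotCmd hd hK₁ ht hm) fun σ₂ hag₂ h₂ => ?_
  have hag : Agree pointCmd σ σ₂ := hag₁.seq_left.trans hag₂.seq_left.seq_right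
  set w := weightOf σ σ.item t with hw
  set p := ⟪dirAt σ t, σ.item - cenAt σ t⟫_ℝ with hp
  set e := excess (dirAt σ t) (cenAt σ t) (σ.arr aThr t) σ.item with he
  have hx : σ₂.real xA = p := by
    rw [h₂, dirAt, cenAt, hag₁.arr aDir rfl, hag₁.arr aCen rfl, hag₁.item rfl]; rfl
  have hW₂ : σ₂.real xW = w := (hag₂.real xW rfl).trans hW₁
  have hK₂ : σ₂.nat rK = t := (hag₂.nat rK rfl).trans hK₁
  have hthr : σ₂.arr aThr = σ.arr aThr := hag.arr aThr rfl
  have hsz : σ₂.arr aSz = σ.arr aSz := hag.arr aSz rfl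
  have hS₂ : σ₂.real xS = σ.real xS := (hag₂.real xS rfl).trans (hag₁.real xS rfl)
  have hM₂ : σ₂.real xM = σ.real xM := (hag₂.real xM rfl).trans (hag₁.real xM rfl)
  have hF₂ : σ₂.real xF = σ.real xF := (hag₂.real xF rfl).trans (hag₁.real xF rfl)
  have hsum : σ₂.arr aSum = σ.arr aSum := (hag₂.arr aSum rfl).trans (hag₁.arr aSum rfl)
  have hmom : σ₂.arr aMom = σ.arr aMom := (hag₂.arr aMom rfl).trans (hag₁.arr aMom rfl)
  have hcen : σ₂.arr aCen = σ.arr aCen := hag.arr aCen rfl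
  have hit : σ₂.item = σ.item := hag.item rfl
  refine Runs.seq (Q' := fun σ' => σ'.real xS = σ.real xS + w ∧ σ'.real xM = σ.real xM + w * p ^ 2 ∧
    σ'.real xF = σ.real xF + w * e / (1 + σ.arr aSz t * e))
    ((Runs.seq (Q' := fun σ' => σ'.real xT = e) (Runs.simple rfl ?_ ?_)
      fun σ' hag' h' => Runs.simple rfl ?_ ?_).time_le ?_) fun σ₃ hag₃ h₃ => ?_
  · simp [Cmd.SpanLe, BoolExp.span, RealExp.span, NatExp.eval, Cmd.sem, hK₂]
    omega
  · simp only [Cmd.sem, BoolExp.Holds, RealExp.eval, NatExp.eval, hx, hthr, hK₂,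
      Function.update_self]
    have he' : e = max 0 (p * p - σ.arr aThr t) := by rw [he, excess, ← hp, sq]
    split_ifs with hpos
    · rw [he', max_eq_right (by simpa using hpos.le)]
      simp
    · rw [he', max_eq_left (by simpa using hpos)]
      simp
  · have hK' := (hag'.nat rK rfl).trans hK₂
    simp [Cmd.SpanLe, RealExp.span, NatExp.eval, Cmd.sem, hK']
    omega
  · have hK' := (hag'.nat rK rfl).trans hK₂
    simp only [rT, rK, xS, xW, xM, xF, xA, xT, aSz] at *
    simp [Cmd.sem, RealExp.eval, NatExp.eval, hK', h', (hag'.real 3 rfl).trans hS₂,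
      (hag'.real 4 rfl).trans hM₂, (hag'.real 5 rfl).trans hF₂, (hag'.real 1 rfl).trans hW₂,
      (hag'.real 2 rfl).trans hx, (hag'.arr 3 rfl).trans hsz, sq]
  · simp [Cmd.budget, BoolExp.cost, RealExp.cost, NatExp.cost]
  have hW₃ : σ₃.real xW = w := (hag₃.real xW rfl).trans hW₂
  have hx₃ : σ₃.real xA = p := (hag₃.real xA rfl).trans hx
  have hK₃ : σ₃.nat rK = t := (hag₃.nat rK rfl).trans hK₂
  have hsum₃ : σ₃.arr aSum = σ.arr aSum := (hag₃.arr aSum rfl).trans hsum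
  have hmom₃ : σ₃.arr aMom = σ.arr aMom := (hag₃.arr aMom rfl).trans hmom
  have hcen₃ : σ₃.arr aCen = σ.arr aCen := (hag₃.arr aCen rfl).trans hcen
  have hit₃ : σ₃.item = σ.item := (hag₃.item rfl).trans hit
  refine Runs.seq ((runs_vecCmd (I := I) aSum _ _ 0 (fun i => σ.arr aSum i + w * coord σ.item i)
    (by omega) ?_).time_le ?_) fun σ₄ hag₄ h₄ => ?_
  · intro k hk σ' hag' hi harr
    have hA : σ'.arr aSum k = σ.arr aSum k := by
      rw [harr, hsum₃]
      simpa using fill_apply_add (σ.arr aSum) 0 (fun i => σ.arr aSum i + w * coord σ.item i) k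
    refine ⟨rfl, ?_, ?_⟩
    · simp only [RealExp.eval, NatExp.eval, hi, hA, (hag'.real xW rfl).trans hW₃,
        (hag'.item rfl).trans hit₃, coord]
    · simp only [RealExp.span, NatExp.eval, hi]
      simp
      omega
  · simp only [RealExp.cost, NatExp.cost]
    omega
  refine ((runs_vecCmd (I := I) aMom _ _ 0
    (fun i => σ.arr aMom i + w * p * (coord σ.item i - σ.arr aCen (t * d + i)))
    (by omega) ?_).weaken fun σ₅ hag₅ h₅ => ?_).time_le ?_
  · intro k hk σ' hag' hi harr
    have hA : σ'.arr aMom k = σ.arr aMom k := by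
      rw [harr, (hag₄.arr aMom rfl).trans hmom₃]
      simpa using fill_apply_add (σ.arr aMom) 0
        (fun i => σ.arr aMom i + w * p * (coord σ.item i - σ.arr aCen (t * d + i))) k
    have hK' : σ'.nat rK = t := (hag'.nat rK rfl).trans ((hag₄.nat rK rfl).trans hK₃)
    refine ⟨rfl, ?_, ?_⟩
    · simp only [RealExp.eval, NatExp.eval, hi, hA, hK',
        (hag'.real xW rfl).trans ((hag₄.real xW rfl).trans hW₃),
        (hag'.real xA rfl).trans ((hag₄.real xA rfl).trans hx₃),
        (hag'.arr aCen rfl).trans ((hag₄.arr aCen rfl).trans hcen₃),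
        (hag'.item rfl).trans ((hag₄.item rfl).trans hit₃), coord]
    · simp only [RealExp.span, NatExp.eval, hi, hK']
      simp
      omega
  · refine ⟨?_, ?_, ?_, ?_, ?_⟩
    · rw [hag₅.real xS rfl, hag₄.real xS rfl, h₃.1]
    · rw [hag₅.real xM rfl, hag₄.real xM rfl, h₃.2.1]
    · rw [hag₅.real xF rfl, hag₄.real xF rfl, h₃.2.2]
    · rw [hag₅.arr aSum rfl, h₄, hsum₃]
      exact vecAt_fill_add _ _ _ fun i => by simp
    · rw [h₅, (hag₄.arr aMom rfl).trans hmom₃]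
      exact vecAt_fill_add _ _ _ fun i => by simp [cenAt]
  · simp only [RealExp.cost, NatExp.cost]
    omega

/-- The statistics in the state `σ'` are those of the points `x` with weights, centre, direction,
threshold and step size number `t` taken from the state `σ`. -/
structure Stats (σ : St d) (x : Fin n → Pt d) (t : ℕ) (σ' : St d) : Prop where
  total : σ'.real xS = ∑ i, weightOf σ (x i) t
  moment : σ'.real xM = ∑ i, weightOf σ (x i) t * ⟪dirAt σ t, x i - cenAt σ t⟫_ℝ ^ 2
  left : σ'.real xF = ∑ i, weightOf σ (x i) t *
    excess (dirAt σ t) (cenAt σ t) (σ.arr aThr t) (x i) /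
      (1 + σ.arr aSz t * excess (dirAt σ t) (cenAt σ t) (σ.arr aThr t) (x i))
  sum : (vecAt (σ'.arr aSum) 0 : Pt d) = ∑ i, weightOf σ (x i) t • x i
  apply : (vecAt (σ'.arr aMom) 0 : Pt d) =
    ∑ i, (weightOf σ (x i) t * ⟪dirAt σ t, x i - cenAt σ t⟫_ℝ) • (x i - cenAt σ t)

/-- All statistics are sums over the points, so the arrangement of the stream in a pass is
irrelevant to them. -/
lemma Stats.perm {x : Fin n → Pt d} {t : ℕ} {σ' : St d} (π : Equiv.Perm (Fin n))
    (h : Stats σ (fun i => x (π i)) t σ') : Stats σ x t σ' where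
  total := h.total.trans (Equiv.sum_comp π fun i => weightOf σ (x i) t)
  moment := h.moment.trans
    (Equiv.sum_comp π fun i => weightOf σ (x i) t * ⟪dirAt σ t, x i - cenAt σ t⟫_ℝ ^ 2)
  left := h.left.trans (Equiv.sum_comp π fun i => weightOf σ (x i) t *
    excess (dirAt σ t) (cenAt σ t) (σ.arr aThr t) (x i) /
      (1 + σ.arr aSz t * excess (dirAt σ t) (cenAt σ t) (σ.arr aThr t) (x i)))
  sum := h.sum.trans (Equiv.sum_comp π fun i => weightOf σ (x i) t • x i)
  apply := h.apply.trans (Equiv.sum_comp π fun i =>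
    (weightOf σ (x i) t * ⟪dirAt σ t, x i - cenAt σ t⟫_ℝ) • (x i - cenAt σ t))

lemma vecAt_fill_const_zero (f : ℕ → ℝ) : (vecAt (fill f 0 (fun _ => 0) d) 0 : Pt d) = 0 := by
  rw [vecAt_fill]
  ext i
  simp

lemma runs_passCmd {t M : ℕ} (hd : 0 < d) (hn : 0 < n) (hpos : σ.pos = 0) (hT : σ.nat rT = t)
    (ht : t ≤ M) (hm : (M + 1) * d ≤ m) :
    Runs I passCmd σ (500 * (n * (d * (M + 1)))) m fun σ' =>
      σ'.pos = 0 ∧ σ'.pass = σ.pass + 1 ∧ Stats σ (I.stream σ.pass) t σ' := by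
  have hdm : d ≤ m := by have := block_le (Nat.zero_le M) hm; omega
  refine (Runs.seq (Q' := fun σ' => σ'.real xS = 0 ∧ σ'.real xM = 0 ∧ σ'.real xF = 0)
    (Runs.simple rfl ?_ ?_) (t₂ := (d * 13 + 6) + ((d * 13 + 6) +
      (n * (400 * (d * (M + 1)) + d + 4) + 4))) fun σ₁ hag₁ h₁ => ?_).time_le ?_
  · simp [Cmd.SpanLe, RealExp.span]
  · simp [Cmd.sem, RealExp.eval]
  swap
  · have h1 : d * 1 ≤ d * (M + 1) := Nat.mul_le_mul_left _ (by omega)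
    have h2 : 1 * (d * (M + 1)) ≤ n * (d * (M + 1)) := Nat.mul_le_mul_right _ hn
    have h3 : n * (400 * (d * (M + 1)) + d + 4) ≤ n * (405 * (d * (M + 1))) :=
      Nat.mul_le_mul_left _ (by omega)
    have h4 : n * (405 * (d * (M + 1))) = 405 * (n * (d * (M + 1))) := by ring
    simp only [Cmd.budget, RealExp.cost]
    omega
  refine Runs.seq ((runs_vecCmd (I := I) aSum _ _ 0 (fun _ => 0) (by omega) ?_).time_le ?_)
    fun σ₂ hag₂ h₂ => ?_
  · intro k hk σ' hag' hi harr
    simp [NatExp.eval, RealExp.eval, RealExp.span]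
  · simp [NatExp.cost, RealExp.cost]
  refine Runs.seq ((runs_vecCmd (I := I) aMom _ _ 0 (fun _ => 0) (by omega) ?_).time_le ?_)
    fun σ₃ hag₃ h₃ => ?_
  · intro k hk σ' hag' hi harr
    simp [NatExp.eval, RealExp.eval, RealExp.span]
  · simp [NatExp.cost, RealExp.cost]
  have hag : Agree passCmd σ σ₃ := hag₁.seq_left.trans
    (hag₂.seq_left.seq_right.trans hag₃.seq_left.seq_right.seq_right)
  have hpos₃ : σ₃.pos = 0 := by
    rw [hag₃.pos rfl, hag₂.pos rfl, hag₁.pos rfl, hpos]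
  have hpass₃ : σ₃.pass = σ.pass := by
    rw [hag₃.pass rfl, hag₂.pass rfl, hag₁.pass rfl]
  set x := I.stream σ.pass with hx
  refine (Runs.forStream (fun k σ' =>
      σ'.real xS = partialSum (fun i => weightOf σ (x i) t) k ∧
      σ'.real xM = partialSum (fun i =>
        weightOf σ (x i) t * ⟪dirAt σ t, x i - cenAt σ t⟫_ℝ ^ 2) k ∧
      σ'.real xF = partialSum (fun i => weightOf σ (x i) t *
        excess (dirAt σ t) (cenAt σ t) (σ.arr aThr t) (x i) /
          (1 + σ.arr aSz t * excess (dirAt σ t) (cenAt σ t) (σ.arr aThr t) (x i))) k ∧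
      (vecAt (σ'.arr aSum) 0 : Pt d) = partialSum (fun i => weightOf σ (x i) t • x i) k ∧
      (vecAt (σ'.arr aMom) 0 : Pt d) = partialSum (fun i =>
        (weightOf σ (x i) t * ⟪dirAt σ t, x i - cenAt σ t⟫_ℝ) • (x i - cenAt σ t)) k)
    rfl hpos₃ ?_ ?_).weaken ?_
  · simp only [partialSum_zero]
    refine ⟨?_, ?_, ?_, ?_, ?_⟩
    · rw [hag₃.real xS rfl, hag₂.real xS rfl, h₁.1]
    · rw [hag₃.real xM rfl, hag₂.real xM rfl, h₁.2.1]
    · rw [hag₃.real xF rfl, hag₂.real xF rfl, h₁.2.2]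
    · rw [hag₃.arr aSum rfl, h₂, vecAt_fill_const_zero]
    · rw [h₃, vecAt_fill_const_zero]
  · rintro k hk σ' hag' - ⟨e1, e2, e3, e4, e5⟩
    have hag4 : Agree passCmd σ σ' := hag.trans hag'.seq_right.seq_right.seq_right
    rw [hpass₃]
    refine (runs_pointCmd (σ := { σ' with item := x ⟨k, hk⟩, pos := k + 1 }) (t := t) hd
      ((hag4.nat rT rfl).trans hT) ht hm).weaken fun σ'' _ h => ?_
    have w1 : weightOf { σ' with item := x ⟨k, hk⟩, pos := k + 1 } (x ⟨k, hk⟩) t =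
        weightOf σ (x ⟨k, hk⟩) t :=
      hag4.weightOf_eq rfl rfl rfl rfl rfl rfl _ _
    have w2 : dirAt { σ' with item := x ⟨k, hk⟩, pos := k + 1 } t = dirAt σ t := by
      simp only [dirAt, hag4.arr aDir rfl]
    have w3 : cenAt { σ' with item := x ⟨k, hk⟩, pos := k + 1 } t = cenAt σ t := by
      simp only [cenAt, hag4.arr aCen rfl]
    simp only [w1, w2, w3, e1, e2, e3, e4, e5, hag4.arr aThr rfl, hag4.arr aSz rfl] at h
    simpa only [partialSum_succ _ hk] using h
  · rintro σ' - ⟨σ'', h, rfl⟩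
    simp only [partialSum_self] at h
    exact ⟨rfl, by simp only [hpass₃], h.1, h.2.1, h.2.2.1, h.2.2.2.1, h.2.2.2.2⟩

end Specs

end StreamRAM

/-! ### Computing one filter. -/

namespace StreamRAM

open RobustMean

/-- The first address of the block of the current round. -/
abbrev blockExp : NExp := .mul (.reg rT) .dim

/-- The address of coordinate `rI` in the block of the current round. -/
abbrev cellExp : NExp := .add blockExp (.reg rI)

/-- Make the weighted mean the centre of the current filter. -/
def meanCmd : Code :=
  .seq passCmd (vecCmd aCen blockExp (.div (.arr aSum (.reg rI)) (.reg xS)))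

/-- Make a random sign vector the direction of the current filter. -/
def signCmd : Code :=
  .forLoop rI .dim (.seq (.flip rB)
    (.setArr aDir cellExp (.sub (.mul (.lit 2) (.ofNat (.reg rB))) (.lit 1))))

/-- Apply the deviation operator to the direction `rL` times. -/
def powerCmd : Code :=
  .forLoop rQ (.reg rL) (.seq passCmd
    (vecCmd aDir blockExp (.sub (.div (.arr aMom (.reg rI)) (.ofNat (.reg rN)))
      (.mul (.reg xL) (.arr aDir cellExp)))))

/-- Compute the threshold, the score bound and the first step size of the current filter. -/
def scoreCmd : Code :=
  .seq (sumCmd xV (.mul (.arr aDir cellExp) (.arr aDir cellExp)))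
    (.seq (.seq (.setArr aThr (.reg rT) (.mul (.mul (.lit 8) (.div (.reg xD) .eps)) (.reg xV)))
        (.setArr aSz (.reg rT) (.lit 0)))
      (.seq passCmd
        (.seq (.setReal xB (.add (.mul (.mul (.lit 7) (.reg xD)) (.reg xV))
            (.mul (.mul (.lit 16) .eps)
              (.sub (.div (.reg xM) (.ofNat (.reg rN))) (.mul (.reg xL) (.reg xV))))))
          (.ite (.realLt (.mul (.mul (.lit 4) (.ofNat (.reg rN))) (.reg xB)) (.reg xF))
            (.setArr aSz (.reg rT) (.div (.lit 1) (.mul (.lit 4) (.reg xB)))) .skip))))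

/-- Halve the step size of the current filter as long as too little score is left. -/
def halveCmd : Code :=
  .forLoop rQ (.reg rL) (.seq passCmd
    (.ite (.realLt (.reg xF) (.mul (.mul (.lit 2) (.ofNat (.reg rN))) (.reg xB)))
      (.setArr aSz (.reg rT) (.div (.arr aSz (.reg rT)) (.lit 2))) .skip))

/-- Compute one filter. -/
def roundCmd : Code :=
  .seq meanCmd (.seq signCmd (.seq powerCmd (.seq scoreCmd halveCmd)))

section Specs

variable {d n : ℕ}

/-- Weights in round `t` depend only on filters before `t`. Block `t` is thus free as a workspace
while its centre, direction and step size are being built. -/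
lemma weightAt_congr {c : Pt d} {r : ℝ} {cen cen' dir dir' : ℕ → Pt d} {thr thr' sz sz' : ℕ → ℝ}
    {t : ℕ} (h1 : ∀ s < t, cen' s = cen s) (h2 : ∀ s < t, dir' s = dir s)
    (h3 : ∀ s < t, thr' s = thr s) (h4 : ∀ s < t, sz' s = sz s) (x : Pt d) :
    weightAt c r cen' dir' thr' sz' x t = weightAt c r cen dir thr sz x t := by
  induction t with
  | zero => rfl
  | succ t ih =>
    rw [weightAt, weightAt, ih (fun s hs => h1 s (by omega)) (fun s hs => h2 s (by omega))
      (fun s hs => h3 s (by omega)) (fun s hs => h4 s (by omega)), h1 t (by omega),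
      h2 t (by omega), h3 t (by omega), h4 t (by omega)]

/-- The state at the beginning of a pass in round `t`, when the weights of the points `S` are `ω`. -/
structure Ready (S : Fin n → Pt d) (ℓ : ℕ) (Δ : ℝ) (t : ℕ) (ω : Fin n → ℝ) (σ : St d) : Prop where
  count : σ.nat rN = n
  power : σ.nat rL = ℓ
  round : σ.nat rT = t
  delta : σ.real xD = Δ
  shift : σ.real xL = max 0 (1 - 5 * Δ)
  pos : σ.pos = 0
  weights : ∀ i, weightOf σ (S i) t = ω i

variable {I : Input d n} {S : Fin n → Pt d} {π : ℕ → Equiv.Perm (Fin n)} {ℓ : ℕ} {Δ : ℝ} {t : ℕ}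
  {ω : Fin n → ℝ} {σ σ' : St d} {M m : ℕ}

lemma Ready.of_agree {p : Code} (h : Ready S ℓ Δ t ω σ) (hag : Agree p σ σ')
    (hnat : p.writesNat rN = false ∧ p.writesNat rL = false ∧ p.writesNat rT = false)
    (hreal : p.writesReal xD = false ∧ p.writesReal xL = false ∧ p.writesReal xR = false)
    (hC : p.writesArr aC0 = false) (hpos : σ'.pos = 0)
    (hcen : ∀ s < t, cenAt σ' s = cenAt σ s) (hdir : ∀ s < t, dirAt σ' s = dirAt σ s)
    (hthr : ∀ s < t, σ'.arr aThr s = σ.arr aThr s) (hsz : ∀ s < t, σ'.arr aSz s = σ.arr aSz s) :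
    Ready S ℓ Δ t ω σ' where
  count := (hag.nat _ hnat.1).trans h.count
  power := (hag.nat _ hnat.2.1).trans h.power
  round := (hag.nat _ hnat.2.2).trans h.round
  delta := (hag.real _ hreal.1).trans h.delta
  shift := (hag.real _ hreal.2.1).trans h.shift
  pos := hpos
  weights i := by
    rw [← h.weights i, weightOf, weightOf, hag.arr _ hC, hag.real _ hreal.2.2]
    exact weightAt_congr hcen hdir hthr hsz _

lemma Ready.update_nat (h : Ready S ℓ Δ t ω σ) {r : Fin 12} (hr : r ≠ rN ∧ r ≠ rL ∧ r ≠ rT)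
    (k : ℕ) : Ready S ℓ Δ t ω { σ with nat := Function.update σ.nat r k } where
  count := (Function.update_of_ne hr.1.symm _ _).trans h.count
  power := (Function.update_of_ne hr.2.1.symm _ _).trans h.power
  round := (Function.update_of_ne hr.2.2.symm _ _).trans h.round
  delta := h.delta
  shift := h.shift
  pos := h.pos
  weights := h.weights

lemma Agree.cenAt_eq {p : Code} (h : Agree p σ σ') (hp : p.writesArr aCen = false) (s : ℕ) :
    cenAt σ' s = cenAt σ s := by rw [cenAt, cenAt, h.arr _ hp]

lemma Agree.dirAt_eq {p : Code} (h : Agree p σ σ') (hp : p.writesArr aDir = false) (s : ℕ) :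
    dirAt σ' s = dirAt σ s := by rw [dirAt, dirAt, h.arr _ hp]

lemma runs_passCmd_ready (hI : ∀ p i, I.stream p i = S (π p i)) (hd : 0 < d) (hn : 0 < n)
    (ht : t ≤ M) (hm : (M + 1) * d ≤ m) (h : Ready S ℓ Δ t ω σ) :
    Runs I passCmd σ (500 * (n * (d * (M + 1)))) m fun σ' =>
      Ready S ℓ Δ t ω σ' ∧ σ'.pass = σ.pass + 1 ∧ Stats σ S t σ' := by
  refine (runs_passCmd hd hn h.pos h.round ht hm).weaken ?_
  rintro σ' hag ⟨h1, h2, h3⟩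
  refine ⟨h.of_agree hag ⟨rfl, rfl, rfl⟩ ⟨rfl, rfl, rfl⟩ rfl h1
    (fun s _ => hag.cenAt_eq rfl s) (fun s _ => hag.dirAt_eq rfl s)
    (fun s _ => by rw [hag.arr aThr rfl]) (fun s _ => by rw [hag.arr aSz rfl]), h2, ?_⟩
  have : I.stream σ.pass = fun i => S (π σ.pass i) := funext fun i => hI _ i
  rw [this] at h3
  exact h3.perm _

lemma Stats.mean_eq (h : Stats σ S t σ') (hω : ∀ i, weightOf σ (S i) t = ω i) :
    (σ'.real xS)⁻¹ • (vecAt (σ'.arr aSum) 0 : Pt d) = wMean S ω := by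
  rw [h.total, h.sum, wMean]
  simp only [hω]

/-- The matrix of `dev` is never formed: the pass accumulates the image of the current direction, so
one pass performs one step of the power method in `O(d)` memory besides the filters. -/
lemma Stats.dev_eq (h : Stats σ S t σ') (hω : ∀ i, weightOf σ (S i) t = ω i)
    (hc : cenAt σ t = wMean S ω) :
    (n : ℝ)⁻¹ • (vecAt (σ'.arr aMom) 0 : Pt d) - max 0 (1 - 5 * Δ) • dirAt σ t
      = dev S Δ ω (dirAt σ t) := by
  rw [h.apply, dev, devOp_apply]
  simp only [hω, hc, real_inner_comm]

lemma Stats.inner_dev_eq (h : Stats σ S t σ') (hn : 0 < n) (hω : ∀ i, weightOf σ (S i) t = ω i)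
    (hc : cenAt σ t = wMean S ω) :
    σ'.real xM / n - max 0 (1 - 5 * Δ) * ‖dirAt σ t‖ ^ 2
      = ⟪dirAt σ t, dev S Δ ω (dirAt σ t)⟫_ℝ := by
  have hn' : (n : ℝ) ≠ 0 := by positivity
  have h1 := inner_devOp hn (max 0 (1 - 5 * Δ)) S ω (dirAt σ t)
  rw [h.moment]
  simp only [hω, hc]
  rw [dev]
  field_simp
  linarith

lemma runs_meanCmd (hI : ∀ p i, I.stream p i = S (π p i)) (hd : 0 < d) (hn : 0 < n) (ht : t ≤ M)
    (hm : (M + 1) * d ≤ m) (h : Ready S ℓ Δ t ω σ) :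
    Runs I meanCmd σ (600 * (n * (d * (M + 1)))) m fun σ' =>
      Ready S ℓ Δ t ω σ' ∧ σ'.pass = σ.pass + 1 ∧ cenAt σ' t = wMean S ω := by
  have hb := block_le ht hm
  refine (Runs.seq (runs_passCmd_ready hI hd hn ht hm h) (t₂ := d * 18 + 6)
    fun σ₁ hag₁ h₁ => ?_).time_le ?_
  · obtain ⟨hr₁, hp₁, hs₁⟩ := h₁
    refine ((runs_vecCmd (I := I) aCen _ _ (t * d) (fun i => σ₁.arr aSum i / σ₁.real xS) hb
      ?_).weaken ?_).time_le ?_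
    · intro k hk σ' hag' hi _
      refine ⟨?_, ?_, ?_⟩
      · simp only [NatExp.eval, hag'.nat rT rfl, hr₁.round]
      · simp only [RealExp.eval, NatExp.eval, hi, hag'.arr aSum rfl, hag'.real xS rfl]
      · simp only [RealExp.span, NatExp.eval, hi]
        simp
        omega
    · intro σ₂ hag₂ h₂
      refine ⟨hr₁.of_agree hag₂ ⟨rfl, rfl, rfl⟩ ⟨rfl, rfl, rfl⟩ rfl ((hag₂.pos rfl).trans hr₁.pos)
        (fun s hs => ?_) (fun s _ => hag₂.dirAt_eq rfl s) (fun s _ => by rw [hag₂.arr aThr rfl])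
        (fun s _ => by rw [hag₂.arr aSz rfl]), by rw [hag₂.pass rfl, hp₁], ?_⟩
      · rw [cenAt, h₂, vecAt_fill_block _ hs, cenAt]
      · rw [cenAt, h₂, vecAt_fill, ← hs₁.mean_eq h.weights]
        ext i
        simp [div_eq_inv_mul]
    · simp only [RealExp.cost, NatExp.cost]
      omega
  · have h1 : d * 1 ≤ d * (M + 1) := Nat.mul_le_mul_left _ (by omega)
    have h2 : 1 * (d * (M + 1)) ≤ n * (d * (M + 1)) := Nat.mul_le_mul_right _ hn
    omega

lemma runs_signCmd (ht : t ≤ M) (hm : (M + 1) * d ≤ m) (h : Ready S ℓ Δ t ω σ) :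
    Runs I signCmd σ (d * 30 + 6) m fun σ' =>
      Ready S ℓ Δ t ω σ' ∧ σ'.coin = σ.coin + d ∧
        dirAt σ' t = signVec fun i => I.coins (σ.coin + i) := by
  have hb := block_le ht hm
  refine ((Runs.forLoop (t := 14) d (fun k σ' => σ'.coin = σ.coin + k ∧ σ'.arr aDir =
    fill (σ.arr aDir) (t * d) (fun i => bitSign (I.coins (σ.coin + i))) k) rfl (fun _ _ => rfl)
    ?_ ?_).weaken ?_).time_le ?_
  · simp [fill_zero]
  · rintro k hk σ₁ hag hi ⟨hc, ha⟩
    have hT : σ₁.nat rT = t := (hag.nat rT rfl).trans h.round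
    simp only [rI, rT] at hi hT
    refine (Runs.simple rfl ?_ ?_).time_le ?_
    · simp [Cmd.SpanLe, RealExp.span, NatExp.eval, Cmd.sem, hT, hi]
      omega
    · simp only [aDir] at ha
      simp only [Cmd.sem, NatExp.eval, RealExp.eval, hc]
      simp [hT, hi, ha, Nat.add_assoc, ← update_fill, bitSign]
    · simp [Cmd.budget, NatExp.cost, RealExp.cost]
  · rintro σ₁ hag ⟨-, hc, ha⟩
    refine ⟨h.of_agree hag ⟨rfl, rfl, rfl⟩ ⟨rfl, rfl, rfl⟩ rfl ((hag.pos rfl).trans h.pos)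
      (fun s _ => hag.cenAt_eq rfl s) (fun s hs => ?_) (fun s _ => by rw [hag.arr aThr rfl])
      (fun s _ => by rw [hag.arr aSz rfl]), hc, ?_⟩
    · rw [dirAt, ha, vecAt_fill_block _ hs, dirAt]
    · rw [dirAt, ha, vecAt_fill, signVec]
  · simp only [NatExp.cost]
    omega

lemma runs_powerCmd (hI : ∀ p i, I.stream p i = S (π p i)) (hd : 0 < d) (hn : 0 < n) (ht : t ≤ M)
    (hm : (M + 1) * d ≤ m) (h : Ready S ℓ Δ t ω σ) (hc : cenAt σ t = wMean S ω) :
    Runs I powerCmd σ (ℓ * (600 * (n * (d * (M + 1)))) + 6) m fun σ' =>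
      Ready S ℓ Δ t ω σ' ∧ σ'.pass = σ.pass + ℓ ∧ dirAt σ' t = powerDir S Δ ℓ ω (dirAt σ t) := by
  have hb := block_le ht hm
  refine ((Runs.forLoop (t := 500 * (n * (d * (M + 1))) + (d * 30 + 6)) ℓ (fun k σ' =>
    Ready S ℓ Δ t ω σ' ∧ σ'.pass = σ.pass + k ∧ dirAt σ' t = powerDir S Δ k ω (dirAt σ t)) rfl
    ?_ ?_ ?_).weaken fun _ _ h => h.2).time_le ?_
  · exact fun σ' hag => (hag.nat rL rfl).trans h.power
  · exact ⟨h.update_nat (by decide) 0, rfl, by simp [powerDir, dirAt]⟩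
  · rintro k hk σ₁ hag - ⟨hr, hp, hv⟩
    refine Runs.seq (runs_passCmd_ready hI hd hn ht hm hr) fun σ₂ hag₂ h₂ => ?_
    obtain ⟨hr₂, hp₂, hs₂⟩ := h₂
    refine ((runs_vecCmd (I := I) aDir _ _ (t * d) (fun i => σ₂.arr aMom i / n -
      max 0 (1 - 5 * Δ) * σ₂.arr aDir (t * d + i)) hb ?_).weaken
        ?_).time_le ?_
    · intro j hj σ' hag' hi ha
      have hT : σ'.nat rT = t := (hag'.nat rT rfl).trans hr₂.round
      refine ⟨?_, ?_, ?_⟩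
      · simp only [NatExp.eval, hT]
      · simp only [RealExp.eval, NatExp.eval, hi, hT, hag'.arr aMom rfl, hag'.real xL rfl,
          hr₂.shift, (hag'.nat rN rfl).trans hr₂.count, ha, fill_apply_add]
      · simp only [RealExp.span, NatExp.eval, hi, hT]
        simp
        omega
    · intro σ₃ hag₃ h₃
      refine ⟨Ready.update_nat (hr₂.of_agree hag₃ ⟨rfl, rfl, rfl⟩ ⟨rfl, rfl, rfl⟩ rfl
        ((hag₃.pos rfl).trans hr₂.pos) (fun s _ => hag₃.cenAt_eq rfl s) (fun s hs => ?_)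
        (fun s _ => by rw [hag₃.arr aThr rfl]) (fun s _ => by rw [hag₃.arr aSz rfl]))
        (by decide) (k + 1), ?_, ?_⟩
      · rw [dirAt, h₃, vecAt_fill_block _ hs, dirAt]
      · change σ₃.pass = _
        rw [hag₃.pass rfl, hp₂, hp, Nat.add_assoc]
      · change dirAt σ₃ t = _
        have hc₁ : cenAt σ₁ t = wMean S ω := (hag.cenAt_eq rfl t).trans hc
        rw [powerDir, pow_succ', Module.End.mul_apply, ← powerDir, ← hv,
          ← hs₂.dev_eq hr.weights hc₁, dirAt, h₃, vecAt_fill, dirAt, ← hag₂.arr aDir rfl]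
        ext i
        simp [div_eq_inv_mul]
    · simp only [RealExp.cost, NatExp.cost]
      omega
  · simp only [NatExp.cost]
    have h1 : d * 1 ≤ d * (M + 1) := Nat.mul_le_mul_left _ (by omega)
    have h2 : 1 * (d * (M + 1)) ≤ n * (d * (M + 1)) := Nat.mul_le_mul_right _ hn
    have : ℓ * (1 + (500 * (n * (d * (M + 1))) + (d * 30 + 6)) + 7)
        ≤ ℓ * (600 * (n * (d * (M + 1)))) := Nat.mul_le_mul_left _ (by omega)
    omega

lemma inner_self_vecAt (f : ℕ → ℝ) (o : ℕ) :
    ∑ i ∈ Finset.range d, f (o + i) * f (o + i) = ‖(vecAt f o : Pt d)‖ ^ 2 := by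
  rw [Finset.sum_range, EuclideanSpace.real_norm_sq_eq]
  exact Finset.sum_congr rfl fun i _ => by simp [sq]

lemma runs_scoreCmd (hI : ∀ p i, I.stream p i = S (π p i)) (hd : 0 < d) (hn : 0 < n) (ht : t ≤ M)
    (hm : (M + 1) * d ≤ m) (h : Ready S ℓ Δ t ω σ) (hc : cenAt σ t = wMean S ω) :
    Runs I scoreCmd σ (600 * (n * (d * (M + 1)))) m fun σ' =>
      Ready S ℓ Δ t ω σ' ∧ σ'.pass = σ.pass + 1 ∧
        σ'.arr aThr t = threshold I.ε Δ (dirAt σ t) ∧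
        σ'.real xB = scoreBound I.ε Δ (dirAt σ t) ⟪dirAt σ t, dev S Δ ω (dirAt σ t)⟫_ℝ ∧
        σ'.arr aSz t = if 4 * n * σ'.real xB < leftScore ω (scores S I.ε Δ ω (dirAt σ t)) 0 then
          1 / (4 * σ'.real xB) else 0 := by
  have hb := block_le ht hm
  have htm : t + 1 ≤ m := by
    have := Nat.le_mul_of_pos_right (M + 1) hd
    omega
  set v := dirAt σ t with hv
  refine (Runs.seq ((runs_sumCmd (I := I) (m := m) xV _
    (fun i => σ.arr aDir (t * d + i) * σ.arr aDir (t * d + i)) ?_).time_le (t' := d * 24 + 8) ?_)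
    (t₂ := 20 + (500 * (n * (d * (M + 1))) + 40)) fun σ₁ hag₁ h₁ => ?_).time_le ?_
  · intro k hk σ' hag' hi
    have hT : σ'.nat rT = t := (hag'.nat rT rfl).trans h.round
    constructor
    · simp only [RealExp.eval, NatExp.eval, hi, hT, hag'.arr aDir rfl]
    · simp only [RealExp.span, NatExp.eval, hi, hT]
      simp
      omega
  · simp [RealExp.cost, NatExp.cost]
  swap
  · have h1 : d * 1 ≤ d * (M + 1) := Nat.mul_le_mul_left _ (by omega)
    have h2 : 1 * (d * (M + 1)) ≤ n * (d * (M + 1)) := Nat.mul_le_mul_right _ hn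
    omega
  rw [inner_self_vecAt, ← dirAt, ← hv] at h₁
  have hT₁ : σ₁.nat rT = t := (hag₁.nat rT rfl).trans h.round
  refine Runs.seq (Q' := fun σ' =>
    σ'.arr aThr = Function.update (σ.arr aThr) t (threshold I.ε Δ v) ∧
    σ'.arr aSz = Function.update (σ.arr aSz) t 0)
    ((Runs.simple rfl ?_ ?_).time_le ?_) fun σ₂ hag₂ h₂ => ?_
  · simp only [rT] at hT₁
    simp [Cmd.SpanLe, RealExp.span, NatExp.eval, Cmd.sem, hT₁]
    omega
  · have e1 := (hag₁.real xD rfl).trans h.delta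
    have e2 := hag₁.arr aThr rfl
    have e3 := hag₁.arr aSz rfl
    simp only [rT, xD, xV, aThr, aSz] at hT₁ e1 e2 e3 h₁
    simp [RealExp.eval, NatExp.eval, Cmd.sem, hT₁, threshold, h₁, e1, e2, e3]
  · simp [Cmd.budget, RealExp.cost, NatExp.cost]
  have hag : Agree scoreCmd σ σ₂ := hag₁.seq_left.trans hag₂.seq_left.seq_right
  have hr₂ : Ready S ℓ Δ t ω σ₂ := h.of_agree hag ⟨rfl, rfl, rfl⟩ ⟨rfl, rfl, rfl⟩ rfl
    (by rw [hag₂.pos rfl, hag₁.pos rfl, h.pos]) (fun s _ => hag.cenAt_eq rfl s)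
    (fun s _ => hag.dirAt_eq rfl s)
    (fun s hs => by rw [h₂.1, Function.update_of_ne hs.ne])
    (fun s hs => by rw [h₂.2, Function.update_of_ne hs.ne])
  have hv₂ : dirAt σ₂ t = v := hag.dirAt_eq rfl t
  have hc₂ : cenAt σ₂ t = wMean S ω := (hag.cenAt_eq rfl t).trans hc
  refine Runs.seq (runs_passCmd_ready hI hd hn ht hm hr₂) fun σ₃ hag₃ h₃ => ?_
  obtain ⟨hr₃, hp₃, hs₃⟩ := h₃
  have hM := hs₃.inner_dev_eq (Δ := Δ) hn hr₂.weights hc₂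
  rw [hv₂] at hM
  -- The step size `0` was stored before this pass, so the remaining score it measures is the total
  -- score.
  have hF : σ₃.real xF = leftScore ω (scores S I.ε Δ ω v) 0 := by
    rw [hs₃.left, leftScore, hv₂, hc₂, h₂.1, h₂.2]
    simp only [hr₂.weights, Function.update_self, scores]
  have hV₃ : σ₃.real xV = ‖v‖ ^ 2 := by rw [hag₃.real xV rfl, hag₂.real xV rfl, h₁]
  have hthr₃ : σ₃.arr aThr = σ₂.arr aThr := hag₃.arr aThr rfl
  have hsz₃ : σ₃.arr aSz = σ₂.arr aSz := hag₃.arr aSz rfl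
  have hp₂ : σ₂.pass = σ.pass := by rw [hag₂.pass rfl, hag₁.pass rfl]
  set a := scoreBound I.ε Δ v ⟪v, dev S Δ ω v⟫_ℝ with ha
  refine ((Runs.seq (Q' := fun σ' => σ'.real xB = a) (t₂ := 20) ((Runs.simple rfl ?_ ?_).time_le
    (t' := 20) ?_) fun σ₄ hag₄ h₄ => ?_).weaken (Q := fun σ' =>
      σ'.arr aSz = Function.update (σ.arr aSz) t
        (if 4 * n * a < leftScore ω (scores S I.ε Δ ω v) 0 then 1 / (4 * a) else 0) ∧
      σ'.real xB = a) ?_)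
  · simp [Cmd.SpanLe, RealExp.span]
  · have e1 := hr₃.delta
    have e2 := hr₃.shift
    have e3 := hr₃.count
    simp only [rN, xD, xL, xM, xV] at hM e1 e2 e3 hV₃
    simp [RealExp.eval, NatExp.eval, Cmd.sem, e1, e2, e3, hV₃, hM, ha, scoreBound]
  · simp [Cmd.budget, RealExp.cost, NatExp.cost]
  · have e0 := (hag₄.nat rT rfl).trans hr₃.round
    have e3 := (hag₄.nat rN rfl).trans hr₃.count
    have e4 := (hag₄.real xF rfl).trans hF
    have e5 := ((hag₄.arr aSz rfl).trans hsz₃).trans h₂.2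
    simp only [rN, rT, xF, xB, aSz] at e0 e3 e4 e5 h₄
    refine (Runs.simple rfl ?_ ?_).time_le ?_
    · simp [Cmd.SpanLe, BoolExp.span, RealExp.span, NatExp.eval, e0]
      omega
    · simp only [Cmd.sem, BoolExp.Holds, RealExp.eval, NatExp.eval, e0, e3, e4, e5, h₄]
      simp only [Rat.cast_ofNat, aSz, xB, Rat.cast_one]
      split_ifs <;> simp [h₄, e5]
    · simp [Cmd.budget, BoolExp.cost, RealExp.cost, NatExp.cost]
  · rintro σ₅ hag₅ ⟨h5, h6⟩
    refine ⟨hr₃.of_agree hag₅ ⟨rfl, rfl, rfl⟩ ⟨rfl, rfl, rfl⟩ rfl ((hag₅.pos rfl).trans hr₃.pos)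
      (fun s _ => hag₅.cenAt_eq rfl s) (fun s _ => hag₅.dirAt_eq rfl s)
      (fun s _ => by rw [hag₅.arr aThr rfl]) (fun s hs => ?_), ?_, ?_, h6, ?_⟩
    · rw [h5, hsz₃, h₂.2, Function.update_of_ne hs.ne, Function.update_of_ne hs.ne]
    · rw [hag₅.pass rfl, hp₃, hp₂]
    · rw [hag₅.arr aThr rfl, hthr₃, h₂.1, Function.update_self]
    · rw [h5, h6, Function.update_self]

/-- One pass per halving, because the score that is left must be measured again for each new step
size. All `ℓ` passes are made even if nothing changes, in agreement with the iterate in `stepSize`.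
-/
lemma runs_halveCmd (hI : ∀ p i, I.stream p i = S (π p i)) (hd : 0 < d) (hn : 0 < n) (ht : t ≤ M)
    (hm : (M + 1) * d ≤ m) (h : Ready S ℓ Δ t ω σ) (hc : cenAt σ t = wMean S ω)
    (hthr : σ.arr aThr t = threshold I.ε Δ (dirAt σ t)) :
    Runs I halveCmd σ (ℓ * (600 * (n * (d * (M + 1)))) + 6) m fun σ' =>
      Ready S ℓ Δ t ω σ' ∧ σ'.pass = σ.pass + ℓ ∧
        σ'.arr aSz t = (fun s => if leftScore ω (scores S I.ε Δ ω (dirAt σ t)) s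
          < 2 * n * σ.real xB then s / 2 else s)^[ℓ] (σ.arr aSz t) := by
  have htm : t + 1 ≤ m := by
    have := Nat.le_mul_of_pos_right (M + 1) hd
    omega
  set v := dirAt σ t with hv
  set f : ℝ → ℝ := fun s => if leftScore ω (scores S I.ε Δ ω v) s < 2 * n * σ.real xB then s / 2
    else s with hf
  refine ((Runs.forLoop (t := 500 * (n * (d * (M + 1))) + 20) ℓ (fun k σ' =>
    Ready S ℓ Δ t ω σ' ∧ σ'.pass = σ.pass + k ∧ σ'.arr aSz t = f^[k] (σ.arr aSz t)) rfl
    ?_ ?_ ?_).weaken fun _ _ h => h.2).time_le ?_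
  · exact fun σ' hag => (hag.nat rL rfl).trans h.power
  · exact ⟨h.update_nat (by decide) 0, rfl, rfl⟩
  · rintro k hk σ₁ hag - ⟨hr, hp, hs⟩
    refine Runs.seq (runs_passCmd_ready hI hd hn ht hm hr) fun σ₂ hag₂ h₂ => ?_
    obtain ⟨hr₂, hp₂, hs₂⟩ := h₂
    have hF : σ₂.real xF = leftScore ω (scores S I.ε Δ ω v) (σ₂.arr aSz t) := by
      rw [hs₂.left, leftScore, hag.dirAt_eq rfl t, hag.cenAt_eq rfl t, hc, hag.arr aThr rfl, hthr,
        hag₂.arr aSz rfl]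
      simp only [hr.weights, scores, hv]
    refine ((Runs.simple (Q := fun σ' =>
      σ'.arr aSz = Function.update (σ₂.arr aSz) t (f (σ₂.arr aSz t))) rfl ?_ ?_).weaken
      ?_).time_le ?_
    · have e0 := hr₂.round
      simp only [rT] at e0
      simp [Cmd.SpanLe, BoolExp.span, RealExp.span, NatExp.eval, e0]
      omega
    · have e0 := hr₂.round
      have e1 := hr₂.count
      have e2 := (hag₂.real xB rfl).trans (hag.real xB rfl)
      simp only [rT, rN, xB, xF, aSz] at e0 e1 e2 hF
      simp only [Cmd.sem, BoolExp.Holds, RealExp.eval, NatExp.eval, e0, e1, e2, hF, hf]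
      simp only [Rat.cast_ofNat, aSz, xB]
      split_ifs <;> simp
    · intro σ₃ hag₃ h₃
      refine ⟨Ready.update_nat (hr₂.of_agree hag₃ ⟨rfl, rfl, rfl⟩ ⟨rfl, rfl, rfl⟩ rfl
        ((hag₃.pos rfl).trans hr₂.pos) (fun s _ => hag₃.cenAt_eq rfl s)
        (fun s _ => hag₃.dirAt_eq rfl s) (fun s _ => by rw [hag₃.arr aThr rfl])
        (fun s hs => by rw [h₃, Function.update_of_ne hs.ne])) (by decide) (k + 1), ?_, ?_⟩
      · change σ₃.pass = _
        rw [hag₃.pass rfl, hp₂, hp, Nat.add_assoc]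
      · change σ₃.arr aSz t = _
        rw [h₃, Function.update_self, Function.iterate_succ_apply', ← hs, hag₂.arr aSz rfl]
    · simp [Cmd.budget, BoolExp.cost, RealExp.cost, NatExp.cost]
  · simp only [NatExp.cost]
    have h1 : d * 1 ≤ d * (M + 1) := Nat.mul_le_mul_left _ (by omega)
    have h2 : 1 * (d * (M + 1)) ≤ n * (d * (M + 1)) := Nat.mul_le_mul_right _ hn
    have : ℓ * (1 + (500 * (n * (d * (M + 1))) + 20) + 7)
        ≤ ℓ * (600 * (n * (d * (M + 1)))) := Nat.mul_le_mul_left _ (by omega)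
    omega

/-- The passes of a round are one for the mean, `ℓ` for the power method, one for the scores and `ℓ`
for the step size. The next `d` coins supply the signs. -/
lemma runs_roundCmd (hI : ∀ p i, I.stream p i = S (π p i)) (hd : 0 < d) (hn : 0 < n) (hℓ : 1 ≤ ℓ)
    (ht : t ≤ M) (hm : (M + 1) * d ≤ m) (h : Ready S ℓ Δ t ω σ) :
    Runs I roundCmd σ (2600 * (ℓ * (n * (d * (M + 1))))) m fun σ' =>
      Ready S ℓ Δ (t + 1) (filterRound S I.ε Δ ℓ ω fun i => I.coins (σ.coin + i))
        { σ' with nat := Function.update σ'.nat rT (t + 1) } ∧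
      σ'.pass = σ.pass + (2 * ℓ + 2) ∧ σ'.coin = σ.coin + d := by
  refine (Runs.seq (runs_meanCmd hI hd hn ht hm h) (t₂ := (d * 30 + 6) +
    ((ℓ * (600 * (n * (d * (M + 1)))) + 6) + (600 * (n * (d * (M + 1))) +
    (ℓ * (600 * (n * (d * (M + 1)))) + 6)))) fun σ₁ hag₁ h₁ => ?_).time_le ?_
  swap
  · have h1 : d * 1 ≤ d * (M + 1) := Nat.mul_le_mul_left _ (by omega)
    have h2 : 1 * (d * (M + 1)) ≤ n * (d * (M + 1)) := Nat.mul_le_mul_right _ hn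
    have h3 : 1 * (n * (d * (M + 1))) ≤ ℓ * (n * (d * (M + 1))) := Nat.mul_le_mul_right _ hℓ
    have h4 : ℓ * (600 * (n * (d * (M + 1)))) = 600 * (ℓ * (n * (d * (M + 1)))) := by ring
    omega
  obtain ⟨hr₁, hp₁, hc₁⟩ := h₁
  refine Runs.seq (runs_signCmd ht hm hr₁) fun σ₂ hag₂ h₂ => ?_
  obtain ⟨hr₂, hq₂, hv₂⟩ := h₂
  have hc₂ : cenAt σ₂ t = wMean S ω := (hag₂.cenAt_eq rfl t).trans hc₁
  refine Runs.seq (runs_powerCmd hI hd hn ht hm hr₂ hc₂) fun σ₃ hag₃ h₃ => ?_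
  obtain ⟨hr₃, hp₃, hv₃⟩ := h₃
  have hc₃ : cenAt σ₃ t = wMean S ω := (hag₃.cenAt_eq rfl t).trans hc₂
  refine Runs.seq (runs_scoreCmd hI hd hn ht hm hr₃ hc₃) fun σ₄ hag₄ h₄ => ?_
  obtain ⟨hr₄, hp₄, hth₄, hB₄, hs₄⟩ := h₄
  have hc₄ : cenAt σ₄ t = wMean S ω := (hag₄.cenAt_eq rfl t).trans hc₃
  have hv₄ : dirAt σ₄ t = dirAt σ₃ t := hag₄.dirAt_eq rfl t
  rw [← hv₄] at hth₄
  refine (runs_halveCmd hI hd hn ht hm hr₄ hc₄ hth₄).weaken fun σ₅ hag₅ h₅ => ?_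
  obtain ⟨hr₅, hp₅, hs₅⟩ := h₅
  refine ⟨⟨hr₅.count, hr₅.power, by simp, hr₅.delta, hr₅.shift, hr₅.pos,
    fun i => ?_⟩, ?_, ?_⟩
  · have hw := hr₅.weights i
    -- The weight after `t + 1` filters is by definition the old weight divided by the factor of
    -- filter `t`, whose data have just been computed.
    change weightOf σ₅ (S i) t / (1 + σ₅.arr aSz t * excess (dirAt σ₅ t) (cenAt σ₅ t)
      (σ₅.arr aThr t) (S i)) = _
    have hq₁ : σ₁.coin = σ.coin := hag₁.coin rfl
    rw [hw, hag₅.dirAt_eq rfl t, hag₅.cenAt_eq rfl t, hag₅.arr aThr rfl, hth₄, hs₅, hc₄, hs₄, hB₄,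
      hv₄, hv₃, hv₂, hq₁]
    rfl
  · rw [hp₅, hp₄, hp₃, hag₂.pass rfl, hp₁]
    omega
  · rw [hag₅.coin rfl, hag₄.coin rfl, hag₃.coin rfl, hq₂, hag₁.coin rfl]

end Specs

end StreamRAM

/-! ### The whole program: parameters, rough centre, filters. -/

namespace StreamRAM

open RobustMean

/-- Compute all filters and output the mean of the filtered points. -/
def filterCmd : Code :=
  .seq (.forLoop rT (.mul (.mul (.lit 16) (.reg rL)) (.reg rL)) roundCmd)
    (.seq passCmd (vecCmd aOut (.lit 0) (.div (.arr aSum (.reg rI)) (.reg xS))))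

/-- Count the points and compute the parameters. -/
def initCmd : Code :=
  .seq (.forStream (.setNat rN (.add (.reg rN) (.lit 1))))
    (.seq
      (.seq (.setReal xD (.div (.mul .delta .delta) .eps))
        (.seq (.setReal xR (.div (.mul (.mul (.lit 100) (.ofNat .dim)) (.add (.lit 1) (.reg xD)))
            .eps))
          (.seq (.setReal xY (.lit 1))
            (.seq (.setReal xL (.sub (.lit 1) (.mul (.lit 5) (.reg xD))))
              (.ite (.realLt (.lit 0) (.reg xL)) .skip (.setReal xL (.lit 0)))))))
      (.loop (.realLt (.reg xY) (.div (.mul (.lit 1000) (.ofNat .dim)) (.mul (.mul .eps .eps) .tau)))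
        (.seq (.setReal xY (.mul (.reg xY) (.lit 2))) (.setNat rL (.add (.reg rL) (.lit 1))))))

/-- Choose a random position, which may lie beyond the end of the stream. -/
def bitsCmd : Code :=
  .seq (.seq (.setNat rU (.lit 0)) (.setNat rY (.lit 1)))
    (.loop (.natLt (.reg rY) (.reg rN))
      (.seq (.flip rB) (.seq (.setNat rU (.add (.mul (.lit 2) (.reg rU)) (.reg rB)))
        (.setNat rY (.mul (.lit 2) (.reg rY))))))

/-- Make the point at the chosen position the candidate. -/
def pickCmd : Code :=
  .seq (.setNat rP (.lit 0))
    (.forStream (.seq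
      (.ite (.conj (.neg (.natLt (.reg rP) (.reg rU))) (.neg (.natLt (.reg rU) (.reg rP))))
        (vecCmd aCand (.lit 0) (.item (.reg rI))) .skip)
      (.setNat rP (.add (.reg rP) (.lit 1)))))

/-- Count the points near the candidate. -/
def nearCmd : Code :=
  .seq (.setNat rC (.lit 0))
    (.forStream (.seq (distCmd aCand)
      (.ite (.realLt (.mul (.lit 4) (.reg xR)) (.reg xA)) .skip
        (.setNat rC (.add (.reg rC) (.lit 1))))))

/-- Accept the candidate if most points are near it. -/
def acceptCmd : Code :=
  .ite (.natLt (.reg rN) (.mul (.lit 2) (.reg rC))) (vecCmd aC0 (.lit 0) (.arr aCand (.reg rI)))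
    .skip

/-- Try one candidate for the rough centre. -/
def candidateCmd : Code := .seq bitsCmd (.seq pickCmd (.seq nearCmd acceptCmd))

/-- Find a rough centre. -/
def centreCmd : Code := .forLoop rJ (.mul (.lit 2) (.reg rL)) candidateCmd

/-- The code of the robust mean estimator. -/
def estimatorCmd : Code := .seq initCmd (.seq centreCmd filterCmd)

section Specs

variable {d n : ℕ} {I : Input d n} {S : Fin n → Pt d} {π : ℕ → Equiv.Perm (Fin n)} {ℓ : ℕ} {Δ : ℝ}
  {ω : Fin n → ℝ} {σ : St d} {m : ℕ}

lemma runs_filterCmd (hI : ∀ p i, I.stream p i = S (π p i)) (hd : 0 < d) (hn : 0 < n) (hℓ : 1 ≤ ℓ)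
    (hm : (16 * ℓ ^ 2 + 1) * d ≤ m)
    (h : Ready S ℓ Δ 0 ω { σ with nat := Function.update σ.nat rT 0 }) :
    Runs I filterCmd σ (3300 * ((16 * ℓ ^ 2 + 1) * (ℓ * (n * (d * (16 * ℓ ^ 2 + 1)))))) m fun σ' =>
      σ'.pass = σ.pass + (16 * ℓ ^ 2 * (2 * ℓ + 2) + 1) ∧
      (vecAt (σ'.arr aOut) 0 : Pt d) = wMean S (rounds S I.ε Δ ℓ ω (16 * ℓ ^ 2)
        fun t i => I.coins (σ.coin + t * d + i)) := by
  set M := 16 * ℓ ^ 2 with hM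
  have hdm : d ≤ m := by have := block_le (Nat.zero_le M) hm; omega
  refine (Runs.seq ((Runs.forLoop (t := 2600 * (ℓ * (n * (d * (M + 1))))) M (fun k σ' =>
    Ready S ℓ Δ k (rounds S I.ε Δ ℓ ω k fun t i => I.coins (σ.coin + t * d + i)) σ' ∧
      σ'.pass = σ.pass + k * (2 * ℓ + 2) ∧ σ'.coin = σ.coin + k * d) rfl ?_ ?_ ?_).weaken
      fun _ _ h => h.2) (t₂ := 500 * (n * (d * (M + 1))) + (d * 18 + 6))
      fun σ₁ hag₁ h₁ => ?_).time_le ?_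
  · intro σ' hag
    have : σ'.nat rL = ℓ := (hag.nat rL rfl).trans h.power
    simp only [NatExp.eval, this, hM]
    ring
  · exact ⟨h, by simp, by simp⟩
  · rintro k hk σ₁ hag - ⟨hr, hp, hq⟩
    refine (runs_roundCmd hI hd hn hℓ hk.le hm hr).weaken ?_
    rintro σ₂ hag₂ ⟨hr₂, hp₂, hq₂⟩
    refine ⟨?_, ?_, ?_⟩
    · rw [hq] at hr₂
      exact hr₂
    · change σ₂.pass = _
      rw [hp₂, hp]
      ring
    · change σ₂.coin = _
      rw [hq₂, hq]
      ring
  · obtain ⟨hr₁, hp₁, -⟩ := h₁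
    refine Runs.seq (runs_passCmd_ready hI hd hn le_rfl hm hr₁) fun σ₂ hag₂ h₂ => ?_
    obtain ⟨hr₂, hp₂, hs₂⟩ := h₂
    refine ((runs_vecCmd (I := I) aOut _ _ 0 (fun i => σ₂.arr aSum i / σ₂.real xS) (by omega)
      ?_).weaken ?_).time_le ?_
    · intro k hk σ' hag' hi _
      refine ⟨rfl, ?_, ?_⟩
      · simp only [RealExp.eval, NatExp.eval, hi, hag'.arr aSum rfl, hag'.real xS rfl]
      · simp only [RealExp.span, NatExp.eval, hi]
        simp
        omega
    · intro σ₃ hag₃ h₃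
      refine ⟨?_, ?_⟩
      · rw [hag₃.pass rfl, hp₂, hp₁, Nat.add_assoc]
      · rw [h₃, vecAt_fill, ← hs₂.mean_eq hr₁.weights]
        ext i
        simp [div_eq_inv_mul]
    · simp only [RealExp.cost, NatExp.cost]
      omega
  · have h1 : d * 1 ≤ d * (M + 1) := Nat.mul_le_mul_left _ (by omega)
    have h2 : 1 * (d * (M + 1)) ≤ n * (d * (M + 1)) := Nat.mul_le_mul_right _ hn
    have h3 : 1 * (n * (d * (M + 1))) ≤ ℓ * (n * (d * (M + 1))) := Nat.mul_le_mul_right _ hℓ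
    set K := ℓ * (n * (d * (M + 1))) with hK
    have h4 : M * (1 + 1 + 1 + 1 + 1 + 2600 * K + 7) ≤ M * (2612 * K) := Nat.mul_le_mul_left _ (by omega)
    have h5 : 3300 * ((M + 1) * K) = M * (2612 * K) + 688 * (M * K) + 3300 * K := by ring
    have h6 := Nat.zero_le (M * K)
    simp only [NatExp.cost]
    omega

/-- No real number can be converted to a natural one, so the logarithm `ℓ` is found by doubling a
real register and counting the doublings. -/
lemma runs_initCmd {ℓ : ℕ} (h0 : σ.pos = 0) (hN : σ.nat rN = 0) (hL : σ.nat rL = 0)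
    (hlt : ∀ k < ℓ, (2 : ℝ) ^ k < 1000 * d / (I.ε ^ 2 * I.τ))
    (hle : 1000 * d / (I.ε ^ 2 * I.τ) ≤ 2 ^ ℓ) :
    Runs I initCmd σ (n * (d + 8) + 30 * ℓ + 70) m fun σ' =>
      σ'.nat rN = n ∧ σ'.nat rL = ℓ ∧ σ'.real xD = I.δ ^ 2 / I.ε ∧
      σ'.real xR = pruneSq d I.ε (I.δ ^ 2 / I.ε) ∧
      σ'.real xL = max 0 (1 - 5 * (I.δ ^ 2 / I.ε)) ∧ σ'.pos = 0 ∧ σ'.pass = σ.pass + 1 := by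
  refine (Runs.seq ((Runs.forStream (t := 4) (fun k σ' => σ'.nat rN = k) rfl h0 hN ?_).weaken
    (Q' := fun σ' => σ'.nat rN = n ∧ σ'.pos = 0 ∧ σ'.pass = σ.pass + 1) ?_)
      (t₂ := 45 + (ℓ * 21 + 21)) fun σ₁ hag₁ h₁ => ?_).time_le ?_
  · intro k hk σ' _ _ hinv
    refine (Runs.simple rfl (by exact trivial) ?_).time_le ?_
    · simp only [rN] at hinv
      simp [Cmd.sem, NatExp.eval, hinv]
    · simp [Cmd.budget, NatExp.cost]
  · rintro σ' - ⟨σ'', h, rfl⟩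
    exact ⟨h, rfl, rfl⟩
  · obtain ⟨hN₁, hpos₁, hpass₁⟩ := h₁
    refine Runs.seq (Q' := fun σ' => σ'.real xY = 1 ∧ σ'.real xD = I.δ ^ 2 / I.ε ∧
      σ'.real xR = pruneSq d I.ε (I.δ ^ 2 / I.ε) ∧
      σ'.real xL = max 0 (1 - 5 * (I.δ ^ 2 / I.ε)))
      ((Runs.simple rfl ?_ ?_).time_le ?_) fun σ₂ hag₂ h₂ => ?_
    · simp [Cmd.SpanLe, BoolExp.span, RealExp.span]
    · simp only [Cmd.sem, BoolExp.Holds, RealExp.eval, NatExp.eval, Function.update_self, pruneSq]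
      split_ifs with hpos
      · rw [max_eq_right]
        · simp [sq]
        · simpa [sq] using hpos.le
      · rw [max_eq_left]
        · simp [sq]
        · simpa [sq] using hpos
    · simp [Cmd.budget, BoolExp.cost, RealExp.cost, NatExp.cost]
    · refine ((Runs.loop (t := 8) ℓ (fun k σ' => σ'.real xY = 2 ^ k ∧ σ'.nat rL = k)
        ?_ ?_ ?_).weaken ?_).time_le ?_
      · exact ⟨by simp [h₂.1], by rw [hag₂.nat rL rfl, hag₁.nat rL rfl, hL]⟩
      · rintro k hk σ' hag ⟨hY, hk'⟩
        refine ⟨?_, ?_, (Runs.simple rfl ?_ ?_).time_le ?_⟩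
        · simp only [BoolExp.Holds, RealExp.eval, NatExp.eval, hY]
          simpa [sq] using hlt k hk
        · simp [BoolExp.span, RealExp.span]
        · simp [Cmd.SpanLe, RealExp.span]
        · simp only [xY, rL] at hY hk'
          simp [Cmd.sem, RealExp.eval, NatExp.eval, hY, hk', pow_succ]
        · simp [Cmd.budget, RealExp.cost, NatExp.cost]
      · rintro σ' hag ⟨hY, hk'⟩
        refine ⟨?_, ?_⟩
        · simp only [BoolExp.Holds, RealExp.eval, NatExp.eval, hY]
          simpa [sq] using hle
        · simp [BoolExp.span, RealExp.span]
      · rintro σ' hag ⟨-, hk'⟩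
        refine ⟨?_, hk', ?_, ?_, ?_, ?_, ?_⟩
        · rw [hag.nat rN rfl, hag₂.nat rN rfl, hN₁]
        · rw [hag.real xD rfl, h₂.2.1]
        · rw [hag.real xR rfl, h₂.2.2.1]
        · rw [hag.real xL rfl, h₂.2.2.2]
        · rw [hag.pos rfl, hag₂.pos rfl, hpos₁]
        · rw [hag.pass rfl, hag₂.pass rfl, hpass₁]
      · simp only [BoolExp.cost, RealExp.cost, NatExp.cost]
        omega
  · have : n * (4 + d + 4) = n * (d + 8) := by ring
    omega

/-- Binary digits are appended until the power of two reaches `n`. The position is uniform below `2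
^ k`, and no rejection loop is needed that could run on without bound. -/
lemma runs_bitsCmd {k : ℕ} (hN : σ.nat rN = n) (hlt : ∀ j < k, 2 ^ j < n) (hle : n ≤ 2 ^ k) :
    Runs I bitsCmd σ (k * 20 + 10) m fun σ' =>
      σ'.nat rU = bitsVal k (fun i => I.coins (σ.coin + i)) ∧ σ'.coin = σ.coin + k := by
  refine (Runs.seq (Q' := fun σ' => σ'.nat rU = 0 ∧ σ'.nat rY = 1) (Runs.simple rfl ?_ ?_)
    (t₂ := k * 20 + 4) fun σ₁ hag₁ h₁ => ?_).time_le ?_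
  · simp [Cmd.SpanLe]
  · simp [Cmd.sem, NatExp.eval]
  · refine ((Runs.loop (t := 15) k (fun j σ' => σ'.nat rY = 2 ^ j ∧
      σ'.nat rU = bitsVal j (fun i => I.coins (σ.coin + i)) ∧ σ'.coin = σ.coin + j)
      ?_ ?_ ?_).weaken fun _ _ h => h.2).time_le ?_
    · exact ⟨h₁.2, h₁.1, hag₁.coin rfl⟩
    · rintro j hj σ' hag ⟨hY, hU, hq⟩
      have hN' : σ'.nat rN = n := by rw [hag.nat rN rfl, hag₁.nat rN rfl, hN]
      refine ⟨?_, Nat.zero_le _, (Runs.simple rfl ?_ ?_).time_le ?_⟩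
      · simp only [BoolExp.Holds, NatExp.eval, hY, hN']
        exact hlt j hj
      · simp [Cmd.SpanLe]
      · simp only [rY, rU] at hY hU
        simp [Cmd.sem, NatExp.eval, hY, hU, hq, bitsVal, pow_succ, Nat.add_assoc, Nat.mul_comm]
      · simp [Cmd.budget, NatExp.cost]
    · rintro σ' hag ⟨hY, -, -⟩
      have hN' : σ'.nat rN = n := by rw [hag.nat rN rfl, hag₁.nat rN rfl, hN]
      refine ⟨?_, Nat.zero_le _⟩
      simp only [BoolExp.Holds, NatExp.eval, hY, hN']
      omega
    · simp only [BoolExp.cost, NatExp.cost]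
      omega
  · simp only [Cmd.budget, NatExp.cost]
    omega

/-- A position beyond the end of the stream leaves the previous candidate in place, as in `pointAt`.
-/
lemma runs_pickCmd (hd : 0 < d) (hdm : d ≤ m) (hpos : σ.pos = 0) :
    Runs I pickCmd σ (n * (60 * d) + 6) m fun σ' =>
      σ'.pos = 0 ∧ σ'.pass = σ.pass + 1 ∧
      (vecAt (σ'.arr aCand) 0 : Pt d) =
        pointAt (I.stream σ.pass) (σ.nat rU) (vecAt (σ.arr aCand) 0) := by
  refine (Runs.seq (Q' := fun σ' => σ'.nat rP = 0) (Runs.simple rfl ?_ ?_)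
    (t₂ := n * (60 * d) + 4) fun σ₁ hag₁ h₁ => ?_).time_le ?_
  · simp [Cmd.SpanLe]
  · simp [Cmd.sem, NatExp.eval]
  · have hpass₁ : σ₁.pass = σ.pass := hag₁.pass rfl
    refine ((Runs.forStream (t := 54 * d) (fun k σ' => σ'.nat rP = k ∧
      (vecAt (σ'.arr aCand) 0 : Pt d) = if h : σ.nat rU < n ∧ σ.nat rU < k then
        I.stream σ.pass ⟨σ.nat rU, h.1⟩ else vecAt (σ.arr aCand) 0) rfl
      ((hag₁.pos rfl).trans hpos) ?_ ?_).weaken ?_).time_le ?_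
    · exact ⟨h₁, by rw [dif_neg (by omega), hag₁.arr aCand rfl]⟩
    · rintro k hk σ' hag - ⟨hP, hv⟩
      have hU : σ'.nat rU = σ.nat rU := (hag.nat rU rfl).trans (hag₁.nat rU rfl)
      rw [hpass₁]
      refine (Runs.seq (Q' := fun σ'' => (vecAt (σ''.arr aCand) 0 : Pt d) =
        if h : σ.nat rU < n ∧ σ.nat rU < k + 1 then I.stream σ.pass ⟨σ.nat rU, h.1⟩
          else vecAt (σ.arr aCand) 0) (Runs.ite (t₁ := d * 14 + 6) (t₂ := 1) ?_ (fun hc => ?_)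
            fun hc => ?_) (t₂ := 4) fun σ₂ hag₂ h₂ => ?_).time_le ?_
      · simp [BoolExp.span]
      · simp only [BoolExp.Holds, NatExp.eval, hP, hU] at hc
        have hUk : σ.nat rU = k := by omega
        refine ((runs_vecCmd (I := I) aCand _ _ 0 (fun i => coord (I.stream σ.pass ⟨k, hk⟩) i)
          (by omega) ?_).weaken ?_).time_le ?_
        · intro j hj σ'' hag'' hi _
          refine ⟨rfl, ?_, ?_⟩
          · simp only [RealExp.eval, NatExp.eval, hi, hag''.item rfl, coord]
          · simp [RealExp.span]
        · intro σ'' _ h''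
          rw [h'', vecAt_fill, dif_pos (by omega)]
          simp only [hUk]
          ext i
          simp
        · simp [RealExp.cost, NatExp.cost]
      · simp only [BoolExp.Holds, NatExp.eval, hP, hU] at hc
        refine Runs.simple rfl trivial ?_
        have : (σ.nat rU < n ∧ σ.nat rU < k + 1) ↔ (σ.nat rU < n ∧ σ.nat rU < k) := by omega
        simp only [this]
        exact hv
      · refine (Runs.simple rfl (by exact trivial) ?_).time_le ?_
        · have hP₂ := (hag₂.nat rP rfl).trans hP
          simp only [rP] at hP₂
          simp only [Cmd.sem]
          exact ⟨by simp [NatExp.eval, hP₂], h₂⟩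
        · simp [Cmd.budget, NatExp.cost]
      · simp only [BoolExp.cost, NatExp.cost]
        omega
    · rintro σ' - ⟨σ'', ⟨-, h⟩, rfl⟩
      refine ⟨rfl, by simp only [hpass₁], ?_⟩
      change (vecAt (σ''.arr aCand) 0 : Pt d) = _
      rw [h, pointAt]
      simp only [and_self]
    · have : n * (54 * d + d + 4) ≤ n * (60 * d) := Nat.mul_le_mul_left _ (by omega)
      omega
  · simp only [Cmd.budget, NatExp.cost]
    omega

lemma runs_nearCmd (hI : ∀ p i, I.stream p i = S (π p i)) (hd : 0 < d) (hdm : d ≤ m)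
    (hpos : σ.pos = 0) :
    Runs I nearCmd σ (n * (60 * d) + 6) m fun σ' =>
      σ'.pos = 0 ∧ σ'.pass = σ.pass + 1 ∧
      (σ.nat rN < 2 * σ'.nat rC ↔ σ.nat rN < 2 * (Finset.univ.filter fun i =>
        ‖S i - vecAt (σ.arr aCand) 0‖ ^ 2 ≤ 4 * σ.real xR).card) := by
  set c : Pt d := vecAt (σ.arr aCand) 0 with hc
  refine (Runs.seq (Q' := fun σ' => σ'.nat rC = 0) (Runs.simple rfl ?_ ?_)
    (t₂ := n * (60 * d) + 4) fun σ₁ hag₁ h₁ => ?_).time_le ?_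
  · simp [Cmd.SpanLe]
  · simp [Cmd.sem, NatExp.eval]
  · have hpass₁ : σ₁.pass = σ.pass := hag₁.pass rfl
    refine ((Runs.forStream (t := 40 * d + 10) (fun k σ' => σ'.nat rC = partialSum (fun i =>
      if ‖I.stream σ.pass i - c‖ ^ 2 ≤ 4 * σ.real xR then 1 else 0) k) rfl
      ((hag₁.pos rfl).trans hpos) ?_ ?_).weaken ?_).time_le ?_
    · simpa using h₁
    · rintro k hk σ' hag - hinv
      rw [hpass₁]
      refine (Runs.seq (runs_distCmd aCand hd hdm) (t₂ := 10) fun σ₂ hag₂ h₂ => ?_)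
      have hA : σ₂.real xA = ‖I.stream σ.pass ⟨k, hk⟩ - c‖ ^ 2 := by
        rw [h₂]
        simp only [hag.arr aCand rfl, hag₁.arr aCand rfl, hc]
      have hR : σ₂.real xR = σ.real xR := by
        rw [hag₂.real xR rfl]
        exact (hag.real xR rfl).trans (hag₁.real xR rfl)
      have hC := (hag₂.nat rC rfl).trans hinv
      refine (Runs.simple rfl ?_ ?_).time_le ?_
      · simp [Cmd.SpanLe, BoolExp.span, RealExp.span]
      · rw [partialSum_succ _ hk, ← hC]
        simp only [Cmd.sem, BoolExp.Holds, RealExp.eval, hA, hR]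
        by_cases hlt : 4 * σ.real xR < ‖I.stream σ.pass ⟨k, hk⟩ - c‖ ^ 2
        · rw [if_pos (by simpa using hlt), if_neg hlt.not_ge, Nat.add_zero]
        · rw [if_neg (by simpa using hlt), if_pos (not_lt.1 hlt)]
          simp [NatExp.eval]
      · simp [Cmd.budget, BoolExp.cost, RealExp.cost, NatExp.cost]
    · rintro σ' - ⟨σ'', h, rfl⟩
      refine ⟨rfl, by simp only [hpass₁], ?_⟩
      change _ < 2 * σ''.nat rC ↔ _
      rw [h, partialSum_self, Finset.card_filter]
      simp only [hI]
      rw [Equiv.sum_comp (π σ.pass) fun i => if ‖S i - c‖ ^ 2 ≤ 4 * σ.real xR then 1 else 0]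
    · have : n * (40 * d + 10 + d + 4) ≤ n * (60 * d) := Nat.mul_le_mul_left _ (by omega)
      omega
  · simp only [Cmd.budget, NatExp.cost]
    omega

lemma runs_acceptCmd (hdm : d ≤ m) :
    Runs I acceptCmd σ (d * 14 + 12) m fun σ' => (vecAt (σ'.arr aC0) 0 : Pt d) =
      if σ.nat rN < 2 * σ.nat rC then vecAt (σ.arr aCand) 0 else vecAt (σ.arr aC0) 0 := by
  refine (Runs.ite (t₁ := d * 14 + 6) (t₂ := 1) ?_ (fun h => ?_) fun h => ?_).time_le ?_
  · simp [BoolExp.span]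
  · simp only [BoolExp.Holds, NatExp.eval] at h
    rw [if_pos h]
    refine ((runs_vecCmd (I := I) aC0 _ _ 0 (fun i => σ.arr aCand i) (by omega) ?_).weaken
      ?_).time_le ?_
    · intro j hj σ'' hag'' hi _
      refine ⟨rfl, ?_, ?_⟩
      · simp only [RealExp.eval, NatExp.eval, hi, hag''.arr aCand rfl]
      · simp only [RealExp.span, NatExp.eval, hi]
        omega
    · intro σ'' _ h''
      rw [h'', vecAt_fill]
      ext i
      simp
    · simp [RealExp.cost, NatExp.cost]
  · simp only [BoolExp.Holds, NatExp.eval] at h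
    rw [if_neg h]
    exact Runs.simple rfl trivial rfl
  · simp only [BoolExp.cost, NatExp.cost]
    omega

open Classical in
lemma runs_candidateCmd (hI : ∀ p i, I.stream p i = S (π p i)) (hd : 0 < d) (hdm : d ≤ m)
    {k : ℕ} (hlt : ∀ j < k, 2 ^ j < n) (hle : n ≤ 2 ^ k) (hN : σ.nat rN = n) (hpos : σ.pos = 0)
    {r : ℝ} (hr : 4 * σ.real xR = r) {cand : Pt d} (hcand : cand = pointAt (I.stream σ.pass)
      (bitsVal k fun i => I.coins (σ.coin + i)) (vecAt (σ.arr aCand) 0)) :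
    Runs I candidateCmd σ (k * 20 + n * (120 * d) + d * 14 + 40) m fun σ' =>
      σ'.pos = 0 ∧ σ'.pass = σ.pass + 2 ∧ σ'.coin = σ.coin + k ∧
      vecAt (σ'.arr aCand) 0 = cand ∧
      vecAt (σ'.arr aC0) 0 = if Accepted S r cand then cand else vecAt (σ.arr aC0) 0 := by
  refine (Runs.seq (runs_bitsCmd hN hlt hle) (t₂ := n * (60 * d) + 6 + (n * (60 * d) + 6 +
    (d * 14 + 12))) fun σ₁ hag₁ h₁ => ?_).time_le ?_
  swap
  · have : n * (120 * d) = n * (60 * d) + n * (60 * d) := by ring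
    omega
  obtain ⟨hU₁, hq₁⟩ := h₁
  refine Runs.seq (runs_pickCmd hd hdm ((hag₁.pos rfl).trans hpos)) fun σ₂ hag₂ h₂ => ?_
  obtain ⟨hpos₂, hp₂, hc₂⟩ := h₂
  rw [hU₁, hag₁.pass rfl, hag₁.arr aCand rfl, ← hcand] at hc₂
  refine Runs.seq (runs_nearCmd hI hd hdm hpos₂) fun σ₃ hag₃ h₃ => ?_
  obtain ⟨hpos₃, hp₃, hC₃⟩ := h₃
  refine (runs_acceptCmd hdm).weaken fun σ₄ hag₄ h₄ => ?_
  refine ⟨?_, ?_, ?_, ?_, ?_⟩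
  · rw [hag₄.pos rfl, hpos₃]
  · rw [hag₄.pass rfl, hp₃, hp₂, hag₁.pass rfl]
  · rw [hag₄.coin rfl, hag₃.coin rfl, hag₂.coin rfl, hq₁]
  · rw [hag₄.arr aCand rfl, hag₃.arr aCand rfl, hc₂]
  · have hN₂ : σ₂.nat rN = n := by rw [hag₂.nat rN rfl, hag₁.nat rN rfl, hN]
    have hR₂ : σ₂.real xR = σ.real xR := by rw [hag₂.real xR rfl, hag₁.real xR rfl]
    rw [hc₂, hR₂, hr, hN₂] at hC₃
    rw [h₄, hag₃.nat rN rfl, hN₂, hag₃.arr aCand rfl, hc₂, hag₃.arr aC0 rfl, hag₂.arr aC0 rfl,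
      hag₁.arr aC0 rfl]
    refine if_congr (hC₃.trans ?_) rfl rfl
    rw [Accepted]

/-- Each candidate takes two passes, one to fetch it and one to count the points near it, so
candidate `j` is read in the arrangement of pass `σ.pass + 2 * j`; it consumes `k` coins. -/
lemma runs_centreCmd (hI : ∀ p i, I.stream p i = S (π p i)) (hd : 0 < d) (hdm : d ≤ m)
    {k : ℕ} (hlt : ∀ j < k, 2 ^ j < n) (hle : n ≤ 2 ^ k) (hN : σ.nat rN = n) (hL : σ.nat rL = ℓ)
    (hpos : σ.pos = 0) (hcoin : σ.coin = 0) (hcand : (vecAt (σ.arr aCand) 0 : Pt d) = 0)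
    (hcen : (vecAt (σ.arr aC0) 0 : Pt d) = 0) {r : ℝ} (hr : 4 * σ.real xR = r) :
    Runs I centreCmd σ (2 * ℓ * (k * 20 + n * (120 * d) + d * 14 + 50) + 8) m fun σ' =>
      σ'.pos = 0 ∧ σ'.pass = σ.pass + 2 * (2 * ℓ) ∧ σ'.coin = 2 * ℓ * k ∧
      vecAt (σ'.arr aC0) 0 = (centreSeq S (fun j => I.stream (σ.pass + 2 * j)) r (2 * ℓ)
        fun j => bitsVal k fun i => I.coins (j * k + i)).2 := by
  refine ((Runs.forLoop (t := k * 20 + n * (120 * d) + d * 14 + 40) (2 * ℓ) (fun N σ' =>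
      σ'.pos = 0 ∧ σ'.pass = σ.pass + 2 * N ∧ σ'.coin = N * k ∧
      vecAt (σ'.arr aCand) 0 = (centreSeq S (fun j => I.stream (σ.pass + 2 * j)) r N
        fun j => bitsVal k fun i => I.coins (j * k + i)).1 ∧
      vecAt (σ'.arr aC0) 0 = (centreSeq S (fun j => I.stream (σ.pass + 2 * j)) r N
        fun j => bitsVal k fun i => I.coins (j * k + i)).2) rfl ?_ ?_ ?_).weaken ?_).time_le ?_
  · intro σ' hag
    simp only [NatExp.eval, (hag.nat rL rfl).trans hL]
  · exact ⟨hpos, rfl, by simpa using hcoin, hcand, hcen⟩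
  · rintro N hN' σ₁ hag - ⟨h1, h2, h3, h4, h5⟩
    refine (runs_candidateCmd hI hd hdm hlt hle ((hag.nat rN rfl).trans hN) h1
      (r := r) (by rw [hag.real xR rfl, hr]) rfl).weaken ?_
    rintro σ₂ - ⟨g1, g2, g3, g4, g5⟩
    rw [h2, h3, h4] at g4 g5
    rw [h5] at g5
    refine ⟨g1, ?_, ?_, g4, g5⟩
    · change σ₂.pass = _
      rw [g2, h2]
      ring
    · change σ₂.coin = _
      rw [g3, h3]
      ring
  · rintro σ' - ⟨-, h1, h2, h3, -, h5⟩
    exact ⟨h1, h2, h3, h5⟩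
  · simp only [NatExp.cost]
    have : 2 * ℓ * (1 + 1 + 1 + (k * 20 + n * (120 * d) + d * 14 + 40) + 7)
      = 2 * ℓ * (k * 20 + n * (120 * d) + d * 14 + 50) := by ring
    omega

end Specs

end StreamRAM

/-! ### Resource bounds and conclusion. -/

namespace StreamRAM

open RobustMean

/-- The robust mean estimator. -/
def estimator : Program where
  numNat := 12
  numReal := 12
  numArr := 9
  code := estimatorCmd
  output := aOut

section Estimator

variable {d n : ℕ} {I : Input d n} {S : Fin n → Pt d} {π : ℕ → Equiv.Perm (Fin n)} {ℓ k : ℕ}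

lemma runs_estimatorCmd (hI : ∀ p i, I.stream p i = S (π p i)) (hd : 0 < d) (hn : 0 < n)
    (hℓ : 1 ≤ ℓ) (hℓlt : ∀ j < ℓ, (2 : ℝ) ^ j < 1000 * d / (I.ε ^ 2 * I.τ))
    (hℓle : 1000 * d / (I.ε ^ 2 * I.τ) ≤ 2 ^ ℓ) (hk : ∀ j < k, 2 ^ j < n) (hk' : n ≤ 2 ^ k) :
    Runs I estimatorCmd (State.start d 12 12 9) (2000000 * (ℓ ^ 5 * (n * d))) (17 * ℓ ^ 2 * d)
      fun σ => σ.pass + 1 ≤ 71 * ℓ ^ 3 ∧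
        vecAt (σ.arr aOut) 0 = finalMean S (fun j i => S (π (1 + 2 * j) i)) I.ε (I.δ ^ 2 / I.ε) ℓ k
          (fun j i => I.coins (j * k + i)) (fun t i => I.coins (2 * ℓ * k + t * d + i)) := by
  have hsq : 1 ≤ ℓ ^ 2 := Nat.one_le_pow _ _ hℓ
  have hm : (16 * ℓ ^ 2 + 1) * d ≤ 17 * ℓ ^ 2 * d := Nat.mul_le_mul_right _ (by omega)
  have hdm : d ≤ 17 * ℓ ^ 2 * d := Nat.le_mul_of_pos_left _ (by omega)
  refine (Runs.seq (runs_initCmd rfl rfl rfl hℓlt hℓle)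
    (t₂ := (2 * ℓ * (k * 20 + n * (120 * d) + d * 14 + 50) + 8) +
      3300 * ((16 * ℓ ^ 2 + 1) * (ℓ * (n * (d * (16 * ℓ ^ 2 + 1))))))
    fun σ₁ hag₁ h₁ => ?_).time_le ?_
  · obtain ⟨hN, hL, hD, hR, hX, hpos, hpass⟩ := h₁
    refine Runs.seq (runs_centreCmd hI hd hdm hk hk' hN hL hpos (hag₁.coin rfl) ?_ ?_
      (r := 4 * pruneSq d I.ε (I.δ ^ 2 / I.ε)) (by rw [hR])) fun σ₂ hag₂ h₂ => ?_
    · rw [hag₁.arr aCand rfl]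
      rfl
    · rw [hag₁.arr aC0 rfl]
      rfl
    obtain ⟨hpos₂, hpass₂, hcoin₂, hcen₂⟩ := h₂
    have hpass₁ : σ₁.pass = 1 := hpass
    have hready : Ready S ℓ (I.δ ^ 2 / I.ε) 0 (pruneWeights S (16 * pruneSq d I.ε (I.δ ^ 2 / I.ε))
        (vecAt (σ₂.arr aC0) 0)) { σ₂ with nat := Function.update σ₂.nat rT 0 } := by
      refine ⟨(hag₂.nat rN rfl).trans hN, (hag₂.nat rL rfl).trans hL, by simp,
        (hag₂.real xD rfl).trans hD, (hag₂.real xL rfl).trans hX, hpos₂, fun i => ?_⟩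
      simp only [weightOf, weightAt, pruneWeights, (hag₂.real xR rfl).trans hR]
    refine (runs_filterCmd hI hd hn hℓ hm hready).weaken fun σ₃ hag₃ h₃ => ⟨?_, ?_⟩
    -- One pass counts the points, `4 ℓ` test candidates, `16 ℓ² (2 ℓ + 2)` build filters and one
    -- forms the output. The last rewind also counts, and `32 + 32 + 4 + 3 = 71`.
    · rw [h₃.1, hpass₂, hpass₁]
      have h1 : ℓ ^ 3 = ℓ * ℓ ^ 2 := by ring
      have h2 : ℓ * 1 ≤ ℓ * ℓ ^ 2 := Nat.mul_le_mul_left _ hsq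
      have h3 : 16 * ℓ ^ 2 * (2 * ℓ + 2) = 32 * (ℓ * ℓ ^ 2) + 32 * ℓ ^ 2 := by ring
      have h4 : 1 * ℓ ^ 2 ≤ ℓ * ℓ ^ 2 := Nat.mul_le_mul_right _ hℓ
      omega
    · have hpts : (fun j => I.stream (1 + 2 * j)) = fun j i => S (π (1 + 2 * j) i) :=
        funext fun j => funext fun i => hI _ i
      rw [h₃.2, hcoin₂, hcen₂, hpass₁, hpts]
      rfl
  -- The cost of drawing a position is logarithmic in `n` and is absorbed by the cost of reading the
  -- stream, so no factor `log n` enters the bounds.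
  · have hkn : k ≤ n := by
      rcases k with _ | k
      · omega
      · have := hk k (by omega)
        have := Nat.lt_two_pow_self (n := k)
        omega
    have e1 : 1 * ℓ ≤ ℓ ^ 5 := by
      have := Nat.pow_le_pow_right hℓ (show 1 ≤ 5 by norm_num)
      simpa using this
    have e2 : 1 * d ≤ n * d := Nat.mul_le_mul_right _ hn
    have e3 : n * 1 ≤ n * d := Nat.mul_le_mul_left _ hd
    have e4 : ℓ * (n * d) ≤ ℓ ^ 5 * (n * d) := Nat.mul_le_mul_right _ (by omega)
    have e5 : ℓ * 1 ≤ ℓ * (n * d) := Nat.mul_le_mul_left _ (by omega)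
    have e6 : 1 * (n * d) ≤ ℓ * (n * d) := Nat.mul_le_mul_right _ hℓ
    have e7 : 2 * ℓ * (k * 20 + n * (120 * d) + d * 14 + 50) ≤ 2 * ℓ * (204 * (n * d)) := by
      refine Nat.mul_le_mul_left _ ?_
      have : n * (120 * d) = 120 * (n * d) := by ring
      omega
    have e8 : 2 * ℓ * (204 * (n * d)) = 408 * (ℓ * (n * d)) := by ring
    have e9 : (16 * ℓ ^ 2 + 1) * (ℓ * (n * (d * (16 * ℓ ^ 2 + 1))))
        ≤ (17 * ℓ ^ 2) * (ℓ * (n * (d * (17 * ℓ ^ 2)))) := by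
      have : 16 * ℓ ^ 2 + 1 ≤ 17 * ℓ ^ 2 := by omega
      gcongr
    have e10 : (17 * ℓ ^ 2) * (ℓ * (n * (d * (17 * ℓ ^ 2)))) = 289 * (ℓ ^ 5 * (n * d)) := by ring
    have e11 : n * (d + 8) = n * d + 8 * n := by ring
    omega

lemma estimator_halts (hI : ∀ p i, I.stream p i = S (π p i)) (hd : 0 < d) (hn : 0 < n)
    (hℓ : 1 ≤ ℓ) (hℓlt : ∀ j < ℓ, (2 : ℝ) ^ j < 1000 * d / (I.ε ^ 2 * I.τ))
    (hℓle : 1000 * d / (I.ε ^ 2 * I.τ) ≤ 2 ^ ℓ) (hk : ∀ j < k, 2 ^ j < n) (hk' : n ≤ 2 ^ k) :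
    ∃ s, estimator.HaltsIn I s ∧ estimator.passes s ≤ 71 * ℓ ^ 3 ∧
      s.time ≤ 2000000 * (ℓ ^ 5 * (n * d)) ∧ estimator.memory s ≤ 178 * (ℓ ^ 2 * d) ∧
      estimator.result s = finalMean S (fun j i => S (π (1 + 2 * j) i)) I.ε (I.δ ^ 2 / I.ε) ℓ k
        (fun j i => I.coins (j * k + i)) (fun t i => I.coins (2 * ℓ * k + t * d + i)) := by
  obtain ⟨s, h1, h2, h3, ⟨h4, h5⟩, -⟩ :=
    runs_estimatorCmd hI hd hn hℓ hℓlt hℓle hk hk' (State.start d 12 12 9) rfl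
  refine ⟨s, h1, h4, ?_, ?_, ?_⟩
  · simpa [State.start] using h2
  · have h6 : s.span ≤ 17 * ℓ ^ 2 * d := by simpa [State.start] using h3
    have h7 : 1 * d ≤ ℓ ^ 2 * d := Nat.mul_le_mul_right _ (Nat.one_le_pow _ _ hℓ)
    have h8 : 17 * ℓ ^ 2 * d = 17 * (ℓ ^ 2 * d) := by ring
    -- The constant is `24 + 9 * 17 + 1 = 178`.
    change 12 + 12 + 9 * s.span + d ≤ _
    omega
  · rw [← h5]
    ext i
    simp [Program.result, State.core, estimator]

end Estimator

/-- The logarithmic bound for the number of power steps. -/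
lemma exists_power_steps {d : ℕ} {ε τ : ℝ} (hd : 0 < d) (hε : 0 < ε) (hε1 : ε < 1) (hτ : 0 < τ)
    (hτ1 : τ < 1) :
    ∃ ℓ : ℕ, 1 ≤ ℓ ∧ (∀ j < ℓ, (2 : ℝ) ^ j < 1000 * d / (ε ^ 2 * τ)) ∧
      1000 * d / (ε ^ 2 * τ) ≤ 2 ^ ℓ ∧
      (ℓ : ℝ) ≤ 12 * (1 + Real.log d + Real.log (1 / ε) + Real.log (1 / τ)) := by
  set X : ℝ := 1000 * d / (ε ^ 2 * τ) with hX
  have hd1 : (1 : ℝ) ≤ d := by exact_mod_cast hd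
  have hden : 0 < ε ^ 2 * τ := by positivity
  have hden1 : ε ^ 2 * τ ≤ 1 := by
    have := pow_le_one₀ (n := 2) hε.le hε1.le
    nlinarith
  have hX1 : 1 < X := by
    rw [hX, lt_div_iff₀ hden]
    linarith
  have hex : ∃ ℓ : ℕ, X ≤ 2 ^ ℓ := by
    obtain ⟨ℓ, h⟩ := pow_unbounded_of_one_lt X (one_lt_two : (1 : ℝ) < 2)
    exact ⟨ℓ, h.le⟩
  classical
  have hlt : ∀ j < Nat.find hex, (2 : ℝ) ^ j < X := fun j hj => not_le.1 (Nat.find_min hex hj)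
  have hle := Nat.find_spec hex
  set ℓ := Nat.find hex with hℓ
  have hpos : 1 ≤ ℓ := by
    by_contra h
    have : ℓ = 0 := by omega
    rw [this, pow_zero] at hle
    linarith
  refine ⟨ℓ, hpos, hlt, hle, ?_⟩
  have h1 := hlt (ℓ - 1) (by omega)
  have h2 := Real.log_lt_log (by positivity) h1
  rw [Real.log_pow, Nat.cast_sub hpos, Nat.cast_one] at h2
  have hld := Real.log_nonneg hd1
  have hle1 : 0 ≤ Real.log (1 / ε) := Real.log_nonneg (by rw [le_div_iff₀ hε]; linarith)
  have hlt1 : 0 ≤ Real.log (1 / τ) := Real.log_nonneg (by rw [le_div_iff₀ hτ]; linarith)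
  have h3 : Real.log X = Real.log 1000 + Real.log d + (2 * Real.log (1 / ε) + Real.log (1 / τ)) := by
    rw [hX, Real.log_div (by positivity) (by positivity), Real.log_mul (by norm_num) (by positivity),
      Real.log_mul (by positivity) (by positivity), Real.log_pow, one_div, one_div, Real.log_inv,
      Real.log_inv]
    push_cast
    ring
  have h4 : Real.log 1000 ≤ 7 := by
    have : Real.log 1000 ≤ Real.log (2 ^ 10) := Real.log_le_log (by norm_num) (by norm_num)
    rw [Real.log_pow] at this
    have := Real.log_two_lt_d9
    push_cast at *
    linarith
  have h5 := Real.log_two_gt_d9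
  have hcast : (1 : ℝ) ≤ ℓ := by exact_mod_cast hpos
  have h6 : ((ℓ : ℝ) - 1) * 0.69 ≤ ((ℓ : ℝ) - 1) * Real.log 2 :=
    -- Minimality gives `2 ^ (ℓ - 1) < X`, hence `0.69 (ℓ - 1) ≤ 7 + 2 (log d + log (1 / ε) + log (1
    -- / τ))`, which the factor 12 covers.
    mul_le_mul_of_nonneg_left (by linarith) (by linarith)
  linarith

end StreamRAM

theorem mainTheorem3 :
    ∃ (P : StreamRAM.Program) (C ε₀ A : ℝ) (m : ℕ),
      1 ≤ C ∧ 0 < ε₀ ∧ C * ε₀ ≤ 1 / 2 ∧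
      ∀ (d n : ℕ) (ε δ τ : ℝ) (μ : RobustMean.Pt d) (S₀ S : Fin n → RobustMean.Pt d)
        (order : ℕ → Equiv.Perm (Fin n)),
        0 < d → 0 < n → 0 < ε → ε < ε₀ → ε ≤ δ → 0 < τ → τ < 1 →
        RobustMean.IsStable (C * ε) δ μ S₀ →
        RobustMean.IsCorrupted ε S₀ S →
        (∀ coins : ℕ → Bool, ∃ s,
          P.HaltsIn ⟨ε, δ, τ, fun p i => S (order p i), coins⟩ s ∧
          (P.passes s : ℝ) ≤ polylogBound A m d ε τ ∧
          (s.time : ℝ) ≤ n * d * polylogBound A m d ε τ ∧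
          (P.memory s : ℝ) ≤ d * polylogBound A m d ε τ) ∧
        1 - τ ≤ StreamRAM.fairCoins.real
          {coins | ∃ s, P.HaltsIn ⟨ε, δ, τ, fun p i => S (order p i), coins⟩ s ∧
            ‖μ - P.result s‖ ≤ A * δ} := by
  -- `C = 4` is the fraction of good weight that `Setting` allows to be missing. The exponent 5 is
  -- two for the rounds, one for the passes in a round and two for recomputing weights; `10 ^ 12`
  -- exceeds `2000000 * 12 ^ 5` and also the accuracy constant 66.
  refine ⟨StreamRAM.estimator, 4, 1 / 10000, 10 ^ 12, 5, by norm_num, by norm_num, by norm_num, ?_⟩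
  intro d n ε δ τ μ S₀ S order hd hn hε hε₀ hδ hτ hτ1 hst hco
  obtain ⟨ℓ, hℓ, hℓlt, hℓle, hℓlog⟩ :=
    StreamRAM.exists_power_steps hd hε (by linarith : ε < 1) hτ hτ1
  have hk : ∀ j < Nat.clog 2 n, 2 ^ j < n := fun j hj =>
    (Nat.lt_clog_iff_pow_lt Nat.one_lt_two).1 hj
  have hk' : n ≤ 2 ^ Nat.clog 2 n := Nat.le_pow_clog Nat.one_lt_two n
  have hrun := fun coins : ℕ → Bool => StreamRAM.estimator_halts
    (I := ⟨ε, δ, τ, fun p i => S (order p i), coins⟩) (S := S) (π := order) (fun _ _ => rfl)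
    hd hn hℓ hℓlt hℓle hk hk'
  set Λ := 1 + Real.log d + Real.log (1 / ε) + Real.log (1 / τ) with hΛ
  have hℓ0 : (1 : ℝ) ≤ ℓ := by exact_mod_cast hℓ
  have hΛ5 : (ℓ : ℝ) ^ 5 ≤ 248832 * Λ ^ 5 := by
    calc (ℓ : ℝ) ^ 5 ≤ (12 * Λ) ^ 5 := pow_le_pow_left₀ (by positivity) hℓlog 5
      _ = 248832 * Λ ^ 5 := by ring
  have hbound : 2000000 * (ℓ : ℝ) ^ 5 ≤ polylogBound (10 ^ 12) 5 d ε τ := by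
    rw [polylogBound, ← hΛ]
    have : 0 ≤ (ℓ : ℝ) ^ 5 := by positivity
    linarith
  refine ⟨fun coins => ?_, ?_⟩
  · obtain ⟨s, h1, h2, h3, h4, -⟩ := hrun coins
    refine ⟨s, h1, ?_, ?_, ?_⟩
    · have h5 : (StreamRAM.estimator.passes s : ℝ) ≤ 71 * (ℓ : ℝ) ^ 3 := by exact_mod_cast h2
      have h6 : (ℓ : ℝ) ^ 3 ≤ ℓ ^ 5 := pow_le_pow_right₀ hℓ0 (by norm_num)
      have : 0 ≤ (ℓ : ℝ) ^ 5 := by positivity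
      linarith
    · have h5 : (s.time : ℝ) ≤ 2000000 * ((ℓ : ℝ) ^ 5 * (n * d)) := by exact_mod_cast h3
      have h6 := mul_le_mul_of_nonneg_left hbound (by positivity : (0 : ℝ) ≤ n * d)
      linarith
    · have h5 : (StreamRAM.estimator.memory s : ℝ) ≤ 178 * ((ℓ : ℝ) ^ 2 * d) := by exact_mod_cast h4
      have h6 : (ℓ : ℝ) ^ 2 ≤ ℓ ^ 5 := pow_le_pow_right₀ hℓ0 (by norm_num)
      have h7 := mul_le_mul_of_nonneg_left hbound (Nat.cast_nonneg d : (0 : ℝ) ≤ d)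
      have h8 := mul_le_mul_of_nonneg_right h6 (Nat.cast_nonneg d : (0 : ℝ) ≤ d)
      have h9 : 0 ≤ (ℓ : ℝ) ^ 5 * d := by positivity
      linarith
  · have hset := RobustMean.setting_of_stable hn hε hε₀.le hδ hst hco
    -- Minimality of the exponent: at least half of the bit strings are valid positions.
    have hk2 : 2 ^ Nat.clog 2 n ≤ 2 * n := by
      rcases Nat.eq_zero_or_pos (Nat.clog 2 n) with h | h
      · rw [h]
        omega
      · have := hk (Nat.clog 2 n - 1) (by omega)
        have h2 : 2 ^ Nat.clog 2 n = 2 * 2 ^ (Nat.clog 2 n - 1) := by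
          rw [← pow_succ', Nat.sub_add_cancel h]
        omega
    -- Pass 0 counts the points, so candidate `j` is fetched in pass `1 + 2 * j`. These are the only
    -- arrangements on which the output depends.
    refine (hset.probability_accurate hd (fun j => order (1 + 2 * j)) hk' hk2 hℓ hτ hτ1
      hℓle).trans (MeasureTheory.measureReal_mono (fun coins hc => ?_))
    obtain ⟨s, h1, -, -, -, h2⟩ := hrun coins
    refine ⟨s, h1, ?_⟩
    rw [h2]
    have h3 : (66 : ℝ) * δ ≤ 10 ^ 12 * δ := by
      have : 0 ≤ δ := by linarith
      linarith
    exact le_trans hc h3
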